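/- Let $M$ be a smooth manifold (Hausdorff, second countable, without boundary, of dimension $n$, not necessarily connected) with a smooth Riemannian metric $\mathrm{g}$ that is complete, i.e. for which $M$ is a complete metric space with respect to the Riemannian distance, and let $\mu$ be its Riemannian volume measure. Let $\mathcal{V}$ be a smooth complex vector bundle of finite rank over $M$ with a smooth Hermitian metric $\mathrm{h}$ and a smooth connection $\nabla$ which are compatible: $X\,\mathrm{h}(Y,Z)=\mathrm{h}(\nabla_X Y,Z)+\mathrm{h}(Y,\nabla_X Z)$ for all smooth sections $Y,Z$ of $\mathcal{V}$ and all tangent vectors $X$. Let $L^2(\mathcal{V})$ and $L^2(T^*M\otimes\mathcal{V})$ be the Hilbert spaces of $\mu$-measurable sections $\xi$ (modulo equality a.e.) with $\int_M|\xi|^2\,d\mu<\infty$, where $T^*M\otimes\mathcal{V}$ carries the metric induced by $\mathrm{g}$ and $\mathrm{h}$. Put $$S_1=\{u\in C^\infty(\mathcal{V})\cap L^2(\mathcal{V}) : \nabla u\in L^2(T^*M\otimes\mathcal{V})\},\qquad \|u\|_{W^{1,2}}=\|u\|_{L^2}+\|\nabla u\|_{L^2},$$ and let $W^{1,2}(\mathcal{V})$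 and $W^{1,2}_0(\mathcal{V})$ be the completions of $S_1$ and of $C_c^\infty(\mathcal{V})\subseteq S_1$ in the norm $\|\cdot\|_{W^{1,2}}$. Let $\nabla_2$ and $\nabla_c$ be the operators $u\mapsto\nabla u$ from $L^2(\mathcal{V})$ to $L^2(T^*M\otimes\mathcal{V})$ with domains $S_1$ and $C_c^\infty(\mathcal{V})$ respectively. Then: 1. $\nabla_2$ is densely defined and closable (hence its restriction $\nabla_c$ is closable too), and $W^{1,2}(\mathcal{V})=\mathcal{D}(\overline{\nabla_2})$; 2. $W^{1,2}_0(\mathcal{V})=\mathcal{D}(\overline{\nabla_c})$; 3. $W^{1,2}_0(\mathcal{V})=W^{1,2}(\mathcal{V})$. Here the equalities in 1 and 2 mean that the continuous extension to the completion of the inclusion of $S_1$ (respectively $C_c^\infty(\mathcal{V})$) in $L^2(\mathcal{V})$ is injective, has the stated domain as its image, and carries the norm of the completion to the graph norm $\|u\|+\|\overline{\nabla_2}u\|$ (respectively $\|u\|+\|\overline{\nabla_c}u\|$); the equality in 3 means that the images in $L^2(\mathcal{V})$ coincide and that the canonical map $W^{1,2}_0(\mathcal{V})\to W^{1,2}(\mathcal{V})$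 is bijective. -/

import Mathlib

open Bundle MeasureTheory Set
open scoped Manifold ContDiff Bundle ENNReal Topology

set_option linter.unusedSectionVars false

noncomputable section

namespace SobolevBundle

section Volume

local notation "𝔼" n:max => EuclideanSpace ℝ (Fin n)

variable (n : ℕ) {M : Type*} [TopologicalSpace M] [ChartedSpace (𝔼 n) M]
  [RiemannianBundle (fun x : M => TangentSpace (𝓡 n) x)]

/-- The derivative of the inverse of the chart `e` at the point with coordinates `y`. -/
def chartDiff (e : OpenPartialHomeomorph M (𝔼 n)) (y : 𝔼 n) :
    𝔼 n →ₗ[ℝ] TangentSpace (𝓡 n) (e.symm y) :=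
  (mfderiv (𝓡 n) (𝓡 n) e.symm y).toLinearMap

/-- The coordinate vector `∂ᵢ` of the chart `e` at the point with coordinates `y`. -/
def coordVector (e : OpenPartialHomeomorph M (𝔼 n)) (y : 𝔼 n) (i : Fin n) :
    TangentSpace (𝓡 n) (e.symm y) :=
  chartDiff n e y (EuclideanSpace.single i 1)

/-- The Riemannian density `√det (g(∂ᵢ, ∂ⱼ))` in the chart `e`. -/
def chartDensity (e : OpenPartialHomeomorph M (𝔼 n)) (y : 𝔼 n) : ℝ :=
  √ (Matrix.of fun i j : Fin n => inner ℝ (coordVector n e y i) (coordVector n e y j)).det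

/-- The measure `√det g dy` of the chart `e`, transported to `M`. -/
def chartMeasure [MeasurableSpace M] (e : OpenPartialHomeomorph M (𝔼 n)) : Measure M :=
  ((volume.restrict e.target).withDensity
    fun y => ENNReal.ofReal (chartDensity n e y)).map e.symm

/-- The Riemannian volume measure: the supremum of the measures `√det g dy` of the charts. These
agree on the overlaps of charts, so this is the measure which is `√det g dy` in every chart, see
`riemannianVolume_apply`. -/
def riemannianVolume [MeasurableSpace M] : Measure M :=
  ⨆ x : M, chartMeasure n (chartAt (𝔼 n) x)

variable {n}

instance (x : M) : FiniteDimensional ℝ (TangentSpace (𝓡 n) x) :=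
  inferInstanceAs (FiniteDimensional ℝ (𝔼 n))

theorem chartDensity_eq_normDet (e : OpenPartialHomeomorph M (𝔼 n)) (y : 𝔼 n) :
    chartDensity n e y = (chartDiff n e y).normDet := by
  have h := (chartDiff n e y).normDet_sq_eq_det_gram (EuclideanSpace.basisFun (Fin n) ℝ)
  have h2 : (Matrix.gram ℝ fun i => chartDiff n e y ((EuclideanSpace.basisFun (Fin n) ℝ) i)) =
      Matrix.of fun i j : Fin n => inner ℝ (coordVector n e y i) (coordVector n e y j) := by
    ext i j
    simp [Matrix.gram, coordVector]
  rw [h2] at h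
  rw [chartDensity, ← h]
  exact Real.sqrt_sq (LinearMap.normDet_nonneg _)

variable [IsManifold (𝓡 n) ∞ M]

theorem chartDensity_pos (p : M) {y : 𝔼 n} (hy : y ∈ (chartAt (𝔼 n) p).target) :
    0 < chartDensity n (chartAt (𝔼 n) p) y := by
  rw [chartDensity_eq_normDet]
  refine lt_of_le_of_ne (LinearMap.normDet_nonneg _) (Ne.symm ?_)
  rw [ne_eq, LinearMap.normDet_eq_zero_iff_ker_ne_bot, not_not, LinearMap.ker_eq_bot]
  have hm := mdifferentiable_of_mem_atlas (I := 𝓡 n) (chart_mem_atlas (𝔼 n) p)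
  exact hm.symm.mfderiv_injective (by simpa using hy)

/-- Transformation of the density under a change of charts. -/
theorem chartDensity_change (p q : M) {y : 𝔼 n} (hy : y ∈ (chartAt (𝔼 n) p).target)
    (hy' : (chartAt (𝔼 n) p).symm y ∈ (chartAt (𝔼 n) q).source) :
    chartDensity n (chartAt (𝔼 n) p) y =
      |(fderiv ℝ (fun z => chartAt (𝔼 n) q ((chartAt (𝔼 n) p).symm z)) y).det| *
        chartDensity n (chartAt (𝔼 n) q) (chartAt (𝔼 n) q ((chartAt (𝔼 n) p).symm y)) := by
  set e := chartAt (𝔼 n) p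
  set e' := chartAt (𝔼 n) q
  have hm := mdifferentiable_of_mem_atlas (I := 𝓡 n) (chart_mem_atlas (𝔼 n) p)
  have hm' := mdifferentiable_of_mem_atlas (I := 𝓡 n) (chart_mem_atlas (𝔼 n) q)
  have h1 : MDifferentiableAt (𝓡 n) (𝓡 n) (fun z => e' (e.symm z)) y :=
    (hm'.mdifferentiableAt hy').comp y (hm.mdifferentiableAt_symm hy)
  have hy2 : e' (e.symm y) ∈ e'.target := e'.map_source hy'
  have h2 : MDifferentiableAt (𝓡 n) (𝓡 n) e'.symm (e' (e.symm y)) :=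
    hm'.mdifferentiableAt_symm hy2
  have hev : (e.symm : 𝔼 n → M) =ᶠ[𝓝 y] e'.symm ∘ (fun z => e' (e.symm z)) := by
    have : e.symm ⁻¹' e'.source ∈ 𝓝 y :=
      (e.continuousAt_symm hy) (e'.open_source.mem_nhds hy')
    filter_upwards [this] with z hz
    exact (e'.left_inv hz).symm
  have hpt : e'.symm (e' (e.symm y)) = e.symm y := e'.left_inv hy'
  have hc := mfderiv_comp (I := 𝓡 n) (I' := 𝓡 n) (I'' := 𝓡 n) y h2 h1
  rw [chartDensity_eq_normDet, chartDensity_eq_normDet]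
  have hkey : ∀ (x x' : M) (hx : x = x') (A : 𝔼 n →ₗ[ℝ] TangentSpace (𝓡 n) x)
      (A' : 𝔼 n →ₗ[ℝ] TangentSpace (𝓡 n) x'), (∀ v, (A v : 𝔼 n) = (A' v : 𝔼 n)) →
      A.normDet = A'.normDet := by
    rintro x x' rfl A A' hA
    congr 1
    ext v : 1
    exact hA v
  rw [ContinuousLinearMap.det, ← LinearMap.normDet_eq_abs_det, mul_comm,
    ← LinearMap.normDet_comp_of_finrank_eq _ _ rfl]
  refine hkey _ _ hpt.symm _ _ ?_
  intro v
  rw [← mfderiv_eq_fderiv]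
  simp only [chartDiff]
  rw [hev.mfderiv_eq, hc]
  rfl

variable [IsContMDiffRiemannianBundle (𝓡 n) ∞ (𝔼 n) (fun x : M => TangentSpace (𝓡 n) x)]

theorem continuousOn_chartDensity (p : M) :
    ContinuousOn (chartDensity n (chartAt (𝔼 n) p)) (chartAt (𝔼 n) p).target := by
  set e := chartAt (𝔼 n) p
  have hv : ∀ i, ContinuousOn (fun y => (⟨e.symm y, coordVector n e y i⟩ :
      TotalSpace (𝔼 n) (fun x : M => TangentSpace (𝓡 n) x))) e.target := by
    intro i
    have h1 : ContMDiffOn (𝓡 n) (𝓡 n) 1 e.symm e.target :=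
      contMDiffOn_symm_of_mem_maximalAtlas
        (IsManifold.chart_mem_maximalAtlas (I := 𝓡 n) (n := 1) p)
    have h2 := h1.continuousOn_tangentMapWithin le_rfl e.open_target.uniqueMDiffOn
    have h3 : ContinuousOn (fun y : 𝔼 n => (⟨y, (EuclideanSpace.single i (1 : ℝ) : 𝔼 n)⟩ :
        TangentBundle (𝓡 n) (𝔼 n))) e.target := by
      have := (tangentBundleModelSpaceHomeomorph (𝓡 n)).symm.continuous.comp
        (Continuous.prodMk_left (X := 𝔼 n) (EuclideanSpace.single i (1 : ℝ) : 𝔼 n))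
      exact this.continuousOn
    refine (h2.comp h3 (fun y hy => hy)).congr ?_
    intro y hy
    simp only [Function.comp, tangentMapWithin, coordVector, chartDiff]
    rw [mfderivWithin_of_isOpen e.open_target hy]
    rfl
  unfold chartDensity
  refine Real.continuous_sqrt.comp_continuousOn ?_
  refine Continuous.comp_continuousOn (g := Matrix.det) (by fun_prop) ?_
  refine continuousOn_pi.2 fun i => continuousOn_pi.2 fun j => ?_
  have : IsContinuousRiemannianBundle (𝔼 n) (fun x : M => TangentSpace (𝓡 n) x) := by
    obtain ⟨g, hg, hg'⟩ := IsContMDiffRiemannianBundle.exists_contMDiff (IB := 𝓡 n) (n := ∞)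
      (F := 𝔼 n) (E := fun x : M => TangentSpace (𝓡 n) x)
    exact ⟨g, hg.continuous, hg'⟩
  exact (hv i).inner_bundle (hv j)

variable [MeasurableSpace M] [BorelSpace M]

theorem aemeasurable_chartDensity (p : M) :
    AEMeasurable (fun y => ENNReal.ofReal (chartDensity n (chartAt (𝔼 n) p) y))
      (volume.restrict (chartAt (𝔼 n) p).target) :=
  ((continuousOn_chartDensity p).aemeasurable
    (chartAt (𝔼 n) p).open_target.measurableSet).ennreal_ofReal

theorem aemeasurable_chart_symm (p : M) {μ : Measure (𝔼 n)}
    (hμ : μ ≪ volume.restrict (chartAt (𝔼 n) p).target) :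
    AEMeasurable (chartAt (𝔼 n) p).symm μ :=
  ((chartAt (𝔼 n) p).continuousOn_symm.aemeasurable
    (chartAt (𝔼 n) p).open_target.measurableSet).mono_ac hμ

theorem measurableSet_target_inter (e : OpenPartialHomeomorph M (𝔼 n)) {A : Set M}
    (hA : MeasurableSet A) : MeasurableSet (e.target ∩ e.symm ⁻¹' A) := by
  have h := (continuousOn_iff_continuous_domRestrict.1 e.continuousOn_symm).measurable hA
  have h2 := e.open_target.measurableSet.subtype_image h
  convert h2 using 1
  ext y
  simp [and_comm]

theorem chartMeasure_apply (p : M) {A : Set M} (hA : MeasurableSet A) :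
    chartMeasure n (chartAt (𝔼 n) p) A =
      ∫⁻ y in (chartAt (𝔼 n) p).target ∩ (chartAt (𝔼 n) p).symm ⁻¹' A,
        ENNReal.ofReal (chartDensity n (chartAt (𝔼 n) p) y) := by
  set e := chartAt (𝔼 n) p
  have hm : MeasurableSet (e.target ∩ e.symm ⁻¹' A) :=
    measurableSet_target_inter e hA
  have hac : (volume.restrict e.target).withDensity
      (fun y => ENNReal.ofReal (chartDensity n e y)) ≪ volume.restrict e.target :=
    withDensity_absolutelyContinuous _ _
  rw [chartMeasure, Measure.map_apply_of_aemeasurable (aemeasurable_chart_symm p hac) hA]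
  have h1 : (volume.restrict e.target).withDensity
      (fun y => ENNReal.ofReal (chartDensity n e y)) (e.symm ⁻¹' A) =
      (volume.restrict e.target).withDensity
      (fun y => ENNReal.ofReal (chartDensity n e y)) (e.target ∩ e.symm ⁻¹' A) := by
    have h0 : ∀ᵐ y ∂((volume.restrict e.target).withDensity
      (fun y => ENNReal.ofReal (chartDensity n e y))), y ∈ e.target :=
      hac.ae_le (ae_restrict_mem e.open_target.measurableSet)
    refine measure_congr ?_
    filter_upwards [h0] with y hy
    exact propext ⟨fun h => ⟨hy, h⟩, fun h => h.2⟩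
  rw [h1, withDensity_apply _ hm, Measure.restrict_restrict hm]
  congr 2
  ext y
  simp +contextual

theorem chartMeasure_eq_of_subset (p q : M) {A : Set M} (hA : MeasurableSet A)
    (hp : A ⊆ (chartAt (𝔼 n) p).source) (hq : A ⊆ (chartAt (𝔼 n) q).source) :
    chartMeasure n (chartAt (𝔼 n) p) A = chartMeasure n (chartAt (𝔼 n) q) A := by
  rw [chartMeasure_apply p hA, chartMeasure_apply q hA]
  set e := chartAt (𝔼 n) p
  set e' := chartAt (𝔼 n) q
  have hm : MeasurableSet (e.target ∩ e.symm ⁻¹' A) :=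
    measurableSet_target_inter e hA
  have hm1 := mdifferentiable_of_mem_atlas (I := 𝓡 n) (chart_mem_atlas (𝔼 n) p)
  have hm2 := mdifferentiable_of_mem_atlas (I := 𝓡 n) (chart_mem_atlas (𝔼 n) q)
  have himg : e'.target ∩ e'.symm ⁻¹' A =
      (fun z => e' (e.symm z)) '' (e.target ∩ e.symm ⁻¹' A) := by
    ext y
    constructor
    · rintro ⟨h1, h2⟩
      refine ⟨e (e'.symm y), ⟨e.map_source (hp h2), ?_⟩, ?_⟩
      · rw [mem_preimage, e.left_inv (hp h2)]; exact h2
      · simp only [e.left_inv (hp h2), e'.right_inv h1]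
    · rintro ⟨z, ⟨h1, h2⟩, rfl⟩
      refine ⟨e'.map_source (hq h2), ?_⟩
      rw [mem_preimage, e'.left_inv (hq h2)]; exact h2
  rw [himg, lintegral_image_eq_lintegral_abs_det_fderiv_mul volume hm
    (f' := fun y => fderiv ℝ (fun z => e' (e.symm z)) y)]
  · refine setLIntegral_congr_fun hm ?_
    intro y hy
    simp only
    rw [chartDensity_change p q hy.1 (hq hy.2), ENNReal.ofReal_mul (abs_nonneg _)]
  · intro y hy
    have h1 : MDifferentiableAt (𝓡 n) (𝓡 n) (fun z => e' (e.symm z)) y :=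
      (hm2.mdifferentiableAt (hq hy.2)).comp y (hm1.mdifferentiableAt_symm hy.1)
    exact h1.differentiableAt.hasFDerivAt.hasFDerivWithinAt
  · intro y hy z hz h
    have h2 := e'.injOn (hq hy.2) (hq hz.2) h
    exact e.symm.injOn hy.1 hz.1 h2

theorem chartMeasure_compl_source (p : M) :
    chartMeasure n (chartAt (𝔼 n) p) (chartAt (𝔼 n) p).sourceᶜ = 0 := by
  rw [chartMeasure_apply p (chartAt (𝔼 n) p).open_source.measurableSet.compl]
  have : (chartAt (𝔼 n) p).target ∩ (chartAt (𝔼 n) p).symm ⁻¹' (chartAt (𝔼 n) p).sourceᶜ = ∅ := by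
    ext y
    simp only [mem_inter_iff, mem_preimage, mem_compl_iff, mem_empty_iff_false, iff_false, not_and,
      not_not]
    exact fun h => (chartAt (𝔼 n) p).map_target h
  rw [this]
  simp

theorem chartMeasure_le_riemannianVolume (p : M) :
    chartMeasure n (chartAt (𝔼 n) p) ≤ riemannianVolume n :=
  le_iSup (fun x : M => chartMeasure n (chartAt (𝔼 n) x)) p

variable [SecondCountableTopology M]

/-- In every chart, the Riemannian volume measure is `√det g dy`. -/
theorem riemannianVolume_apply (p : M) {A : Set M} (hA : MeasurableSet A)
    (hp : A ⊆ (chartAt (𝔼 n) p).source) :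
    riemannianVolume n A = chartMeasure n (chartAt (𝔼 n) p) A := by
  refine le_antisymm ?_ (chartMeasure_le_riemannianVolume p A)
  have : Nonempty M := ⟨p⟩
  obtain ⟨s, hs, hsU⟩ := TopologicalSpace.countable_cover_nhds
    (fun x : M => (chartAt (𝔼 n) x).open_source.mem_nhds (mem_chart_source (𝔼 n) x))
  have hne : s.Nonempty := by
    by_contra h
    rw [not_nonempty_iff_eq_empty] at h
    simp only [h, mem_empty_iff_false, iUnion_of_empty, iUnion_empty] at hsU
    exact empty_ne_univ hsU
  obtain ⟨f, rfl⟩ := hs.exists_eq_range hne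
  set D : ℕ → Set M := disjointed fun k => (chartAt (𝔼 n) (f k)).source
  have hDm : ∀ k, MeasurableSet (D k) := fun k =>
    MeasurableSet.disjointed (fun k => (chartAt (𝔼 n) (f k)).open_source.measurableSet) k
  have hDs : ∀ k, D k ⊆ (chartAt (𝔼 n) (f k)).source := fun k => disjointed_subset _ k
  have hDU : ⋃ k, D k = univ := by
    rw [iUnion_disjointed, ← hsU, biUnion_range]
  have hDd : Pairwise (Function.onFun Disjoint D) := disjoint_disjointed _
  have hdec : ∀ (μ : Measure M) {B : Set M}, MeasurableSet B → μ B = ∑' k, μ (B ∩ D k) := by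
    intro μ B hB
    rw [← measure_iUnion (fun i j hij => (hDd hij).mono inter_subset_right inter_subset_right)
      (fun k => hB.inter (hDm k)), ← inter_iUnion, hDU, inter_univ]
  let ν : Measure M := Measure.sum fun k => (chartMeasure n (chartAt (𝔼 n) (f k))).restrict (D k)
  have hle : riemannianVolume n ≤ ν := by
    refine iSup_le fun q => Measure.le_iff.2 fun B hB => ?_
    rw [hdec _ hB, Measure.sum_apply _ hB]
    refine ENNReal.tsum_le_tsum fun k => ?_
    rw [Measure.restrict_apply hB]
    have h1 : chartMeasure n (chartAt (𝔼 n) q) (B ∩ D k) ≤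
        chartMeasure n (chartAt (𝔼 n) q) (B ∩ D k ∩ (chartAt (𝔼 n) q).source) := by
      refine (measure_mono_ae ?_)
      have h0 : (chartAt (𝔼 n) q).source ∈ ae (chartMeasure n (chartAt (𝔼 n) q)) :=
        mem_ae_iff.2 (chartMeasure_compl_source q)
      filter_upwards [h0] with x hx hx'
      exact ⟨hx', hx⟩
    refine h1.trans ?_
    rw [chartMeasure_eq_of_subset q (f k)
      ((hB.inter (hDm k)).inter (chartAt (𝔼 n) q).open_source.measurableSet) inter_subset_right
      (fun x hx => hDs k hx.1.2)]
    exact measure_mono inter_subset_left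
  refine (hle A).trans ?_
  rw [hdec (chartMeasure n (chartAt (𝔼 n) p)) hA, Measure.sum_apply _ hA]
  refine ENNReal.tsum_le_tsum fun k => ?_
  rw [Measure.restrict_apply hA, chartMeasure_eq_of_subset (f k) p (hA.inter (hDm k))
    (fun x hx => hDs k hx.2) (fun x hx => hp hx.1)]

instance isLocallyFiniteMeasure_riemannianVolume :
    IsLocallyFiniteMeasure (riemannianVolume n : Measure M) := by
  refine ⟨fun p => ?_⟩
  set e := chartAt (𝔼 n) p
  have hpt : e p ∈ e.target := mem_chart_target (𝔼 n) p
  have hc : ContinuousAt (chartDensity n e) (e p) :=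
    (continuousOn_chartDensity p).continuousAt (e.open_target.mem_nhds hpt)
  have h1 : ∀ᶠ y in 𝓝 (e p), chartDensity n e y < chartDensity n e (e p) + 1 :=
    hc.eventually_lt continuousAt_const (by simp)
  obtain ⟨r, hr, hrs⟩ := Metric.eventually_nhds_iff_ball.1
    (h1.and (e.open_target.mem_nhds hpt))
  refine ⟨e.source ∩ e ⁻¹' Metric.ball (e p) r, ?_, ?_⟩
  · exact Filter.inter_mem (e.open_source.mem_nhds (mem_chart_source (𝔼 n) p))
      ((e.continuousAt (mem_chart_source (𝔼 n) p)) (Metric.ball_mem_nhds _ hr))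
  · have hm : MeasurableSet (e.source ∩ e ⁻¹' Metric.ball (e p) r) :=
      (e.isOpen_inter_preimage Metric.isOpen_ball).measurableSet
    rw [riemannianVolume_apply p hm inter_subset_left, chartMeasure_apply p hm]
    calc _ ≤ ∫⁻ y in Metric.ball (e p) r, ENNReal.ofReal (chartDensity n e y) := by
          refine lintegral_mono_set ?_
          rintro y ⟨hy1, hy2⟩
          have := hy2.2
          rwa [mem_preimage, e.right_inv hy1] at this
      _ ≤ ∫⁻ y in Metric.ball (e p) r, ENNReal.ofReal (chartDensity n e (e p) + 1) := by
          refine setLIntegral_mono measurable_const fun y hy => ?_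
          exact ENNReal.ofReal_le_ofReal (hrs y hy).1.le
      _ < ⊤ := by
          rw [setLIntegral_const]
          exact ENNReal.mul_lt_top ENNReal.ofReal_lt_top measure_ball_lt_top

instance isOpenPosMeasure_riemannianVolume :
    (riemannianVolume n : Measure M).IsOpenPosMeasure := by
  refine ⟨fun U hU ⟨p, hp⟩ h0 => ?_⟩
  set e := chartAt (𝔼 n) p
  have h1 : chartMeasure n e U = 0 :=
    le_antisymm ((chartMeasure_le_riemannianVolume p U).trans_eq h0) zero_le
  rw [chartMeasure_apply p hU.measurableSet] at h1
  have ho : IsOpen (e.target ∩ e.symm ⁻¹' U) := e.isOpen_inter_preimage_symm hU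
  have h2 : (∀ᵐ y ∂(volume : Measure (𝔼 n)), y ∈ e.target ∩ e.symm ⁻¹' U →
      ENNReal.ofReal (chartDensity n e y) = 0) := by
    have hm : AEMeasurable (fun y => ENNReal.ofReal (chartDensity n e y))
        (volume.restrict (e.target ∩ e.symm ⁻¹' U)) :=
      (aemeasurable_chartDensity p).mono_measure (Measure.restrict_mono inter_subset_left le_rfl)
    exact (ae_restrict_iff' ho.measurableSet).1 ((lintegral_eq_zero_iff' hm).1 h1)
  have h3 : volume (e.target ∩ e.symm ⁻¹' U) = 0 := by
    rw [ae_iff] at h2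
    refine measure_mono_null (fun y hy => ?_) h2
    intro hcon
    exact (ENNReal.ofReal_pos.2 (chartDensity_pos p hy.1)).ne' (hcon hy)
  refine (ho.measure_pos volume ⟨e p, mem_chart_target (𝔼 n) p, ?_⟩).ne' h3
  rw [mem_preimage, e.left_inv (mem_chart_source (𝔼 n) p)]
  exact hp

end Volume

section L2

variable {M : Type*} [MeasurableSpace M] (μ : Measure M)
  (W : M → Type*) [∀ x, NormedAddCommGroup (W x)] [∀ x, InnerProductSpace ℂ (W x)]

/-- A family of Hermitian inner product spaces over a measure space together with a space of
sections, called measurable, whose pointwise inner products are `μ`-measurable. -/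
structure MeasurableField where
  /-- The measurable sections. -/
  measurableSections : Submodule ℂ (Π x, W x)
  aestronglyMeasurable_inner : ∀ u ∈ measurableSections, ∀ v ∈ measurableSections,
    AEStronglyMeasurable (fun x => inner ℂ (u x) (v x)) μ

variable {μ W} (𝓕 : MeasurableField μ W)

namespace MeasurableField

theorem aestronglyMeasurable_norm {u : Π x, W x} (hu : u ∈ 𝓕.measurableSections) :
    AEStronglyMeasurable (fun x => ‖u x‖) μ := by
  have h := (𝓕.aestronglyMeasurable_inner u hu u hu).norm
  have h2 := Real.continuous_sqrt.comp_aestronglyMeasurable h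
  refine h2.congr (Filter.Eventually.of_forall fun x => ?_)
  simp only [inner_self_eq_norm_sq_to_K, norm_pow, RCLike.norm_ofReal, abs_norm]
  exact Real.sqrt_sq (norm_nonneg _)

/-- The measurable sections `u` with `∫ ‖u‖² dμ < ∞`. -/
def sqIntegrable : Submodule ℂ (Π x, W x) where
  carrier := {u | u ∈ 𝓕.measurableSections ∧ ∫⁻ x, ‖u x‖ₑ ^ 2 ∂μ < ⊤}
  zero_mem' := ⟨Submodule.zero_mem _, by simp⟩
  add_mem' := by
    rintro u v ⟨hu, hu'⟩ ⟨hv, hv'⟩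
    refine ⟨Submodule.add_mem _ hu hv, ?_⟩
    have hb : ∀ x, ‖(u + v) x‖ₑ ^ 2 ≤ 2 * (‖u x‖ₑ ^ 2 + ‖v x‖ₑ ^ 2) := by
      intro x
      have h1 : ‖(u + v) x‖ ^ 2 ≤ 2 * (‖u x‖ ^ 2 + ‖v x‖ ^ 2) := by
        have := norm_add_le (u x) (v x)
        have h0 := norm_nonneg (u x + v x)
        rw [Pi.add_apply]
        nlinarith [sq_nonneg (‖u x‖ - ‖v x‖)]
      have h2 := ENNReal.ofReal_le_ofReal h1
      rw [ENNReal.ofReal_mul (by norm_num), ENNReal.ofReal_add (by positivity) (by positivity),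
        ENNReal.ofReal_pow (by positivity), ENNReal.ofReal_pow (by positivity),
        ENNReal.ofReal_pow (by positivity), ofReal_norm, ofReal_norm, ofReal_norm] at h2
      simpa using h2
    refine (lintegral_mono hb).trans_lt ?_
    have hm : AEMeasurable (fun x => ‖u x‖ₑ ^ 2) μ := by
      have := (𝓕.aestronglyMeasurable_norm hu).aemeasurable.ennreal_ofReal.pow_const 2
      simpa only [ofReal_norm] using this
    rw [lintegral_const_mul' _ _ (by simp), lintegral_add_left' hm]
    exact ENNReal.mul_lt_top (by simp) (ENNReal.add_lt_top.2 ⟨hu', hv'⟩)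
  smul_mem' := by
    rintro c u ⟨hu, hu'⟩
    refine ⟨Submodule.smul_mem _ c hu, ?_⟩
    simp only [Pi.smul_apply, enorm_smul, mul_pow]
    rw [lintegral_const_mul' _ _ (by simp)]
    exact ENNReal.mul_lt_top (by simp) hu'

/-- The square integrable sections, as a space carrying the `L²` seminorm. -/
def PreL2 : Type _ := 𝓕.sqIntegrable

instance : AddCommGroup 𝓕.PreL2 := inferInstanceAs (AddCommGroup 𝓕.sqIntegrable)

instance : Module ℂ 𝓕.PreL2 := inferInstanceAs (Module ℂ 𝓕.sqIntegrable)

/-- The section underlying an element of `PreL2`. -/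
def PreL2.val (u : 𝓕.PreL2) : Π x, W x := Subtype.val (p := (· ∈ 𝓕.sqIntegrable)) u

theorem integrable_norm_sq (u : 𝓕.PreL2) : Integrable (fun x => ‖u.val 𝓕 x‖ ^ 2) μ := by
  obtain ⟨u, hu, hu'⟩ := u
  refine ⟨(𝓕.aestronglyMeasurable_norm hu).pow 2, ?_⟩
  refine lt_of_eq_of_lt (lintegral_congr fun x => ?_) hu'
  rw [enorm_pow, enorm_norm]
  rfl

theorem integrable_inner (u v : 𝓕.PreL2) :
    Integrable (fun x => inner ℂ (u.val 𝓕 x) (v.val 𝓕 x)) μ := by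
  refine ((𝓕.integrable_norm_sq u).add (𝓕.integrable_norm_sq v)).mono'
    (𝓕.aestronglyMeasurable_inner _ u.2.1 _ v.2.1) (Filter.Eventually.of_forall fun x => ?_)
  refine (norm_inner_le_norm _ _).trans ?_
  simp only [Pi.add_apply]
  nlinarith [sq_nonneg (‖u.val 𝓕 x‖ - ‖v.val 𝓕 x‖), sq_nonneg (‖u.val 𝓕 x‖ + ‖v.val 𝓕 x‖)]

/-- The inner product `⟨u, v⟩ = ∫ h(u, v) dμ`. -/
@[reducible] def preInnerCore : PreInnerProductSpace.Core ℂ 𝓕.PreL2 where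
  inner u v := ∫ x, inner ℂ (u.val 𝓕 x) (v.val 𝓕 x) ∂μ
  conj_inner_symm u v := by
    rw [← integral_conj]
    simp
  re_inner_nonneg u := by
    have h : ∀ x, inner ℂ (u.val 𝓕 x) (u.val 𝓕 x) = ((‖u.val 𝓕 x‖ ^ 2 : ℝ) : ℂ) := fun x => by
      rw [inner_self_eq_norm_sq_to_K]; norm_num
    simp only [h]
    rw [integral_complex_ofReal]
    exact integral_nonneg fun x => by positivity
  add_left u v w := by
    rw [← integral_add (𝓕.integrable_inner u w) (𝓕.integrable_inner v w)]
    exact integral_congr_ae (Filter.Eventually.of_forall fun x => inner_add_left _ _ _)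
  smul_left u v c := by
    rw [← integral_const_mul]
    exact integral_congr_ae (Filter.Eventually.of_forall fun x => inner_smul_left _ _ _)

instance : SeminormedAddCommGroup 𝓕.PreL2 :=
  @InnerProductSpace.Core.toSeminormedAddCommGroup ℂ _ _ _ _ 𝓕.preInnerCore

instance : InnerProductSpace ℂ 𝓕.PreL2 := InnerProductSpace.ofCore 𝓕.preInnerCore

theorem norm_sq_preL2 (u : 𝓕.PreL2) : ‖u‖ ^ 2 = ∫ x, ‖u.val 𝓕 x‖ ^ 2 ∂μ := by
  rw [@norm_sq_eq_re_inner ℂ]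
  change RCLike.re (∫ x, inner ℂ (u.val 𝓕 x) (u.val 𝓕 x) ∂μ) = _
  have h : ∀ x, inner ℂ (u.val 𝓕 x) (u.val 𝓕 x) = ((‖u.val 𝓕 x‖ ^ 2 : ℝ) : ℂ) := fun x => by
    rw [inner_self_eq_norm_sq_to_K]; norm_num
  simp only [h]
  rw [integral_complex_ofReal]
  exact Complex.ofReal_re _

/-- The Hilbert space `L²` of square integrable sections modulo sections of norm `0`, that is,
modulo equality almost everywhere. -/
abbrev L2 : Type _ := SeparationQuotient 𝓕.PreL2

/-- The class in `L²` of a square integrable section. -/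
def toL2 : 𝓕.sqIntegrable →ₗ[ℂ] 𝓕.L2 where
  toFun u := SeparationQuotient.mk (show 𝓕.PreL2 from u)
  map_add' _ _ := rfl
  map_smul' _ _ := rfl

theorem toL2_eq_zero_iff (u : 𝓕.sqIntegrable) : 𝓕.toL2 u = 0 ↔ ∀ᵐ x ∂μ, u.1 x = 0 := by
  have h1 : 𝓕.toL2 u = 0 ↔ ‖(show 𝓕.PreL2 from u)‖ ^ 2 = 0 := by
    rw [sq_eq_zero_iff, ← norm_eq_zero (a := 𝓕.toL2 u)]
    rfl
  rw [h1, norm_sq_preL2, integral_eq_zero_iff_of_nonneg (fun x => by positivity)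
    (𝓕.integrable_norm_sq u)]
  refine Filter.eventually_congr (Filter.Eventually.of_forall fun x => ?_)
  simp only [Pi.zero_apply, sq_eq_zero_iff, norm_eq_zero]
  rfl

end MeasurableField

end L2

section Bundle

local notation "𝔼" n:max => EuclideanSpace ℝ (Fin n)

variable {M : Type*} [TopologicalSpace M] [MeasurableSpace M]

section MeasurableSection

variable (F : Type*) [TopologicalSpace F] (V : M → Type*) [TopologicalSpace (TotalSpace F V)]
  [∀ x, TopologicalSpace (V x)] [FiberBundle F V]

/-- A section is `μ`-measurable if it is so in the local trivializations. -/
def IsMeasurableSection (μ : Measure M) (u : Π x, V x) : Prop :=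
  ∀ x₀ : M, AEStronglyMeasurable (fun x => (trivializationAt F V x₀ ⟨x, u x⟩).2)
    (μ.restrict (trivializationAt F V x₀).baseSet)

theorem IsMeasurableSection.of_continuous [BorelSpace M] [SecondCountableTopology M]
    [TopologicalSpace.PseudoMetrizableSpace F] {μ : Measure M} {u : Π x, V x}
    (hu : Continuous fun x => TotalSpace.mk' F x (u x)) : IsMeasurableSection F V μ u := by
  intro x₀
  have h := (trivializationAt F V x₀).continuousOn.comp
    (s := (trivializationAt F V x₀).baseSet) hu.continuousOn
    (fun x hx => (trivializationAt F V x₀).mem_source.2 hx)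
  exact (continuous_snd.comp_continuousOn h).aestronglyMeasurable
    (trivializationAt F V x₀).open_baseSet.measurableSet

end MeasurableSection

variable (F : Type*) [NormedAddCommGroup F] [NormedSpace ℂ F] [FiniteDimensional ℂ F]
  (V : M → Type*) [TopologicalSpace (TotalSpace F V)] [∀ x, NormedAddCommGroup (V x)]
  [∀ x, InnerProductSpace ℂ (V x)] [FiberBundle F V] [VectorBundle ℝ F V] [VectorBundle ℂ F V]
  (n : ℕ) [ChartedSpace (𝔼 n) M]

/-- The fibrewise Hermitian inner product of a complex vector bundle over a real manifold depends
smoothly on the base point. -/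
class IsSmoothHermitianBundle : Prop where
  exists_contMDiff : ∃ h : Π x : M, V x →L[ℝ] V x →L[ℝ] ℂ,
    ContMDiff (𝓡 n) ((𝓡 n).prod 𝓘(ℝ, F →L[ℝ] F →L[ℝ] ℂ)) ∞
      (fun b => TotalSpace.mk' (F →L[ℝ] F →L[ℝ] ℂ) b (h b)) ∧
    ∀ (x : M) (v w : V x), inner ℂ v w = h x v w

variable [RiemannianBundle (fun x : M => TangentSpace (𝓡 n) x)]

/-- The fibre of `T*M ⊗ V` at `x`. -/
def CotangentTensor (x : M) : Type _ := TangentSpace (𝓡 n) x →L[ℝ] V x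

instance (x : M) : AddCommGroup (CotangentTensor V n x) :=
  inferInstanceAs (AddCommGroup (TangentSpace (𝓡 n) x →L[ℝ] V x))

instance (x : M) : Module ℂ (CotangentTensor V n x) :=
  inferInstanceAs (Module ℂ (TangentSpace (𝓡 n) x →L[ℝ] V x))

/-- An element of `T*M ⊗ V` as a linear map. -/
def CotangentTensor.toHom {x : M} (A : CotangentTensor V n x) : TangentSpace (𝓡 n) x →L[ℝ] V x := A

/-- The inner product of `T*M ⊗ V` induced by those of `TM` and `V`, that is
`⟨A, B⟩ = ∑ᵢ h(A eᵢ, B eᵢ)` for an orthonormal basis `(eᵢ)` of the tangent space. -/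
@[reducible] def CotangentTensor.innerCore (x : M) :
    InnerProductSpace.Core ℂ (CotangentTensor V n x) where
  inner A B := ∑ i, inner ℂ (A.toHom V n (stdOrthonormalBasis ℝ (TangentSpace (𝓡 n) x) i))
    (B.toHom V n (stdOrthonormalBasis ℝ (TangentSpace (𝓡 n) x) i))
  conj_inner_symm A B := by simp
  re_inner_nonneg A := by
    rw [map_sum]
    exact Finset.sum_nonneg fun i _ => inner_self_nonneg
  add_left A B C := by
    rw [← Finset.sum_add_distrib]
    exact Finset.sum_congr rfl fun i _ => inner_add_left _ _ _
  smul_left A B c := by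
    rw [Finset.mul_sum]
    exact Finset.sum_congr rfl fun i _ => inner_smul_left _ _ _
  definite A hA := by
    have h1 : ∑ i, ‖A.toHom V n (stdOrthonormalBasis ℝ (TangentSpace (𝓡 n) x) i)‖ ^ 2 = 0 := by
      have := congrArg Complex.re hA
      rw [Complex.re_sum] at this
      simpa [inner_self_eq_norm_sq_to_K, ← Complex.ofReal_pow] using this
    rw [Finset.sum_eq_zero_iff_of_nonneg fun i _ => by positivity] at h1
    have h2 : (A.toHom V n).toLinearMap = 0 := by
      refine (stdOrthonormalBasis ℝ (TangentSpace (𝓡 n) x)).toBasis.ext fun i => ?_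
      simpa using h1 i (Finset.mem_univ i)
    exact ContinuousLinearMap.coe_injective h2

instance (x : M) : NormedAddCommGroup (CotangentTensor V n x) :=
  @InnerProductSpace.Core.toNormedAddCommGroup ℂ _ _ _ _ (CotangentTensor.innerCore V n x)

instance (x : M) : InnerProductSpace ℂ (CotangentTensor V n x) :=
  InnerProductSpace.ofCore (CotangentTensor.innerCore V n x).toCore

end Bundle

section Measurability

local notation "𝔼" n:max => EuclideanSpace ℝ (Fin n)

theorem sum_inner_orthonormalBasis {ι T W : Type*} [Fintype ι] [DecidableEq ι]
    [NormedAddCommGroup T] [InnerProductSpace ℝ T] [NormedAddCommGroup W] [InnerProductSpace ℂ W]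
    (e : OrthonormalBasis ι ℝ T) (b : Module.Basis ι ℝ T) (A B : T →ₗ[ℝ] W) :
    ∑ k, inner ℂ (A (e k)) (B (e k)) =
      ∑ i, ∑ j, (((Matrix.of fun i j => inner ℝ (b i) (b j))⁻¹ i j : ℝ) : ℂ) *
        inner ℂ (A (b i)) (B (b j)) := by
  set G : Matrix ι ι ℝ := Matrix.of fun i j => inner ℝ (b i) (b j) with hG
  set C : Matrix ι ι ℝ := b.toMatrix e with hC
  have hexp : ∀ k, e k = ∑ i, C i k • b i := fun k => (b.sum_toMatrix_smul_self e k).symm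
  have h1 : C.transpose * G * C = 1 := by
    ext k l
    have h2 : inner ℝ (e k) (e l) = (C.transpose * G * C) k l := by
      rw [hexp k, hexp l, sum_inner]
      simp only [inner_sum, real_inner_smul_left, real_inner_smul_right, Matrix.mul_apply,
        Matrix.transpose_apply, Finset.sum_mul, hG, Matrix.of_apply]
      rw [Finset.sum_comm]
      exact Finset.sum_congr rfl fun i _ => Finset.sum_congr rfl fun j _ => by ring
    rw [← h2, orthonormal_iff_ite.1 e.orthonormal k l, Matrix.one_apply]
  have h3 : G⁻¹ = C * C.transpose := by
    refine Matrix.inv_eq_left_inv ?_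
    rw [Matrix.mul_assoc]
    exact mul_eq_one_comm.1 h1
  have hR : ∀ (c d : ℝ) (v w : W), inner ℂ (c • v) (d • w) = ((c * d : ℝ) : ℂ) * inner ℂ v w := by
    intro c d v w
    rw [← Complex.coe_smul c v, ← Complex.coe_smul d w, inner_smul_left, inner_smul_right]
    simp [mul_assoc]
  calc ∑ k, inner ℂ (A (e k)) (B (e k))
      = ∑ k, ∑ i, ∑ j, ((C i k * C j k : ℝ) : ℂ) * inner ℂ (A (b i)) (B (b j)) := by
        refine Finset.sum_congr rfl fun k _ => ?_
        rw [hexp k]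
        simp only [map_sum, map_smul, sum_inner, inner_sum, hR]
        exact Finset.sum_comm
    _ = _ := by
        rw [h3]
        simp only [Matrix.mul_apply, Matrix.transpose_apply, Complex.ofReal_sum, Finset.sum_mul]
        rw [Finset.sum_comm]
        exact Finset.sum_congr rfl fun i _ => Finset.sum_comm

variable {M : Type*} [TopologicalSpace M] [MeasurableSpace M] [BorelSpace M]
  [SecondCountableTopology M] {μ : Measure M}
  {F : Type*} [NormedAddCommGroup F] [NormedSpace ℂ F] [FiniteDimensional ℂ F]
  {V : M → Type*} [TopologicalSpace (TotalSpace F V)] [∀ x, NormedAddCommGroup (V x)]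
  [∀ x, InnerProductSpace ℂ (V x)] [FiberBundle F V] [VectorBundle ℝ F V] [VectorBundle ℂ F V]
  {n : ℕ} [ChartedSpace (𝔼 n) M]

theorem aestronglyMeasurable_of_local {β : Type*} [TopologicalSpace β]
    [TopologicalSpace.PseudoMetrizableSpace β] {f : M → β} (U : M → Set M)
    (hU : ∀ x, IsOpen (U x)) (hx : ∀ x, x ∈ U x)
    (hf : ∀ x, AEStronglyMeasurable f (μ.restrict (U x))) : AEStronglyMeasurable f μ := by
  obtain ⟨s, hs, hsU⟩ := TopologicalSpace.countable_cover_nhds fun x => (hU x).mem_nhds (hx x)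
  have := hs.to_subtype
  rw [← Measure.restrict_univ (μ := μ), ← hsU, biUnion_eq_iUnion]
  exact AEStronglyMeasurable.iUnion fun i => hf i

theorem aestronglyMeasurable_inner_local [IsSmoothHermitianBundle F V n] (x₀ : M) {s : Set M}
    (hs : MeasurableSet s) (hsb : s ⊆ (trivializationAt F V x₀).baseSet) {u v : Π x, V x}
    (hu : AEStronglyMeasurable (fun x => (trivializationAt F V x₀ ⟨x, u x⟩).2) (μ.restrict s))
    (hv : AEStronglyMeasurable (fun x => (trivializationAt F V x₀ ⟨x, v x⟩).2) (μ.restrict s)) :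
    AEStronglyMeasurable (fun x => inner ℂ (u x) (v x)) (μ.restrict s) := by
  obtain ⟨h, hc, hh⟩ := IsSmoothHermitianBundle.exists_contMDiff (F := F) (V := V) (n := n)
  set e := trivializationAt F V x₀
  let H : M → F →L[ℝ] F →L[ℝ] ℂ := fun x =>
    ContinuousLinearMap.inCoordinates F V (F →L[ℝ] ℂ) (fun x => V x →L[ℝ] ℂ) x₀ x x₀ x (h x)
  have hH : ContinuousOn H s := by
    have h1 := (trivializationAt (F →L[ℝ] F →L[ℝ] ℂ)
      (fun x => V x →L[ℝ] V x →L[ℝ] ℂ) x₀).continuousOn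
    have h2 := h1.comp (s := s) hc.continuous.continuousOn (fun x hx => by
      rw [Trivialization.mem_source]
      exact ⟨hsb hx, hsb hx, mem_univ _⟩)
    exact continuous_snd.comp_continuousOn h2
  have : FiniteDimensional ℝ F := FiniteDimensional.trans ℝ ℂ F
  have hHm : AEStronglyMeasurable H (μ.restrict s) := hH.aestronglyMeasurable hs
  have hcomp : Continuous fun p : (F →L[ℝ] F →L[ℝ] ℂ) × F × F => p.1 p.2.1 p.2.2 := by fun_prop
  refine (hcomp.comp_aestronglyMeasurable (hHm.prodMk (hu.prodMk hv))).congr ?_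
  filter_upwards [ae_restrict_mem hs] with x hx
  simp only [H]
  rw [inCoordinates_apply_eq₂ (hsb hx) (hsb hx) (mem_univ _)]
  simp only [Trivial.fiberBundle_trivializationAt', Trivial.linearMapAt_trivialization,
    LinearMap.id_coe, id_eq, hh]
  have hu' : (trivializationAt F V x₀).symm x (e ⟨x, u x⟩).2 = u x :=
    e.symm_apply_apply_mk (hsb hx) (u x)
  have hv' : (trivializationAt F V x₀).symm x (e ⟨x, v x⟩).2 = v x :=
    e.symm_apply_apply_mk (hsb hx) (v x)
  rw [hu', hv']

theorem aestronglyMeasurable_inner [IsSmoothHermitianBundle F V n] {u v : Π x, V x}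
    (hu : IsMeasurableSection F V μ u) (hv : IsMeasurableSection F V μ v) :
    AEStronglyMeasurable (fun x => inner ℂ (u x) (v x)) μ :=
  aestronglyMeasurable_of_local (fun x₀ => (trivializationAt F V x₀).baseSet)
    (fun x₀ => (trivializationAt F V x₀).open_baseSet)
    (fun x₀ => FiberBundle.mem_baseSet_trivializationAt F V x₀)
    (fun x₀ => aestronglyMeasurable_inner_local (n := n) x₀
      (trivializationAt F V x₀).open_baseSet.measurableSet subset_rfl (hu x₀) (hv x₀))

variable [IsManifold (𝓡 n) ∞ M] [RiemannianBundle (fun x : M => TangentSpace (𝓡 n) x)]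
  [IsContMDiffRiemannianBundle (𝓡 n) ∞ (𝔼 n) (fun x : M => TangentSpace (𝓡 n) x)]

/-- The Gram matrix of the local frame of `TM` given by the trivialization at `x₀`. -/
def frameGram (x₀ x : M) : Matrix (Fin n) (Fin n) ℝ := Matrix.of fun i j => inner ℝ
  ((trivializationAt (𝔼 n) (fun x : M => TangentSpace (𝓡 n) x) x₀).symm x
    (EuclideanSpace.single i (1 : ℝ)))
  ((trivializationAt (𝔼 n) (fun x : M => TangentSpace (𝓡 n) x) x₀).symm x
    (EuclideanSpace.single j (1 : ℝ)))

theorem continuousOn_frame (x₀ : M) (i : Fin n) : ContinuousOn (fun x : M => (⟨x,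
      (trivializationAt (𝔼 n) (fun x : M => TangentSpace (𝓡 n) x) x₀).symm x
        (EuclideanSpace.single i (1 : ℝ))⟩ : TotalSpace (𝔼 n)
        (fun x : M => TangentSpace (𝓡 n) x)))
      (trivializationAt (𝔼 n) (fun x : M => TangentSpace (𝓡 n) x) x₀).baseSet := by
  set eT := trivializationAt (𝔼 n) (fun x : M => TangentSpace (𝓡 n) x) x₀
  have h1 := eT.continuousOn_symm.comp (s := eT.baseSet)
    (f := fun x : M => (x, (EuclideanSpace.single i (1 : ℝ) : 𝔼 n))) (by fun_prop)
    (fun x hx => ⟨hx, mem_univ _⟩)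
  exact h1

theorem exists_frame_basis (x₀ : M) {x : M}
    (hx : x ∈ (trivializationAt (𝔼 n) (fun x : M => TangentSpace (𝓡 n) x) x₀).baseSet) :
    ∃ b : Module.Basis (Fin n) ℝ (TangentSpace (𝓡 n) x), ∀ i, b i =
      (trivializationAt (𝔼 n) (fun x : M => TangentSpace (𝓡 n) x) x₀).symm x
        (EuclideanSpace.single i (1 : ℝ)) :=
  ⟨(EuclideanSpace.basisFun (Fin n) ℝ).toBasis.map
      ((trivializationAt (𝔼 n) (fun x : M => TangentSpace (𝓡 n) x) x₀).continuousLinearEquivAt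
        ℝ x hx).symm.toLinearEquiv, fun i => by simp⟩

theorem continuousOn_frameGram_inv (x₀ : M) (i j : Fin n) :
    ContinuousOn (fun x : M => (frameGram (n := n) x₀ x)⁻¹ i j)
      (trivializationAt (𝔼 n) (fun x : M => TangentSpace (𝓡 n) x) x₀).baseSet := by
  have : IsContinuousRiemannianBundle (𝔼 n) (fun x : M => TangentSpace (𝓡 n) x) := by
    obtain ⟨g, hg, hg'⟩ := IsContMDiffRiemannianBundle.exists_contMDiff (IB := 𝓡 n) (n := ∞)
      (F := 𝔼 n) (E := fun x : M => TangentSpace (𝓡 n) x)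
    exact ⟨g, hg.continuous, hg'⟩
  have hG : ContinuousOn (frameGram (M := M) (n := n) x₀)
      (trivializationAt (𝔼 n) (fun x : M => TangentSpace (𝓡 n) x) x₀).baseSet :=
    continuousOn_pi.2 fun i => continuousOn_pi.2 fun j =>
      (continuousOn_frame x₀ i).inner_bundle (continuousOn_frame x₀ j)
  have h1 : (fun x : M => (frameGram (n := n) x₀ x)⁻¹ i j) =
      fun x : M => (frameGram (n := n) x₀ x).det⁻¹ * (frameGram (n := n) x₀ x).adjugate i j := by
    ext x
    simp [Matrix.inv_def]
  rw [h1]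
  refine ContinuousOn.mul (ContinuousOn.inv₀ ?_ ?_) ?_
  · exact Continuous.comp_continuousOn (g := Matrix.det) (by fun_prop) hG
  · intro x hx
    obtain ⟨b, hb⟩ := exists_frame_basis x₀ hx
    have h2 : frameGram x₀ x = Matrix.gram ℝ b := by
      ext i j
      simp [frameGram, Matrix.gram, hb]
    rw [h2]
    exact (Matrix.posDef_gram_of_linearIndependent b.linearIndependent).det_pos.ne'
  · exact Continuous.comp_continuousOn (g := fun m : Matrix (Fin n) (Fin n) ℝ => m.adjugate i j)
        ((continuous_id.matrix_adjugate).matrix_elem i j) hG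

theorem inner_cotangent_eq (x₀ : M) {x : M}
    (hx : x ∈ (trivializationAt (𝔼 n) (fun x : M => TangentSpace (𝓡 n) x) x₀).baseSet)
    (A B : CotangentTensor V n x) :
    inner ℂ A B = ∑ i, ∑ j, (((frameGram x₀ x)⁻¹ i j : ℝ) : ℂ) *
      inner ℂ (A.toHom V n ((trivializationAt (𝔼 n) (fun x : M => TangentSpace (𝓡 n) x) x₀).symm x
          (EuclideanSpace.single i (1 : ℝ))))
        (B.toHom V n ((trivializationAt (𝔼 n) (fun x : M => TangentSpace (𝓡 n) x) x₀).symm x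
          (EuclideanSpace.single j (1 : ℝ)))) := by
  have hfr : Module.finrank ℝ (TangentSpace (𝓡 n) x) = n :=
    (finrank_euclideanSpace_fin (𝕜 := ℝ) (n := n))
  obtain ⟨b, hb⟩ := exists_frame_basis x₀ hx
  have key := sum_inner_orthonormalBasis
    ((stdOrthonormalBasis ℝ (TangentSpace (𝓡 n) x)).reindex (finCongr hfr)) b
    (A.toHom V n).toLinearMap (B.toHom V n).toLinearMap
  have hl : inner ℂ A B =
      ∑ i, inner ℂ (A.toHom V n (stdOrthonormalBasis ℝ (TangentSpace (𝓡 n) x) i))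
    (B.toHom V n (stdOrthonormalBasis ℝ (TangentSpace (𝓡 n) x) i)) := rfl
  rw [hl]
  simp only [hb] at key
  refine Eq.trans ?_ key
  exact Fintype.sum_equiv (finCongr hfr) _ _ fun i => by simp

theorem aestronglyMeasurable_inner_cotangent [IsSmoothHermitianBundle F V n]
    {A B : Π x, CotangentTensor V n x}
    (hA : IsMeasurableSection (𝔼 n →L[ℝ] F) (fun x : M => TangentSpace (𝓡 n) x →L[ℝ] V x) μ A)
    (hB : IsMeasurableSection (𝔼 n →L[ℝ] F) (fun x : M => TangentSpace (𝓡 n) x →L[ℝ] V x) μ B) :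
    AEStronglyMeasurable (fun x => inner ℂ (A x) (B x)) μ := by
  refine aestronglyMeasurable_of_local (fun x₀ => (trivializationAt (𝔼 n →L[ℝ] F)
    (fun x : M => TangentSpace (𝓡 n) x →L[ℝ] V x) x₀).baseSet)
    (fun x₀ => (trivializationAt (𝔼 n →L[ℝ] F)
    (fun x : M => TangentSpace (𝓡 n) x →L[ℝ] V x) x₀).open_baseSet)
    (fun x₀ => FiberBundle.mem_baseSet_trivializationAt _ _ x₀) (fun x₀ => ?_)
  set eH := trivializationAt (𝔼 n →L[ℝ] F) (fun x : M => TangentSpace (𝓡 n) x →L[ℝ] V x) x₀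
  set eT := trivializationAt (𝔼 n) (fun x : M => TangentSpace (𝓡 n) x) x₀
  set eV := trivializationAt F V x₀
  have hbs : eH.baseSet = eT.baseSet ∩ eV.baseSet := rfl
  have hmeas : MeasurableSet eH.baseSet := eH.open_baseSet.measurableSet
  have hcoord : ∀ {C : Π x, CotangentTensor V n x},
      IsMeasurableSection (𝔼 n →L[ℝ] F) (fun x : M => TangentSpace (𝓡 n) x →L[ℝ] V x) μ C →
      ∀ i : Fin n, AEStronglyMeasurable
        (fun x => (eV ⟨x, (C x).toHom V n (eT.symm x (EuclideanSpace.single i (1 : ℝ)))⟩).2)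
        (μ.restrict eH.baseSet) := by
    intro C hC i
    have h1 := (ContinuousLinearMap.apply ℝ F
      (EuclideanSpace.single i (1 : ℝ) : 𝔼 n)).continuous.comp_aestronglyMeasurable (hC x₀)
    refine h1.congr ?_
    filter_upwards [ae_restrict_mem hmeas] with x hx
    have h2 := hom_trivializationAt_apply (𝕜₁ := ℝ) (𝕜₂ := ℝ) (σ := RingHom.id ℝ) (F₁ := 𝔼 n)
      (E₁ := fun x : M => TangentSpace (𝓡 n) x) (F₂ := F) (E₂ := V) x₀ ⟨x, (C x).toHom V n⟩
    have h3 : (eH ⟨x, C x⟩).2 = ContinuousLinearMap.inCoordinates (𝔼 n)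
        (fun x : M => TangentSpace (𝓡 n) x) F V x₀ x x₀ x ((C x).toHom V n) := congrArg Prod.snd h2
    simp only [ContinuousLinearMap.apply_apply]
    rw [h3, ContinuousLinearMap.inCoordinates]
    simp only [ContinuousLinearMap.comp_apply, Trivialization.continuousLinearMapAt_apply]
    rw [Trivialization.coe_linearMapAt_of_mem _ hx.2]
    have h4 : (Trivialization.symmL ℝ (trivializationAt (𝔼 n)
        (fun x : M => TangentSpace (𝓡 n) x) x₀) x) (EuclideanSpace.single i (1 : ℝ)) =
        eT.symm x (EuclideanSpace.single i (1 : ℝ)) := by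
      exact Trivialization.symmL_apply _ hx.1 _
    simp only [h4]
    rfl
  have hGi : ∀ i j, AEStronglyMeasurable (fun x : M => (frameGram (n := n) x₀ x)⁻¹ i j)
      (μ.restrict eH.baseSet) := fun i j =>
    ((continuousOn_frameGram_inv x₀ i j).mono fun x hx => hx.1).aestronglyMeasurable hmeas
  have hsum : AEStronglyMeasurable (fun x => ∑ i, ∑ j, (((frameGram x₀ x)⁻¹ i j : ℝ) : ℂ) *
      inner ℂ ((A x).toHom V n (eT.symm x (EuclideanSpace.single i (1 : ℝ))))
        ((B x).toHom V n (eT.symm x (EuclideanSpace.single j (1 : ℝ))))) (μ.restrict eH.baseSet) := by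
    refine Finset.aestronglyMeasurable_fun_sum _ fun i _ =>
      Finset.aestronglyMeasurable_fun_sum _ fun j _ => ?_
    refine (Complex.continuous_ofReal.comp_aestronglyMeasurable (hGi i j)).mul ?_
    exact aestronglyMeasurable_inner_local (n := n) x₀ hmeas (fun x hx => hx.2)
      (hcoord hA i) (hcoord hB j)
  refine hsum.congr ?_
  filter_upwards [ae_restrict_mem hmeas] with x hx
  exact (inner_cotangent_eq x₀ hx.1 (A x) (B x)).symm

theorem continuousOn_inner [IsSmoothHermitianBundle F V n] {u v : Π x, V x} {s : Set M}
    (hu : ContinuousOn (fun x => TotalSpace.mk' F x (u x)) s)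
    (hv : ContinuousOn (fun x => TotalSpace.mk' F x (v x)) s) :
    ContinuousOn (fun x => inner ℂ (u x) (v x)) s := by
  obtain ⟨h, hc, hh⟩ := IsSmoothHermitianBundle.exists_contMDiff (F := F) (V := V) (n := n)
  simp only [hh]
  have h1 : ContinuousOn (fun x => TotalSpace.mk' ℂ (E := Bundle.Trivial M ℂ) x
      (h x (u x) (v x))) s :=
    hc.continuous.continuousOn.clm_bundle_apply₂ (F₁ := F) (F₂ := F) hu hv
  intro x hx
  have h2 := h1 x hx
  simp only [FiberBundle.continuousWithinAt_totalSpace] at h2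
  exact h2.2

theorem continuous_inner_cotangent [IsSmoothHermitianBundle F V n]
    {A B : Π x : M, TangentSpace (𝓡 n) x →L[ℝ] V x}
    (hA : Continuous (fun x => TotalSpace.mk' (𝔼 n →L[ℝ] F)
      (E := fun x : M => TangentSpace (𝓡 n) x →L[ℝ] V x) x (A x)))
    (hB : Continuous (fun x => TotalSpace.mk' (𝔼 n →L[ℝ] F)
      (E := fun x : M => TangentSpace (𝓡 n) x →L[ℝ] V x) x (B x))) :
    Continuous (fun x => inner ℂ (show CotangentTensor V n x from A x)
      (show CotangentTensor V n x from B x)) := by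
  rw [continuous_iff_continuousAt]
  intro x₀
  set eT := trivializationAt (𝔼 n) (fun x : M => TangentSpace (𝓡 n) x) x₀
  have hx₀ : eT.baseSet ∈ 𝓝 x₀ :=
    eT.open_baseSet.mem_nhds (FiberBundle.mem_baseSet_trivializationAt _ _ x₀)
  refine ContinuousOn.continuousAt ?_ hx₀
  have hsum : ContinuousOn (fun x => ∑ i, ∑ j, (((frameGram x₀ x)⁻¹ i j : ℝ) : ℂ) *
      inner ℂ (A x (eT.symm x (EuclideanSpace.single i (1 : ℝ))))
        (B x (eT.symm x (EuclideanSpace.single j (1 : ℝ))))) eT.baseSet := by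
    refine continuousOn_finsetSum _ fun i _ => continuousOn_finsetSum _ fun j _ => ?_
    refine (Complex.continuous_ofReal.comp_continuousOn (continuousOn_frameGram_inv x₀ i j)).mul ?_
    exact continuousOn_inner (F := F) (n := n)
      (hA.continuousOn.clm_bundle_apply (continuousOn_frame x₀ i))
      (hB.continuousOn.clm_bundle_apply (continuousOn_frame x₀ j))
  exact hsum.congr fun x hx => inner_cotangent_eq x₀ hx _ _

end Measurability

section Connection

local notation "𝔼" n:max => EuclideanSpace ℝ (Fin n)

variable {M : Type*} [TopologicalSpace M] (n : ℕ) [ChartedSpace (𝔼 n) M] [IsManifold (𝓡 n) ∞ M]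
  (F : Type*) [NormedAddCommGroup F] [NormedSpace ℂ F]
  (V : M → Type*) [TopologicalSpace (TotalSpace F V)] [∀ x, NormedAddCommGroup (V x)]
  [∀ x, InnerProductSpace ℂ (V x)] [FiberBundle F V] [VectorBundle ℝ F V] [VectorBundle ℂ F V]

/-- The space `C^∞(V)` of smooth sections. -/
def smoothSections : Submodule ℂ (Π x, V x) where
  carrier := {u | ContMDiff (𝓡 n) ((𝓡 n).prod 𝓘(ℝ, F)) ∞ (fun x => TotalSpace.mk' F x (u x))}
  zero_mem' := contMDiff_zeroSection ℝ V
  add_mem' hu hv := ContMDiff.add_section hu hv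
  smul_mem' c u hu := by
    intro x₀
    have h := hu x₀
    rw [contMDiffAt_section] at h ⊢
    have hc : ContDiff ℝ ∞ (fun y : F => c • y) := contDiff_const_smul c
    refine ((hc.contMDiff (x := _)).comp x₀ h).congr_of_eventuallyEq ?_
    filter_upwards [(trivializationAt F V x₀).open_baseSet.mem_nhds
      (FiberBundle.mem_baseSet_trivializationAt F V x₀)] with x hx
    exact ((trivialization_linear ℂ (trivializationAt F V x₀)).linear x hx).map_smul c (u x)

/-- The space `C_c^∞(V)` of smooth sections with compact support. -/
def compactlySupportedSections : Submodule ℂ (Π x, V x) where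
  carrier := {u | u ∈ smoothSections n F V ∧ IsCompact (closure {x | u x ≠ 0})}
  zero_mem' := ⟨Submodule.zero_mem _, by simp⟩
  add_mem' := by
    rintro u v ⟨hu, hu'⟩ ⟨hv, hv'⟩
    refine ⟨Submodule.add_mem _ hu hv, (hu'.union hv').of_isClosed_subset isClosed_closure ?_⟩
    rw [← closure_union]
    refine closure_mono fun x hx => ?_
    by_contra h
    simp only [mem_union, mem_ofPred_eq, not_or, not_not] at h
    exact hx (by simp [h.1, h.2])
  smul_mem' := by
    rintro c u ⟨hu, hu'⟩
    refine ⟨Submodule.smul_mem _ c hu, hu'.of_isClosed_subset isClosed_closure ?_⟩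
    refine closure_mono fun x hx h => hx ?_
    simp [h]

/-- A smooth connection on the complex vector bundle `V`: a smooth covariant derivative which is
complex linear. -/
structure SmoothConnection extends CovariantDerivative (𝓡 n) F V where
  contMDiff_toFun : CovariantDerivative.ContMDiffCovariantDerivative toCovariantDerivative ∞
  toFun_smul : ∀ (c : ℂ), ∀ u ∈ smoothSections n F V, ∀ x, toFun (c • u) x = c • toFun u x

variable {n F V}

/-- The connection is compatible with the metric `h`: `X h(Y, Z) = h(∇_X Y, Z) + h(Y, ∇_X Z)`. -/
def SmoothConnection.IsCompatible (D : SmoothConnection n F V) : Prop :=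
  ∀ Y ∈ smoothSections n F V, ∀ Z ∈ smoothSections n F V, ∀ (x : M) (X : TangentSpace (𝓡 n) x),
    mvfderiv (𝓡 n) (fun y => inner ℂ (Y y) (Z y)) x X =
      inner ℂ (D.toFun Y x X) (Z x) + inner ℂ (Y x) (D.toFun Z x X)

end Connection

section Sobolev

local notation "𝔼" n:max => EuclideanSpace ℝ (Fin n)

variable {M : Type*} [TopologicalSpace M] [SecondCountableTopology M]
  [MeasurableSpace M] [BorelSpace M]
  (n : ℕ) [ChartedSpace (𝔼 n) M] [IsManifold (𝓡 n) ∞ M]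
  [RiemannianBundle (fun x : M => TangentSpace (𝓡 n) x)]
  [IsContMDiffRiemannianBundle (𝓡 n) ∞ (𝔼 n) (fun x : M => TangentSpace (𝓡 n) x)]
  (F : Type*) [NormedAddCommGroup F] [NormedSpace ℂ F] [FiniteDimensional ℂ F]
  (V : M → Type*) [TopologicalSpace (TotalSpace F V)] [∀ x, NormedAddCommGroup (V x)]
  [∀ x, InnerProductSpace ℂ (V x)] [FiberBundle F V] [VectorBundle ℝ F V] [VectorBundle ℂ F V]
  [ContMDiffVectorBundle ∞ F V (𝓡 n)] [IsSmoothHermitianBundle F V n]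

/-- The measurable sections of `V`, with respect to the Riemannian volume measure. -/
def sectionField : MeasurableField (riemannianVolume n : Measure M) V where
  measurableSections :=
    { carrier := {u | IsMeasurableSection F V (riemannianVolume n) u}
      zero_mem' := IsMeasurableSection.of_continuous F V
        (contMDiff_zeroSection (IB := 𝓡 n) (n := ∞) (F := F) ℝ V).continuous
      add_mem' := by
        intro u v hu hv x₀
        refine ((hu x₀).add (hv x₀)).congr ?_
        filter_upwards [ae_restrict_mem
          (trivializationAt F V x₀).open_baseSet.measurableSet] with x hx
        exact (((trivialization_linear ℂ (trivializationAt F V x₀)).linear x hx).map_add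
          (u x) (v x)).symm
      smul_mem' := by
        intro c u hu x₀
        refine ((hu x₀).const_smul c).congr ?_
        filter_upwards [ae_restrict_mem
          (trivializationAt F V x₀).open_baseSet.measurableSet] with x hx
        exact (((trivialization_linear ℂ (trivializationAt F V x₀)).linear x hx).map_smul
          c (u x)).symm }
  aestronglyMeasurable_inner _ hu _ hv := aestronglyMeasurable_inner (n := n) hu hv

/-- The measurable sections of `T*M ⊗ V`, with respect to the Riemannian volume measure. -/
def cotangentField : MeasurableField (riemannianVolume n : Measure M) (CotangentTensor V n) where
  measurableSections :=
    { carrier := {A | IsMeasurableSection (𝔼 n →L[ℝ] F)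
        (fun x : M => TangentSpace (𝓡 n) x →L[ℝ] V x) (riemannianVolume n) A}
      zero_mem' := IsMeasurableSection.of_continuous (𝔼 n →L[ℝ] F)
        (fun x : M => TangentSpace (𝓡 n) x →L[ℝ] V x)
        (contMDiff_zeroSection (IB := 𝓡 n) (n := ∞) (F := 𝔼 n →L[ℝ] F) ℝ
          (fun x : M => TangentSpace (𝓡 n) x →L[ℝ] V x)).continuous
      add_mem' := by
        intro u v hu hv x₀
        refine ((hu x₀).add (hv x₀)).congr ?_
        filter_upwards [ae_restrict_mem (trivializationAt (𝔼 n →L[ℝ] F)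
          (fun x : M => TangentSpace (𝓡 n) x →L[ℝ] V x) x₀).open_baseSet.measurableSet] with x hx
        exact (((trivialization_linear ℝ (trivializationAt (𝔼 n →L[ℝ] F)
          (fun x : M => TangentSpace (𝓡 n) x →L[ℝ] V x) x₀)).linear x hx).map_add
          (u x) (v x)).symm
      smul_mem' := by
        intro c u hu x₀
        refine ((hu x₀).const_smul c).congr ?_
        filter_upwards [ae_restrict_mem (trivializationAt (𝔼 n →L[ℝ] F)
          (fun x : M => TangentSpace (𝓡 n) x →L[ℝ] V x) x₀).open_baseSet.measurableSet] with x hx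
        have h1 : ∀ A : TangentSpace (𝓡 n) x →L[ℝ] V x, ∀ w : 𝔼 n,
            (trivializationAt (𝔼 n →L[ℝ] F) (fun x : M => TangentSpace (𝓡 n) x →L[ℝ] V x) x₀
              ⟨x, A⟩).2 w = (trivializationAt F V x₀ ⟨x, A ((trivializationAt (𝔼 n)
                (fun x : M => TangentSpace (𝓡 n) x) x₀).symmL ℝ x w)⟩).2 := by
          intro A w
          rw [hom_trivializationAt_apply, ContinuousLinearMap.inCoordinates]
          exact Trivialization.continuousLinearMapAt_apply_of_mem ℝ _ hx.2 _
        refine ContinuousLinearMap.ext fun w => ?_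
        refine Eq.trans ?_ (h1 (c • (u x).toHom V n) w).symm
        refine Eq.trans (congrArg (c • ·) (h1 ((u x).toHom V n) w)) ?_
        exact (((trivialization_linear ℂ (trivializationAt F V x₀)).linear x hx.2).map_smul c
          _).symm }
  aestronglyMeasurable_inner _ hA _ hB := aestronglyMeasurable_inner_cotangent hA hB

/-- The Hilbert space `L²(V)`. -/
abbrev L2Section : Type _ := (sectionField (M := M) n F V).L2

/-- The Hilbert space `L²(T*M ⊗ V)`. -/
abbrev L2Cotangent : Type _ := (cotangentField (M := M) n F V).L2

variable {n F V}

namespace SmoothConnection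

variable (D : SmoothConnection n F V)

/-- The section `∇u` of `T*M ⊗ V`. -/
def nabla (u : Π x, V x) : Π x, CotangentTensor V n x := fun x => D.toFun u x

theorem nabla_add {u v : Π x, V x} (hu : u ∈ smoothSections n F V)
    (hv : v ∈ smoothSections n F V) : D.nabla (u + v) = D.nabla u + D.nabla v := by
  ext1 x
  exact D.isCovariantDerivativeOnUniv.add (hu.mdifferentiableAt (by simp))
    (hv.mdifferentiableAt (by simp))

theorem nabla_smul (c : ℂ) {u : Π x, V x} (hu : u ∈ smoothSections n F V) :
    D.nabla (c • u) = c • D.nabla u := by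
  ext1 x
  exact D.toFun_smul c u hu x

theorem continuous_nabla {u : Π x, V x} (hu : u ∈ smoothSections n F V) :
    Continuous (fun x => TotalSpace.mk' (𝔼 n →L[ℝ] F)
      (E := fun x : M => TangentSpace (𝓡 n) x →L[ℝ] V x) x (D.nabla u x)) := by
  have h := D.contMDiff_toFun.contMDiff.contMDiff (σ := u) (ContMDiff.contMDiffOn hu)
  exact continuousOn_univ.1 h.continuousOn

/-- The space `S₁` of smooth sections `u` with `u ∈ L²(V)` and `∇u ∈ L²(T*M ⊗ V)`. -/
def S1 : Submodule ℂ (Π x, V x) where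
  carrier := {u | u ∈ smoothSections n F V ∧ u ∈ (sectionField n F V).sqIntegrable ∧
    D.nabla u ∈ (cotangentField n F V).sqIntegrable}
  zero_mem' := by
    refine ⟨Submodule.zero_mem _, Submodule.zero_mem _, ?_⟩
    have h := D.nabla_smul 0 (Submodule.zero_mem (smoothSections n F V))
    rw [zero_smul, zero_smul] at h
    rw [h]
    exact Submodule.zero_mem _
  add_mem' := by
    rintro u v ⟨hu, hu', hu''⟩ ⟨hv, hv', hv''⟩
    refine ⟨Submodule.add_mem _ hu hv, Submodule.add_mem _ hu' hv', ?_⟩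
    rw [D.nabla_add hu hv]
    exact Submodule.add_mem _ hu'' hv''
  smul_mem' := by
    rintro c u ⟨hu, hu', hu''⟩
    refine ⟨Submodule.smul_mem _ c hu, Submodule.smul_mem _ c hu', ?_⟩
    rw [D.nabla_smul c hu]
    exact Submodule.smul_mem _ c hu''

/-- The inclusion `S₁ → L²(V)`. -/
def toL2 : D.S1 →ₗ[ℂ] L2Section n F V where
  toFun u := (sectionField n F V).toL2 ⟨u.1, u.2.2.1⟩
  map_add' u v := (sectionField n F V).toL2.map_add ⟨u.1, u.2.2.1⟩ ⟨v.1, v.2.2.1⟩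
  map_smul' c u := (sectionField n F V).toL2.map_smul c ⟨u.1, u.2.2.1⟩

/-- The map `u ↦ ∇u` from `S₁` to `L²(T*M ⊗ V)`. -/
def gradL2 : D.S1 →ₗ[ℂ] L2Cotangent n F V where
  toFun u := (cotangentField n F V).toL2 ⟨D.nabla u.1, u.2.2.2⟩
  map_add' u v := by
    rw [← map_add]
    congr 1
    exact Subtype.ext (D.nabla_add u.2.1 v.2.1)
  map_smul' c u := by
    rw [RingHom.id_apply, ← map_smul]
    congr 1
    exact Subtype.ext (D.nabla_smul c u.2.1)

theorem toL2_injective : Function.Injective D.toL2 := by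
  rw [injective_iff_map_eq_zero]
  intro u hu
  have hu' : (sectionField n F V).toL2 ⟨u.1, u.2.2.1⟩ = 0 := hu
  have h1 : ∀ᵐ x ∂(riemannianVolume n : Measure M), u.1 x = 0 :=
    ((sectionField n F V).toL2_eq_zero_iff ⟨u.1, u.2.2.1⟩).1 hu'
  have hc : Continuous (fun x => inner ℂ (u.1 x) (u.1 x)) := by
    rw [← continuousOn_univ]
    exact continuousOn_inner (F := F) (n := n) u.2.1.continuous.continuousOn
      u.2.1.continuous.continuousOn
  have h2 : (fun x => inner ℂ (u.1 x) (u.1 x)) = fun _ => (0 : ℂ) := by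
    refine (hc.ae_eq_iff_eq (riemannianVolume n : Measure M) continuous_const).1 ?_
    filter_upwards [h1] with x hx
    simp [hx]
  refine Subtype.ext (funext fun x => ?_)
  exact inner_self_eq_zero.1 (congrFun h2 x)

theorem compactlySupportedSections_le_S1 : compactlySupportedSections n F V ≤ D.S1 := by
  rintro u ⟨hu, hK⟩
  have hfin : ∀ f : M → ℝ, Continuous f → (∀ x, x ∉ closure {x | u x ≠ 0} → f x = 0) →
      ∫⁻ x, ‖f x‖ₑ ∂(riemannianVolume n : Measure M) < ⊤ := by
    intro f hf h0
    have hs : HasCompactSupport f :=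
      hK.of_isClosed_subset isClosed_closure (closure_minimal (fun x hx => by
        by_contra h
        exact hx (h0 x h)) isClosed_closure)
    exact (hf.integrable_of_hasCompactSupport hs).2
  refine ⟨hu, ⟨IsMeasurableSection.of_continuous F V hu.continuous, ?_⟩, ?_, ?_⟩
  · have hc : Continuous (fun x => ‖u x‖ ^ 2) := by
      have h1 : Continuous (fun x => inner ℂ (u x) (u x)) := by
        rw [← continuousOn_univ]
        exact continuousOn_inner (F := F) (n := n) hu.continuous.continuousOn
          hu.continuous.continuousOn
      refine (Complex.continuous_re.comp h1).congr fun x => ?_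
      exact inner_self_eq_norm_sq (𝕜 := ℂ) (u x)
    refine lt_of_eq_of_lt (lintegral_congr fun x => ?_) (hfin _ hc fun x hx => ?_)
    · rw [enorm_pow, enorm_norm]
    · have : u x = 0 := by
        by_contra h
        exact hx (subset_closure h)
      simp [this]
  · exact IsMeasurableSection.of_continuous (𝔼 n →L[ℝ] F)
      (fun x : M => TangentSpace (𝓡 n) x →L[ℝ] V x) (D.continuous_nabla hu)
  · have hc : Continuous (fun x => ‖D.nabla u x‖ ^ 2) := by
      have h1 : Continuous (fun x => inner ℂ (D.nabla u x) (D.nabla u x)) :=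
        continuous_inner_cotangent (F := F) (D.continuous_nabla hu) (D.continuous_nabla hu)
      refine (Complex.continuous_re.comp h1).congr fun x => ?_
      exact inner_self_eq_norm_sq (𝕜 := ℂ) (D.nabla u x)
    refine lt_of_eq_of_lt (lintegral_congr fun x => ?_) (hfin _ hc fun x hx => ?_)
    · rw [enorm_pow, enorm_norm]
    · have h0 : D.nabla u x = 0 := by
        have h1 : ∀ᶠ y in 𝓝 x, u y = (0 : Π x, V x) y := by
          filter_upwards [isClosed_closure.isOpen_compl.mem_nhds hx] with y hy
          by_contra h
          exact hy (subset_closure h)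
        have h2 := D.isCovariantDerivativeOnUniv.congr_of_eventuallyEq
          (hu.mdifferentiableAt (by simp)) (mdifferentiableAt_zeroSection ..) Filter.univ_mem h1
        exact h2.trans (D.isCovariantDerivativeOnUniv.zero)
      simp [h0]

/-- The operator `u ↦ ∇u` from `L²(V)` to `L²(T*M ⊗ V)` with domain `S ⊆ S₁`. -/
def nablaOn (S : Submodule ℂ (Π x, V x)) (hS : S ≤ D.S1) :
    L2Section n F V →ₗ.[ℂ] L2Cotangent n F V where
  domain := LinearMap.range (D.toL2 ∘ₗ Submodule.inclusion hS)
  toFun := (D.gradL2 ∘ₗ Submodule.inclusion hS) ∘ₗ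
    (LinearEquiv.ofInjective (D.toL2 ∘ₗ Submodule.inclusion hS)
      (D.toL2_injective.comp (Submodule.inclusion_injective hS))).symm.toLinearMap

/-- The operator `∇₂`: the connection with domain `S₁`. -/
def nabla2 : L2Section n F V →ₗ.[ℂ] L2Cotangent n F V := D.nablaOn D.S1 le_rfl

/-- The operator `∇_c`: the connection with domain `C_c^∞(V)`. -/
def nablaC : L2Section n F V →ₗ.[ℂ] L2Cotangent n F V :=
  D.nablaOn (compactlySupportedSections n F V) D.compactlySupportedSections_le_S1

/-- A space `S ⊆ S₁` of sections, as a space carrying the Sobolev norm `‖u‖ + ‖∇u‖`. -/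
def PreSobolev (S : Submodule ℂ (Π x, V x)) (_ : S ≤ D.S1) : Type _ := S

section PreSobolev

variable (S : Submodule ℂ (Π x, V x)) (hS : S ≤ D.S1)

instance : AddCommGroup (D.PreSobolev S hS) := inferInstanceAs (AddCommGroup S)

instance : Module ℂ (D.PreSobolev S hS) := inferInstanceAs (Module ℂ S)

variable {S hS}

/-- The section underlying an element of `PreSobolev`, as an element of `S₁`. -/
def PreSobolev.toS1 : D.PreSobolev S hS →ₗ[ℂ] D.S1 := Submodule.inclusion hS

instance : NormedAddCommGroup (D.PreSobolev S hS) :=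
  AddGroupNorm.toNormedAddCommGroup
    { toFun := fun u => ‖D.toL2 (PreSobolev.toS1 D u)‖ + ‖D.gradL2 (PreSobolev.toS1 D u)‖
      map_zero' := by simp
      add_le' := fun u v => by
        simp only [map_add]
        linarith [norm_add_le (D.toL2 (PreSobolev.toS1 D u)) (D.toL2 (PreSobolev.toS1 D v)),
          norm_add_le (D.gradL2 (PreSobolev.toS1 D u)) (D.gradL2 (PreSobolev.toS1 D v))]
      neg' := fun u => by simp only [map_neg, norm_neg]
      eq_zero_of_map_eq_zero' := fun u hu => by
        have h1 : ‖D.toL2 (PreSobolev.toS1 D u)‖ = 0 :=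
          le_antisymm (by linarith [norm_nonneg (D.gradL2 (PreSobolev.toS1 D u))]) (norm_nonneg _)
        rw [norm_eq_zero] at h1
        have h2 := D.toL2_injective (h1.trans (map_zero D.toL2).symm)
        exact Submodule.inclusion_injective hS (h2.trans (map_zero (PreSobolev.toS1 D)).symm) }

theorem PreSobolev.norm_def (u : D.PreSobolev S hS) :
    ‖u‖ = ‖D.toL2 (PreSobolev.toS1 D u)‖ + ‖D.gradL2 (PreSobolev.toS1 D u)‖ := rfl

instance : NormedSpace ℂ (D.PreSobolev S hS) where
  norm_smul_le c u := by
    simp only [PreSobolev.norm_def, map_smul, norm_smul, mul_add]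
    exact le_rfl

end PreSobolev

/-- The Sobolev space `W^{1,2}(V)`: the completion of `S₁` in the Sobolev norm. -/
abbrev W12 : Type _ := UniformSpace.Completion (D.PreSobolev D.S1 le_rfl)

/-- The Sobolev space `W_0^{1,2}(V)`: the completion of `C_c^∞(V)` in the Sobolev norm. -/
abbrev W012 : Type _ := UniformSpace.Completion
  (D.PreSobolev (compactlySupportedSections n F V) D.compactlySupportedSections_le_S1)

/-- The canonical map `W_0^{1,2}(V) → W^{1,2}(V)`, which extends the inclusion of `C_c^∞(V)` in
`S₁` by continuity. -/
def w012ToW12 : D.W012 → D.W12 :=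
  UniformSpace.Completion.map
    (fun u : D.PreSobolev (compactlySupportedSections n F V) D.compactlySupportedSections_le_S1 =>
      (Submodule.inclusion D.compactlySupportedSections_le_S1 u : D.PreSobolev D.S1 le_rfl))

end SmoothConnection

end Sobolev


end SobolevBundle

end

/-! The Sobolev norm is the graph norm of `∇`, so the first two claims follow formally once `nabla2`
is known to be closable. For a closable operator the completion of the domain in the graph norm is
the graph of the closure (`mem_graph_closure_iff`): the pair (inclusion, gradient) extends to the
completion with closed range. Closability is what makes the first component alone injective.
Extending the maps uses that the `L²` spaces are complete (Riesz-Fischer).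

Closability (`IsCompatible.isClosable_nabla2`) comes from a formal adjoint. Let `ρ = √det g` in a
chart and `Xᵢ = ρ⁻¹∂ᵢ`. These fields span every tangent space of the chart and are divergence free,
because `ρ` cancels against the volume density. For a test section `s` supported in the chart,
compatibility gives `Xᵢ h(s,u) = h(∇_{Xᵢ}s,u) + h(s,∇_{Xᵢ}u)`, and the left side integrates to zero.
Thus `⟨Xᵢ♭ ⊗ s, ∇u⟩ = -⟨∇_{Xᵢ}s, u⟩`. If `u_k → 0` and `∇u_k → v` in `L²`, then `v` is orthogonal to
all the tensors `Xᵢ♭ ⊗ s`; hence each `v(Xᵢ)` vanishes almost everywhere, and so does `v`.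

The third claim is the density of `C_c^∞` in `S₁` for the Sobolev norm (`denseRange_inclusion`). It
rests on cutoffs `χ_k` with uniformly bounded differentials, each point having a neighbourhood on
which `χ_k = 1` for all large `k` (`exists_cutoff`). Since `∇(χ_k u) - ∇u = (χ_k - 1)∇u + dχ_k ⊗ u`
is dominated by a multiple of `|∇u| + |u|` and vanishes eventually at each point, dominated
convergence gives `χ_k u → u`.

The cutoffs are functions of a distance. Completeness makes closed balls of finite radius compact
(Hopf-Rinow), which gives compact supports. The distance is only Lipschitz, so it is replaced by a
uniformly close smooth function with bounded differential: mollification in charts, then a partition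
of unity with local errors small compared with its differentials. As `M` may be disconnected, the
distance is taken to growing finite subsets of a dense sequence instead of to one point. -/

noncomputable section
namespace SobolevBundle

/-! ### Completions in the graph norm and closures of operators -/

section Completion

variable {P X Y : Type*} [NormedAddCommGroup P] [NormedSpace ℂ P]
  [NormedAddCommGroup X] [NormedSpace ℂ X] [CompleteSpace X]
  [NormedAddCommGroup Y] [NormedSpace ℂ Y] [CompleteSpace Y]

/-- The continuous extension to the completion of a continuous linear map. -/
def extendCompletion (T : P →L[ℂ] X) : UniformSpace.Completion P →L[ℂ] X :=
  T.extend (UniformSpace.Completion.toComplL (𝕜 := ℂ) (E := P))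

theorem extendCompletion_coe (T : P →L[ℂ] X) (u : P) : extendCompletion T u = T u :=
  T.extend_eq (UniformSpace.Completion.denseRange_coe)
    (UniformSpace.Completion.isUniformInducing_coe P) u

theorem norm_eq_add_extendCompletion (T : P →L[ℂ] X) (G : P →L[ℂ] Y)
    (h : ∀ u, ‖u‖ = ‖T u‖ + ‖G u‖) (w : UniformSpace.Completion P) :
    ‖w‖ = ‖extendCompletion T w‖ + ‖extendCompletion G w‖ := by
  induction w using UniformSpace.Completion.induction_on with
  | hp => exact isClosed_eq (by fun_prop) (by fun_prop)
  | ih u => rw [extendCompletion_coe, extendCompletion_coe, UniformSpace.Completion.norm_coe, h]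

/-- The completion of the domain of a closable operator in the graph norm is the graph of the
closure of the operator. -/
theorem mem_graph_closure_iff (T : P →L[ℂ] X) (G : P →L[ℂ] Y) (h : ∀ u, ‖u‖ = ‖T u‖ + ‖G u‖)
    (A : X →ₗ.[ℂ] Y) (hA : ∀ x : X × Y, x ∈ A.graph ↔ ∃ u, (T u, G u) = x) (hc : A.IsClosable)
    (x : X × Y) :
    x ∈ A.closure.graph ↔ ∃ w, (extendCompletion T w, extendCompletion G w) = x := by
  set J : UniformSpace.Completion P → X × Y :=
    fun w => (extendCompletion T w, extendCompletion G w) with hJ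
  have hJc : Continuous J := by fun_prop
  -- The product carries the maximum norm, so a sum of two norms is at most twice it. Being bounded
  -- below on a complete space, `J` has closed range.
  have hanti : AntilipschitzWith 2 J := by
    refine AntilipschitzWith.of_le_mul_dist fun v w => ?_
    rw [dist_eq_norm, norm_eq_add_extendCompletion T G h, dist_eq_norm]
    have h1 : J v - J w = J (v - w) := by simp [hJ]
    rw [h1]
    have h2 : ‖extendCompletion T (v - w)‖ ≤ ‖J (v - w)‖ := norm_fst_le (J (v - w))
    have h3 : ‖extendCompletion G (v - w)‖ ≤ ‖J (v - w)‖ := norm_snd_le (J (v - w))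
    push_cast
    linarith
  have hclosed : IsClosed (range J) :=
    hanti.isClosed_range (by
      have : UniformContinuous J :=
        ((extendCompletion T).uniformContinuous).prodMk (extendCompletion G).uniformContinuous
      exact this)
  have hgr : (A.graph : Set (X × Y)) = J '' range ((↑) : P → UniformSpace.Completion P) := by
    ext y
    rw [SetLike.mem_coe, hA]
    constructor
    · rintro ⟨u, rfl⟩
      exact ⟨u, ⟨u, rfl⟩, by simp [hJ, extendCompletion_coe]⟩
    · rintro ⟨_, ⟨u, rfl⟩, rfl⟩
      exact ⟨u, by simp [hJ, extendCompletion_coe]⟩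
  -- The graph is the image under `J` of a dense subset of the completion, and `range J` is closed.
  have hcl : closure (A.graph : Set (X × Y)) = range J := by
    rw [hgr]
    refine subset_antisymm (closure_minimal (image_subset_range _ _) hclosed) ?_
    rw [← image_univ, ← (UniformSpace.Completion.denseRange_coe (α := P)).closure_range]
    exact image_closure_subset_closure_image hJc
  rw [← hc.graph_closure_eq_closure_graph, ← SetLike.mem_coe, Submodule.topologicalClosure_coe, hcl]
  exact Iff.rfl

/-- If `T w = 0`, then `(0, G w)` lies in the graph of the closure. A graph contains no vertical
vector, so `G w = 0` and the graph norm of `w` is zero. -/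
theorem extendCompletion_injective (T : P →L[ℂ] X) (G : P →L[ℂ] Y)
    (h : ∀ u, ‖u‖ = ‖T u‖ + ‖G u‖) (A : X →ₗ.[ℂ] Y)
    (hA : ∀ x : X × Y, x ∈ A.graph ↔ ∃ u, (T u, G u) = x) (hc : A.IsClosable) :
    Function.Injective (extendCompletion T) := by
  rw [injective_iff_map_eq_zero]
  intro w hw
  have h1 : (extendCompletion T w, extendCompletion G w) ∈ A.closure.graph :=
    (mem_graph_closure_iff T G h A hA hc _).2 ⟨w, rfl⟩
  have h2 := A.closure.graph_fst_eq_zero_snd h1 hw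
  rw [← norm_eq_zero, norm_eq_add_extendCompletion T G h, hw, h2]
  simp

theorem range_extendCompletion (T : P →L[ℂ] X) (G : P →L[ℂ] Y)
    (h : ∀ u, ‖u‖ = ‖T u‖ + ‖G u‖) (A : X →ₗ.[ℂ] Y)
    (hA : ∀ x : X × Y, x ∈ A.graph ↔ ∃ u, (T u, G u) = x) (hc : A.IsClosable) :
    range (extendCompletion T) = A.closure.domain := by
  ext x
  rw [SetLike.mem_coe, LinearPMap.mem_domain_iff]
  constructor
  · rintro ⟨w, rfl⟩
    exact ⟨extendCompletion G w, (mem_graph_closure_iff T G h A hA hc _).2 ⟨w, rfl⟩⟩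
  · rintro ⟨y, hy⟩
    obtain ⟨w, hw⟩ := (mem_graph_closure_iff T G h A hA hc _).1 hy
    exact ⟨w, congrArg Prod.fst hw⟩

theorem norm_eq_graphNorm (T : P →L[ℂ] X) (G : P →L[ℂ] Y)
    (h : ∀ u, ‖u‖ = ‖T u‖ + ‖G u‖) (A : X →ₗ.[ℂ] Y)
    (hA : ∀ x : X × Y, x ∈ A.graph ↔ ∃ u, (T u, G u) = x) (hc : A.IsClosable)
    (w : UniformSpace.Completion P) (hw : extendCompletion T w ∈ A.closure.domain) :
    ‖w‖ = ‖extendCompletion T w‖ + ‖A.closure ⟨extendCompletion T w, hw⟩‖ := by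
  have h1 : (extendCompletion T w, extendCompletion G w) ∈ A.closure.graph :=
    (mem_graph_closure_iff T G h A hA hc _).2 ⟨w, rfl⟩
  have h2 := A.closure.mem_graph ⟨extendCompletion T w, hw⟩
  have h3 := A.closure.mem_graph_snd_inj h1 h2 rfl
  rw [← h3]
  exact norm_eq_add_extendCompletion T G h w

/-- The sequential criterion for closability: the closure of the graph is itself a graph as soon as
it contains no nonzero vertical vector. -/
theorem isClosable_of_graph {A : X →ₗ.[ℂ] Y}
    (hA : ∀ y, ((0 : X), y) ∈ A.graph.topologicalClosure → y = 0) : A.IsClosable := by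
  refine ⟨A.graph.topologicalClosure.toLinearPMap, ?_⟩
  rw [Submodule.toLinearPMap_graph_eq]
  rintro ⟨x, y⟩ hx (rfl : x = 0)
  exact hA y hx

end Completion

/-! ### Riesz-Fischer for fields of Hilbert spaces -/

namespace MeasurableField

variable {M : Type*} [MeasurableSpace M] {μ : Measure M}
  {W : M → Type*} [∀ x, NormedAddCommGroup (W x)] [∀ x, InnerProductSpace ℂ (W x)]
  (𝓕 : MeasurableField μ W)

theorem lintegral_enorm_sq (u : 𝓕.PreL2) :
    ∫⁻ x, ‖u.val 𝓕 x‖ₑ ^ 2 ∂μ = ENNReal.ofReal (‖u‖ ^ 2) := by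
  rw [norm_sq_preL2, ofReal_integral_eq_lintegral_ofReal (𝓕.integrable_norm_sq u)
    (Filter.Eventually.of_forall fun x => by positivity)]
  refine lintegral_congr fun x => ?_
  rw [ENNReal.ofReal_pow (norm_nonneg _), ofReal_norm]

theorem aemeasurable_enorm_sq {u : Π x, W x} (hu : u ∈ 𝓕.measurableSections) :
    AEMeasurable (fun x => ‖u x‖ₑ ^ 2) μ := by
  have := (𝓕.aestronglyMeasurable_norm hu).aemeasurable.ennreal_ofReal.pow_const 2
  simpa only [ofReal_norm] using this

/-- Riesz-Fischer: if the fibres are complete and almost everywhere limits of measurable sections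
are measurable, then `L²` is complete. -/
theorem completeSpace_preL2 [∀ x, CompleteSpace (W x)]
    (hlim : ∀ (f : ℕ → Π x, W x) (g : Π x, W x), (∀ k, f k ∈ 𝓕.measurableSections) →
      (∀ᵐ x ∂μ, Filter.Tendsto (fun k => f k x) Filter.atTop (𝓝 (g x))) →
      g ∈ 𝓕.measurableSections) : CompleteSpace 𝓕.PreL2 := by
  -- With distances below `4⁻ᴺ` the integrals of squares decay like `16⁻ᴺ`, which leaves room for
  -- the weight `4ᵏ` used below.
  refine Metric.complete_of_convergent_controlled_sequences (fun N => (1 / 4 : ℝ) ^ N)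
    (fun N => by positivity) fun u hu => ?_
  have hmeas : ∀ k, (u k).val 𝓕 ∈ 𝓕.measurableSections := fun k => (u k).2.1
  have hsub : ∀ m k, ∫⁻ x, ‖(u m).val 𝓕 x - (u k).val 𝓕 x‖ₑ ^ 2 ∂μ =
      ENNReal.ofReal (‖u m - u k‖ ^ 2) := fun m k => 𝓕.lintegral_enorm_sq (u m - u k)
  have hsubm : ∀ m k, AEMeasurable (fun x => ‖(u m).val 𝓕 x - (u k).val 𝓕 x‖ₑ ^ 2) μ :=
    fun m k => 𝓕.aemeasurable_enorm_sq (Submodule.sub_mem _ (hmeas m) (hmeas k))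
  have hbound : ∀ N m k, N ≤ m → N ≤ k →
      ∫⁻ x, ‖(u m).val 𝓕 x - (u k).val 𝓕 x‖ₑ ^ 2 ∂μ ≤ ENNReal.ofReal ((1 / 16 : ℝ) ^ N) := by
    intro N m k hm hk
    rw [hsub]
    refine ENNReal.ofReal_le_ofReal ?_
    have h1 := (hu N m k hm hk).le
    rw [dist_eq_norm] at h1
    calc ‖u m - u k‖ ^ 2 ≤ ((1 / 4 : ℝ) ^ N) ^ 2 := by gcongr
      _ = (1 / 16 : ℝ) ^ N := by rw [← pow_mul, mul_comm, pow_mul]; norm_num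
  have hae : ∀ᵐ x ∂μ, CauchySeq fun k => (u k).val 𝓕 x := by
    -- The weighted sum has finite integral, hence a finite value `C` at almost every point; there
    -- the consecutive differences are at most `√C · 2⁻ᵏ`, so the sequence is Cauchy in the fibre.
    have h1 : ∫⁻ x, ∑' k, (4 : ℝ≥0∞) ^ k * ‖(u (k + 1)).val 𝓕 x - (u k).val 𝓕 x‖ₑ ^ 2 ∂μ ≠ ⊤ := by
      rw [lintegral_tsum fun k => (hsubm _ _).const_mul _]
      refine ne_top_of_le_ne_top (b := ∑' k, ENNReal.ofReal ((1 / 4 : ℝ) ^ k)) ?_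
        (ENNReal.tsum_le_tsum fun k => ?_)
      · rw [← ENNReal.ofReal_tsum_of_nonneg (fun k => by positivity)
          (summable_geometric_of_lt_one (by norm_num) (by norm_num))]
        exact ENNReal.ofReal_ne_top
      · rw [lintegral_const_mul'' _ (hsubm _ _)]
        calc (4 : ℝ≥0∞) ^ k * _ ≤ 4 ^ k * ENNReal.ofReal ((1 / 16 : ℝ) ^ k) := by
              gcongr
              exact hbound k (k + 1) k (by omega) le_rfl
          _ = ENNReal.ofReal ((1 / 4 : ℝ) ^ k) := by
              have : (4 : ℝ≥0∞) = ENNReal.ofReal 4 := by simp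
              rw [this, ← ENNReal.ofReal_pow (by norm_num), ← ENNReal.ofReal_mul (by positivity),
                ← mul_pow]
              norm_num
    have h2 := ae_lt_top' (AEMeasurable.tsum fun k => (hsubm _ _).const_mul _) h1
    filter_upwards [h2] with x hx
    set C := ∑' k, (4 : ℝ≥0∞) ^ k * ‖(u (k + 1)).val 𝓕 x - (u k).val 𝓕 x‖ₑ ^ 2 with hC
    refine cauchySeq_of_le_geometric (1 / 2 : ℝ) (√C.toReal) (by norm_num) fun k => ?_
    rw [dist_comm, dist_eq_norm]
    have h3 : (4 : ℝ≥0∞) ^ k * ‖(u (k + 1)).val 𝓕 x - (u k).val 𝓕 x‖ₑ ^ 2 ≤ C :=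
      ENNReal.le_tsum k
    have h4 := ENNReal.toReal_mono hx.ne h3
    simp only [ENNReal.toReal_mul, ENNReal.toReal_pow, ENNReal.toReal_ofNat, toReal_enorm] at h4
    set d := ‖(u (k + 1)).val 𝓕 x - (u k).val 𝓕 x‖
    have h5 : (2 ^ k * d) ^ 2 ≤ C.toReal := by
      have : (2 ^ k * d) ^ 2 = 4 ^ k * d ^ 2 := by
        rw [mul_pow, ← pow_mul, mul_comm k, pow_mul]; norm_num
      rwa [this]
    have h6 := Real.le_sqrt_of_sq_le h5
    rw [one_div, inv_pow, ← div_eq_mul_inv, le_div_iff₀ (by positivity), mul_comm]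
    exact h6
  classical
  -- The value `0` is taken only on a null set, and `hlim` asks for convergence almost everywhere.
  let g : Π x, W x := fun x => if h : CauchySeq fun k => (u k).val 𝓕 x then
    (cauchySeq_tendsto_of_complete h).choose else 0
  have hg : ∀ᵐ x ∂μ, Filter.Tendsto (fun k => (u k).val 𝓕 x) Filter.atTop (𝓝 (g x)) := by
    filter_upwards [hae] with x hx
    simp only [g, hx, dif_pos]
    exact (cauchySeq_tendsto_of_complete hx).choose_spec
  have hgm : g ∈ 𝓕.measurableSections := hlim _ g hmeas hg
  -- Fatou's lemma in `m` with `N` fixed gives both the square integrability of `g` and the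
  -- convergence of `u` to it.
  have hfatou : ∀ N, ∫⁻ x, ‖g x - (u N).val 𝓕 x‖ₑ ^ 2 ∂μ ≤ ENNReal.ofReal ((1 / 16 : ℝ) ^ N) := by
    intro N
    calc ∫⁻ x, ‖g x - (u N).val 𝓕 x‖ₑ ^ 2 ∂μ
        = ∫⁻ x, Filter.liminf (fun m => ‖(u m).val 𝓕 x - (u N).val 𝓕 x‖ₑ ^ 2) Filter.atTop ∂μ := by
          refine lintegral_congr_ae ?_
          filter_upwards [hg] with x hx
          have : Filter.Tendsto (fun m => ‖(u m).val 𝓕 x - (u N).val 𝓕 x‖ₑ ^ 2) Filter.atTop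
              (𝓝 (‖g x - (u N).val 𝓕 x‖ₑ ^ 2)) := by
            refine ((ENNReal.continuous_pow 2).tendsto _).comp ?_
            exact (continuous_enorm.tendsto _).comp (hx.sub_const _)
          exact this.liminf_eq.symm
      _ ≤ Filter.liminf (fun m => ∫⁻ x, ‖(u m).val 𝓕 x - (u N).val 𝓕 x‖ₑ ^ 2 ∂μ) Filter.atTop :=
          lintegral_liminf_le' fun m => hsubm m N
      _ ≤ ENNReal.ofReal ((1 / 16 : ℝ) ^ N) := by
          refine Filter.liminf_le_of_frequently_le' (Filter.Eventually.frequently ?_)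
          filter_upwards [Filter.eventually_ge_atTop N] with m hm
          exact hbound N m N hm le_rfl
  have hdiff : ∀ N, (g - (u N).val 𝓕) ∈ 𝓕.sqIntegrable := fun N =>
    ⟨Submodule.sub_mem _ hgm (hmeas N), (hfatou N).trans_lt ENNReal.ofReal_lt_top⟩
  have hgs : g ∈ 𝓕.sqIntegrable := by
    have := Submodule.add_mem _ (hdiff 0) (u 0).2
    rwa [show (g - (u 0).val 𝓕) + (u 0).1 = g from sub_add_cancel g _] at this
  refine ⟨(show 𝓕.PreL2 from ⟨g, hgs⟩), ?_⟩
  set G : 𝓕.PreL2 := ⟨g, hgs⟩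
  rw [tendsto_iff_norm_sub_tendsto_zero]
  refine squeeze_zero (fun _ => norm_nonneg _) (g := fun N => (1 / 4 : ℝ) ^ N) (fun N => ?_)
    (tendsto_pow_atTop_nhds_zero_of_lt_one (by norm_num) (by norm_num))
  have h1 : ENNReal.ofReal (‖G - u N‖ ^ 2) ≤ ENNReal.ofReal ((1 / 16 : ℝ) ^ N) := by
    rw [← 𝓕.lintegral_enorm_sq]
    exact hfatou N
  rw [ENNReal.ofReal_le_ofReal_iff (by positivity)] at h1
  rw [norm_sub_rev]
  refine abs_le_of_sq_le_sq' (h1.trans_eq ?_) (by positivity) |>.2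
  rw [← pow_mul, mul_comm, pow_mul]; norm_num

end MeasurableField

/-! ### Completeness of the `L²` spaces of sections -/

section Fields

local notation "𝔼" n:max => EuclideanSpace ℝ (Fin n)

variable {M : Type*} [TopologicalSpace M] [SecondCountableTopology M]
  [MeasurableSpace M] [BorelSpace M]
  {n : ℕ} [ChartedSpace (𝔼 n) M] [IsManifold (𝓡 n) ∞ M]
  [RiemannianBundle (fun x : M => TangentSpace (𝓡 n) x)]
  [IsContMDiffRiemannianBundle (𝓡 n) ∞ (𝔼 n) (fun x : M => TangentSpace (𝓡 n) x)]
  {F : Type*} [NormedAddCommGroup F] [NormedSpace ℂ F] [FiniteDimensional ℂ F]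
  {V : M → Type*} [TopologicalSpace (TotalSpace F V)] [∀ x, NormedAddCommGroup (V x)]
  [∀ x, InnerProductSpace ℂ (V x)] [FiberBundle F V] [VectorBundle ℝ F V] [VectorBundle ℂ F V]
  [ContMDiffVectorBundle ∞ F V (𝓡 n)] [IsSmoothHermitianBundle F V n]

variable (F) in
include F in
theorem finiteDimensional_fiber (x : M) : FiniteDimensional ℂ (V x) :=
  ((trivializationAt F V x).continuousLinearEquivAt ℂ x
    (FiberBundle.mem_baseSet_trivializationAt F V x)).symm.toLinearEquiv.finiteDimensional

variable (F) in
include F in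
theorem completeSpace_fiber (x : M) : CompleteSpace (V x) := by
  have := finiteDimensional_fiber F (V := V) x
  exact FiniteDimensional.complete ℂ (V x)

theorem finiteDimensional_cotangentTensor [∀ x, FiniteDimensional ℂ (V x)] (x : M) :
    FiniteDimensional ℂ (CotangentTensor V n x) := by
  have h1 : FiniteDimensional ℝ (V x) := FiniteDimensional.trans ℝ ℂ (V x)
  have h2 : FiniteDimensional ℝ (TangentSpace (𝓡 n) x →L[ℝ] V x) := inferInstance
  have h3 : FiniteDimensional ℂ (TangentSpace (𝓡 n) x →L[ℝ] V x) :=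
    FiniteDimensional.right ℝ ℂ _
  exact h3

theorem CotangentTensor.norm_sq_eq {x : M} (A : CotangentTensor V n x) :
    ‖A‖ ^ 2 = ∑ i, ‖A.toHom V n (stdOrthonormalBasis ℝ (TangentSpace (𝓡 n) x) i)‖ ^ 2 := by
  have h : inner ℂ A A =
      ∑ i, inner ℂ (A.toHom V n (stdOrthonormalBasis ℝ (TangentSpace (𝓡 n) x) i))
        (A.toHom V n (stdOrthonormalBasis ℝ (TangentSpace (𝓡 n) x) i)) := rfl
  rw [@norm_sq_eq_re_inner ℂ, h, map_sum]
  exact Finset.sum_congr rfl fun i _ => (norm_sq_eq_re_inner _).symm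

/-- The Hilbert-Schmidt norm dominates the operator norm: expand `v` in the orthonormal basis and
apply Cauchy-Schwarz. This links the norm of `T*M ⊗ V` to the topology of the Hom bundle, in which
measurability is defined. -/
theorem CotangentTensor.norm_apply_le {x : M} (A : CotangentTensor V n x)
    (v : TangentSpace (𝓡 n) x) : ‖A.toHom V n v‖ ≤ ‖A‖ * ‖v‖ := by
  set e := stdOrthonormalBasis ℝ (TangentSpace (𝓡 n) x)
  have h1 : A.toHom V n v = ∑ i, inner ℝ (e i) v • A.toHom V n (e i) := by
    conv_lhs => rw [← e.sum_repr' v]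
    simp
  have h2 : ‖A.toHom V n v‖ ≤ ∑ i, ‖inner ℝ (e i) v‖ * ‖A.toHom V n (e i)‖ := by
    rw [h1]
    refine (norm_sum_le _ _).trans (Finset.sum_le_sum fun i _ => ?_)
    rw [norm_smul]
  refine h2.trans ?_
  refine abs_le_of_sq_le_sq' ?_ (by positivity) |>.2
  refine (Finset.sum_mul_sq_le_sq_mul_sq _ _ _).trans_eq ?_
  rw [mul_pow, A.norm_sq_eq, e.sum_sq_norm_inner_right, mul_comm]

instance completeSpace_L2Section : CompleteSpace (L2Section (M := M) n F V) := by
  have := completeSpace_fiber F (V := V)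
  have : CompleteSpace (sectionField (M := M) n F V).PreL2 := by
    refine MeasurableField.completeSpace_preL2 _ fun f g hf hg x₀ => ?_
    refine aestronglyMeasurable_of_tendsto_ae Filter.atTop (fun k => hf k x₀) ?_
    filter_upwards [ae_restrict_mem (trivializationAt F V x₀).open_baseSet.measurableSet,
      ae_restrict_of_ae hg] with x hx hgx
    -- Fibrewise convergence is carried to the model fibre by the trivialization, where limits of
    -- measurable functions are measurable.
    have hc := ((trivializationAt F V x₀).continuousLinearEquivAt ℝ x hx).continuous
    exact (hc.tendsto (g x)).comp hgx
  infer_instance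

instance completeSpace_L2Cotangent : CompleteSpace (L2Cotangent (M := M) n F V) := by
  have := finiteDimensional_fiber F (V := V)
  have := finiteDimensional_cotangentTensor (n := n) (V := V)
  have := fun x => FiniteDimensional.complete ℂ (CotangentTensor V n x)
  have : CompleteSpace (cotangentField (M := M) n F V).PreL2 := by
    refine MeasurableField.completeSpace_preL2 _ fun f g hf hg x₀ => ?_
    refine aestronglyMeasurable_of_tendsto_ae Filter.atTop (fun k => hf k x₀) ?_
    filter_upwards [ae_restrict_mem (trivializationAt (𝔼 n →L[ℝ] F)
          (fun x : M => TangentSpace (𝓡 n) x →L[ℝ] V x) x₀).open_baseSet.measurableSet,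
      ae_restrict_of_ae hg] with x hx hgx
    have hc := ((trivializationAt (𝔼 n →L[ℝ] F)
          (fun x : M => TangentSpace (𝓡 n) x →L[ℝ] V x) x₀).continuousLinearEquivAt
            ℝ x hx).continuous
    -- Convergence is known in the Hilbert-Schmidt norm, while the trivialization is continuous for
    -- the operator norm.
    have hl : Continuous (fun A : CotangentTensor V n x => A.toHom V n) :=
      AddMonoidHomClass.continuous_of_bound
        (⟨⟨fun A : CotangentTensor V n x => A.toHom V n, rfl⟩, fun _ _ => rfl⟩ :
          CotangentTensor V n x →+ (TangentSpace (𝓡 n) x →L[ℝ] V x)) 1 fun A => by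
        rw [one_mul]
        exact ContinuousLinearMap.opNorm_le_bound _ (norm_nonneg _) A.norm_apply_le
    exact ((hc.comp hl).tendsto (g x)).comp hgx
  infer_instance

end Fields

/-! ### Hopf-Rinow: compactness of closed balls of finite radius -/

section HopfRinow

variable {M : Type*} [EMetricSpace M]

/-- In a locally compact complete space in which distances can be split, as in a length space,
bounded closed balls are compact. -/
theorem isCompact_closedEBall_of_split [LocallyCompactSpace M] [CompleteSpace M]
    (hsplit : ∀ (x z : M) (a b : ℝ≥0∞), 0 < b → edist x z < a + b →
      ∃ y, edist x y ≤ a ∧ edist y z < b)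
    (x : M) {r : ℝ≥0∞} (hr : r ≠ ⊤) : IsCompact (Metric.closedEBall x r) := by
  -- A continuity argument on the radius: the admissible radii form an initial segment which can be
  -- prolonged beyond each finite member (`hext`) and contains its finite suprema (`hlim`).
  set S : Set ℝ≥0∞ := {s | IsCompact (Metric.closedEBall x s)} with hS
  have hmono : ∀ s ∈ S, ∀ t ≤ s, t ∈ S := fun s hs t hts =>
    IsCompact.of_isClosed_subset hs Metric.isClosed_closedEBall (Metric.closedEBall_subset_closedEBall hts)
  have hnear : ∀ (s t : ℝ≥0∞) (ε : ℝ≥0∞), s < ⊤ → 0 < ε → t < s + ε →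
      ∀ z ∈ Metric.closedEBall x t, ∃ y ∈ Metric.closedEBall x s, edist y z < ε := by
    intro s t ε _ hε ht z hz
    obtain ⟨y, hy1, hy2⟩ := hsplit x z s ε hε (by
      rw [Metric.mem_closedEBall, edist_comm] at hz
      exact hz.trans_lt ht)
    exact ⟨y, by rwa [Metric.mem_closedEBall, edist_comm], hy2⟩
  -- By local compactness a compact ball has a thickening inside a compact set, and by the splitting
  -- property a slightly larger ball lies in that thickening.
  have hext : ∀ s ∈ S, s < ⊤ → ∃ δ > 0, s + δ ∈ S := by
    intro s hs hst
    obtain ⟨K, hK, hsK⟩ := exists_compact_superset (show IsCompact (Metric.closedEBall x s) from hs)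
    obtain ⟨δ, hδ, hδK⟩ := hs.exists_thickening_subset_open isOpen_interior hsK
    refine ⟨ENNReal.ofReal (δ / 2), by positivity, ?_⟩
    refine hK.of_isClosed_subset Metric.isClosed_closedEBall fun z hz => interior_subset (hδK ?_)
    obtain ⟨y, hy, hyz⟩ := hnear s (s + ENNReal.ofReal (δ / 2)) (ENNReal.ofReal δ) hst (by positivity)
      (ENNReal.add_lt_add_left hst.ne ((ENNReal.ofReal_lt_ofReal_iff hδ).2 (by linarith))) z hz
    exact (Metric.mem_thickening_iff_exists_edist_lt _ _).2 ⟨y, hy, by rwa [edist_comm]⟩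
  -- The ball of radius `t` is closed in a complete space, so total boundedness suffices.
  have hlim : ∀ t, t < ⊤ → (∀ s < t, s ∈ S) → t ∈ S := by
    intro t htop ht
    rcases eq_or_ne t 0 with rfl | ht0
    · change IsCompact (Metric.closedEBall x 0)
      rw [Metric.closedEBall_zero]
      exact isCompact_singleton
    refine isCompact_iff_totallyBounded_isComplete.2 ⟨?_, Metric.isClosed_closedEBall.isComplete⟩
    rw [EMetric.totallyBounded_iff]
    intro ε hε
    rcases lt_or_ge t (ε / 2) with h | h
    · refine ⟨{x}, finite_singleton x, fun z hz => ?_⟩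
      simp only [mem_singleton_iff, iUnion_iUnion_eq_left, Metric.mem_eball]
      exact (Metric.mem_closedEBall.1 hz).trans_lt (h.trans_le ENNReal.half_le_self)
    have hεtop : ε ≠ ⊤ := by
      rintro rfl
      rw [ENNReal.top_div_of_ne_top (by simp)] at h
      exact htop.not_ge h
    -- Every point of the ball of radius `t` is within `ε / 2` of the compact ball of radius `t - ε
    -- / 4`, so a finite `ε / 2`-net of the latter is an `ε`-net of the former.
    have hs : t - ε / 2 / 2 ∈ S := ht _ (ENNReal.sub_lt_self htop.ne ht0 (by simp [hε.ne']))
    have hq : ε / 2 / 2 < ε / 2 :=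
      ENNReal.half_lt_self (a := ε / 2) (by simp [hε.ne'])
        (ENNReal.div_lt_top hεtop (by simp)).ne
    obtain ⟨T, hT, hTc⟩ := EMetric.totallyBounded_iff.1
      (show IsCompact (Metric.closedEBall x (t - ε / 2 / 2)) from hs).totallyBounded (ε / 2) (by simp [hε.ne'])
    refine ⟨T, hT, fun z hz => ?_⟩
    have hfin : t - ε / 2 / 2 < ⊤ := tsub_le_self.trans_lt htop
    obtain ⟨y, hy, hyz⟩ := hnear (t - ε / 2 / 2) t (ε / 2) hfin (by simp [hε.ne']) (by
      calc t = (t - ε / 2 / 2) + ε / 2 / 2 := (tsub_add_cancel_of_le (hq.le.trans h)).symm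
        _ < _ := ENNReal.add_lt_add_left hfin.ne hq) z hz
    obtain ⟨c, hc, hyc⟩ := mem_iUnion₂.1 (hTc hy)
    refine mem_iUnion₂.2 ⟨c, hc, ?_⟩
    rw [Metric.mem_eball] at hyc ⊢
    calc edist z c ≤ edist z y + edist y c := edist_triangle _ _ _
      _ < ε / 2 + ε / 2 := ENNReal.add_lt_add (by rwa [edist_comm]) hyc
      _ = ε := ENNReal.add_halves ε
  by_contra hcon
  set R := sSup S with hR
  have hRr : R ≤ r := by
    refine sSup_le fun s hs => ?_
    by_contra h
    exact hcon (hmono s hs r (not_le.1 h).le)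
  have hRtop : R < ⊤ := hRr.trans_lt (lt_top_iff_ne_top.2 hr)
  have hRS : R ∈ S := hlim R hRtop fun s hs => by
    obtain ⟨t, ht, hst⟩ := lt_sSup_iff.1 hs
    exact hmono t ht s hst.le
  obtain ⟨δ, hδ, hδS⟩ := hext R hRS hRtop
  exact (le_sSup hδS).not_gt (ENNReal.lt_add_right hRtop.ne hδ.ne')

variable {n : ℕ} [ChartedSpace (EuclideanSpace ℝ (Fin n)) M]
  [RiemannianBundle (fun x : M => TangentSpace (𝓡 n) x)]
  [IsRiemannianManifold (𝓡 n) M]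

variable (n) in
include n in
-- Take a path from `x` to `z` of length less than `a + b` and stop where its distance from `x`
-- equals `a`. The part already travelled has length at least `a`, so the remaining part is shorter
-- than `b`.
theorem exists_edist_le_edist_lt {x z : M} {a b : ℝ≥0∞} (hb : 0 < b) (h : edist x z < a + b) :
    ∃ y, edist x y ≤ a ∧ edist y z < b := by
  rcases le_or_gt (edist x z) a with h1 | h1
  · exact ⟨z, h1, by simpa using hb⟩
  rw [IsRiemannianManifold.out (I := 𝓡 n)] at h
  obtain ⟨γ, h0, h2, hγ, hlen⟩ := Manifold.exists_lt_of_riemannianEDist_lt h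
  have hc : ContinuousOn (fun t => edist x (γ t)) (Icc 0 1) :=
    (continuous_const.edist continuous_id).comp_continuousOn hγ.continuousOn
  obtain ⟨t, ht, hta⟩ := intermediate_value_Icc zero_le_one hc
    (show a ∈ Icc _ _ by simp [h0, h2, h1.le])
  refine ⟨γ t, hta.le, ?_⟩
  have h3 := Manifold.riemannianEDist_le_pathELength (I := 𝓡 n)
    (hγ.mono (Icc_subset_Icc le_rfl ht.2)) h0 rfl ht.1
  have h4 := Manifold.riemannianEDist_le_pathELength (I := 𝓡 n)
    (hγ.mono (Icc_subset_Icc ht.1 le_rfl)) rfl h2 ht.2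
  rw [← IsRiemannianManifold.out (I := 𝓡 n)] at h3 h4
  rw [← Manifold.pathELength_add ht.1 ht.2] at hlen
  have ha : a ≠ ⊤ := (h1.trans_le le_top).ne
  refine h4.trans_lt ?_
  simp only at hta
  rw [hta] at h3
  by_contra hcon
  exact hlen.not_ge (add_le_add h3 (not_lt.1 hcon))

variable (n) in
include n in
theorem isCompact_closedEBall [CompleteSpace M] (x : M) {r : ℝ≥0∞} (hr : r ≠ ⊤) :
    IsCompact (Metric.closedEBall x r) := by
  have : LocallyCompactSpace M := ChartedSpace.locallyCompactSpace (EuclideanSpace ℝ (Fin n)) M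
  exact isCompact_closedEBall_of_split (fun x z a b hb h => exists_edist_le_edist_lt n hb h) x hr

end HopfRinow

/-! ### Mollification of Lipschitz functions in Euclidean coordinates -/

section Mollification

variable {E : Type*} [NormedAddCommGroup E] [InnerProductSpace ℝ E] [FiniteDimensional ℝ E]
  [MeasurableSpace E] [BorelSpace E]
  {T : Type*} [NormedAddCommGroup T] [NormedSpace ℝ T]

/-- A function which is Lipschitz with respect to the seminorm `‖L ·‖` is uniformly close to smooth
functions whose derivatives satisfy the same bound. -/
theorem exists_contDiff_approx (L : E →L[ℝ] T) {K : ℝ} (hK : 0 ≤ K) {f : E → ℝ}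
    (hf : ∀ y z, |f y - f z| ≤ K * ‖L (y - z)‖) {ε : ℝ} (hε : 0 < ε) :
    ∃ h : E → ℝ, ContDiff ℝ ∞ h ∧ (∀ y, |h y - f y| ≤ ε) ∧
      ∀ y v, |fderiv ℝ h y v| ≤ K * ‖L v‖ := by
  have hLip : ∀ y z, dist (f y) (f z) ≤ (K * ‖L‖) * dist y z := by
    intro y z
    rw [Real.dist_eq, dist_eq_norm, mul_assoc]
    exact (hf y z).trans (mul_le_mul_of_nonneg_left (L.le_opNorm _) hK)
  have hfc : Continuous f :=
    (LipschitzWith.of_dist_le_mul (K := ⟨K * ‖L‖, by positivity⟩) hLip).continuous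
  -- Since `f` is Lipschitz with constant `K * ‖L‖`, it varies by at most `ε` at this scale; the
  -- summand `1` keeps the denominator positive.
  set δ : ℝ := ε / (K * ‖L‖ + 1) with hδ
  have hδ0 : 0 < δ := by positivity
  let φ : ContDiffBump (0 : E) := ⟨δ / 2, δ, by positivity, by linarith⟩
  let η : E → ℝ := φ.normed volume
  let h : E → ℝ := convolution η f (ContinuousLinearMap.lsmul ℝ ℝ) volume
  have hηc : Continuous η := φ.continuous_normed
  have hηs : HasCompactSupport η := φ.hasCompactSupport_normed
  have hint : ∀ y, Integrable (fun t => η t * f (y - t)) volume := fun y =>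
    (hηc.mul (hfc.comp (continuous_const.sub continuous_id))).integrable_of_hasCompactSupport
      hηs.mul_right
  have hh : ∀ y, h y = ∫ t, η t * f (y - t) := fun y => by simp [h, convolution_def]
  have hhd : ContDiff ℝ ∞ h :=
    hηs.contDiff_convolution_left _ φ.contDiff_normed hfc.locallyIntegrable
  -- The convolution is an average of translates of `f`, and the bound is translation invariant.
  have hhL : ∀ y z, |h y - h z| ≤ K * ‖L (y - z)‖ := by
    intro y z
    rw [hh, hh, ← integral_sub (hint y) (hint z)]
    calc |∫ t, η t * f (y - t) - η t * f (z - t)|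
        ≤ ∫ t, η t * (K * ‖L (y - z)‖) := by
          rw [← Real.norm_eq_abs]
          refine norm_integral_le_of_norm_le
            ((φ.integrable_normed).mul_const _) (Filter.Eventually.of_forall fun t => ?_)
          rw [← mul_sub, norm_mul, Real.norm_of_nonneg (φ.nonneg_normed t)]
          refine mul_le_mul_of_nonneg_left ?_ (φ.nonneg_normed t)
          have := hf (y - t) (z - t)
          rwa [sub_sub_sub_cancel_right] at this
      _ = K * ‖L (y - z)‖ := by
          rw [integral_mul_const, φ.integral_normed, one_mul]
  refine ⟨h, hhd, fun y => ?_, fun y v => ?_⟩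
  · rw [← Real.dist_eq]
    refine φ.dist_normed_convolution_le hfc.aestronglyMeasurable fun x hx => ?_
    refine (hLip x y).trans ?_
    have h1 : dist x y ≤ δ := (Metric.mem_ball.1 hx).le
    calc K * ‖L‖ * dist x y ≤ (K * ‖L‖ + 1) * δ := by
          gcongr
          linarith
      _ = ε := by rw [hδ]; field_simp
  · have h1 : HasDerivAt (fun t : ℝ => h (y + t • v)) (fderiv ℝ h y v) 0 := by
      have h2 : HasFDerivAt h (fderiv ℝ h y) (y + (0 : ℝ) • v) := by
        rw [zero_smul, add_zero]
        exact (hhd.differentiable (by simp) y).hasFDerivAt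
      have h3 : HasDerivAt (fun t : ℝ => y + t • v) v 0 := by
        simpa using ((hasDerivAt_id (0 : ℝ)).smul_const v).const_add y
      exact h2.comp_hasDerivAt 0 h3
    rw [← Real.norm_eq_abs]
    -- Restricting to the line through `y` in direction `v` keeps the seminorm `‖L v‖` sharp; a
    -- bound on the operator norm of the derivative would lose it.
    refine h1.le_of_lip' (by positivity) (Filter.Eventually.of_forall fun t => ?_)
    have h4 := hhL (y + t • v) (y + (0 : ℝ) • v)
    rw [show y + t • v - (y + (0 : ℝ) • v) = t • v by simp, map_smul, norm_smul] at h4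
    rw [sub_zero, Real.norm_eq_abs]
    exact h4.trans_eq (by ring)

/-- Transported by `L`, the hypothesis is ordinary Lipschitz continuity on a subset of `T`, and
real-valued functions extend with the same constant. Mollification needs the function on the whole
space. -/
theorem exists_lipschitz_extension (L : E ≃L[ℝ] T) {K : ℝ} (hK : 0 ≤ K) {f : E → ℝ} {s : Set E}
    (hf : ∀ y ∈ s, ∀ z ∈ s, |f y - f z| ≤ K * ‖L (y - z)‖) :
    ∃ g : E → ℝ, (∀ y z, |g y - g z| ≤ K * ‖L (y - z)‖) ∧ EqOn f g s := by
  have h1 : LipschitzOnWith ⟨K, hK⟩ (f ∘ L.symm) (L '' s) := by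
    refine LipschitzOnWith.of_dist_le_mul ?_
    rintro _ ⟨y, hy, rfl⟩ _ ⟨z, hz, rfl⟩
    simp only [Function.comp_apply, ContinuousLinearEquiv.symm_apply_apply,
      dist_eq_norm, ← map_sub]
    exact hf y hy z hz
  obtain ⟨g, hg, hgs⟩ := h1.extend_real
  refine ⟨g ∘ L, fun y z => ?_, fun y hy => ?_⟩
  · have := hg.dist_le_mul (L y) (L z)
    rwa [Real.dist_eq, dist_eq_norm, ← map_sub] at this
  · have := hgs (mem_image_of_mem L hy)
    simpa using this

end Mollification

/-! ### Smooth approximation of Lipschitz functions near a point -/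

section LocalApprox

local notation "𝔼" n:max => EuclideanSpace ℝ (Fin n)

variable {n : ℕ} {M : Type*}

section
variable [TopologicalSpace M] [ChartedSpace (𝔼 n) M] [IsManifold (𝓡 n) ∞ M]

theorem mvfderiv_comp_chart {W : Type*} [NormedAddCommGroup W] [NormedSpace ℝ W] (p : M) {x : M}
    (hx : x ∈ (chartAt (𝔼 n) p).source) {h : 𝔼 n → W}
    (hh : DifferentiableAt ℝ h (extChartAt (𝓡 n) p x)) (v : TangentSpace (𝓡 n) x) :
    mvfderiv (𝓡 n) (h ∘ extChartAt (𝓡 n) p) x v =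
      fderiv ℝ h (extChartAt (𝓡 n) p x)
        ((trivializationAt (𝔼 n) (fun x : M => TangentSpace (𝓡 n) x) p).continuousLinearMapAt
          ℝ x v) := by
  have h1 := mfderiv_comp_apply x hh.mdifferentiableAt
    (mdifferentiableAt_extChartAt (I := 𝓡 n) hx) v
  rw [TangentBundle.continuousLinearMapAt_trivializationAt hx]
  rw [mfderiv_eq_fderiv] at h1
  exact h1

/-- The frame at `x` is the frame at `p` followed by a comparison map from the tangent space at `p`
to that at `x`. The norm of this map is close to `1` near `p`, so the fixed norm at `p` can serve as
the reference norm on coordinates. -/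
theorem symmL_trivializationAt_comp (p x : M)
    (w : 𝔼 n) :
    (trivializationAt (𝔼 n) (fun x : M => TangentSpace (𝓡 n) x) p).symmL ℝ x w =
    ((trivializationAt (𝔼 n) (fun x : M => TangentSpace (𝓡 n) x) p).symmL ℝ x ∘L
      (trivializationAt (𝔼 n) (fun x : M => TangentSpace (𝓡 n) x) p).continuousLinearMapAt ℝ p)
      ((trivializationAt (𝔼 n) (fun x : M => TangentSpace (𝓡 n) x) p).symmL ℝ p w) := by
  rw [ContinuousLinearMap.comp_apply,
    Trivialization.continuousLinearMapAt_symmL _ (FiberBundle.mem_baseSet_trivializationAt' p)]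

variable [RiemannianBundle (fun x : M => TangentSpace (𝓡 n) x)]

theorem norm_mfderivWithin_chart_symm (p : M) {y : 𝔼 n}
    (hy : y ∈ (extChartAt (𝓡 n) p).target) (w : 𝔼 n) :
    ‖mfderivWithin 𝓘(ℝ, 𝔼 n) (𝓡 n) (extChartAt (𝓡 n) p).symm (range (𝓡 n)) y w‖ =
      ‖(trivializationAt (𝔼 n) (fun x : M => TangentSpace (𝓡 n) x) p).symmL ℝ
        ((extChartAt (𝓡 n) p).symm y) w‖ := by
  have hx : (extChartAt (𝓡 n) p).symm y ∈ (chartAt (𝔼 n) p).source := by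
    rw [← extChartAt_source (𝓡 n)]
    exact (extChartAt (𝓡 n) p).map_target hy
  have h := TangentBundle.symmL_trivializationAt (𝕜 := ℝ) (I := 𝓡 n) hx
  have h1 := DFunLike.congr_fun h w
  -- The chart applied to its inverse returns `y` only up to a propositional equality, so the
  -- derivatives at the two base points are identified by substitution.
  have h2 : ∀ y', y' = y →
      (mfderivWithin 𝓘(ℝ, 𝔼 n) (𝓡 n) (extChartAt (𝓡 n) p).symm (range (𝓡 n)) y' w : 𝔼 n) =
      (mfderivWithin 𝓘(ℝ, 𝔼 n) (𝓡 n) (extChartAt (𝓡 n) p).symm (range (𝓡 n)) y w : 𝔼 n) := by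
    rintro _ rfl; rfl
  have h3 := h1.trans (h2 _ ((extChartAt (𝓡 n) p).right_inv hy))
  exact congrArg (fun v : TangentSpace (𝓡 n) ((extChartAt (𝓡 n) p).symm y) => ‖v‖) h3.symm

variable [IsContMDiffRiemannianBundle (𝓡 n) ∞ (𝔼 n) (fun x : M => TangentSpace (𝓡 n) x)]

theorem isContinuousRiemannianBundle_tangent :
    IsContinuousRiemannianBundle (𝔼 n) (fun x : M => TangentSpace (𝓡 n) x) := by
  obtain ⟨g, hg, hg'⟩ := IsContMDiffRiemannianBundle.exists_contMDiff (IB := 𝓡 n) (n := ∞)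
    (F := 𝔼 n) (E := fun x : M => TangentSpace (𝓡 n) x)
  exact ⟨g, hg.continuous, hg'⟩

end

variable [EMetricSpace M] [ChartedSpace (𝔼 n) M] [IsManifold (𝓡 n) ∞ M]
  [RiemannianBundle (fun x : M => TangentSpace (𝓡 n) x)]
  [IsRiemannianManifold (𝓡 n) M]

/-- On a convex set of coordinates on which the metric is bounded by `K` times that at `p`, the
Riemannian distance is bounded by `K` times the distance of the coordinates. -/
theorem edist_chart_symm_le (p : M) {K : ℝ} {s : Set (𝔼 n)} (hs : Convex ℝ s)
    (hst : s ⊆ (extChartAt (𝓡 n) p).target)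
    (hsK : ∀ y ∈ s, ‖(trivializationAt (𝔼 n) (fun x : M => TangentSpace (𝓡 n) x) p).symmL ℝ
        ((extChartAt (𝓡 n) p).symm y) ∘L
      (trivializationAt (𝔼 n) (fun x : M => TangentSpace (𝓡 n) x) p).continuousLinearMapAt ℝ p‖ ≤ K)
    {y z : 𝔼 n} (hy : y ∈ s) (hz : z ∈ s) :
    edist ((extChartAt (𝓡 n) p).symm y) ((extChartAt (𝓡 n) p).symm z) ≤
      ENNReal.ofReal (K * ‖(trivializationAt (𝔼 n) (fun x : M => TangentSpace (𝓡 n) x) p).symmL ℝ p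
        (y - z)‖) := by
  set T := trivializationAt (𝔼 n) (fun x : M => TangentSpace (𝓡 n) x) p
  -- The distance is bounded by the length of the image of the straight segment, which stays in `s`
  -- by convexity and has constant coordinate velocity `z - y`.
  let η := ContinuousAffineMap.lineMap (R := ℝ) y z
  set γ := (extChartAt (𝓡 n) p).symm ∘ η with hγ
  have hηs : ∀ t ∈ Icc (0 : ℝ) 1, η t ∈ s := by
    intro t ht
    refine hs.segment_subset hy hz ?_
    rw [segment_eq_image_lineMap]
    exact ⟨t, ht, rfl⟩
  have η_smooth : ContMDiffOn 𝓘(ℝ, ℝ) 𝓘(ℝ, 𝔼 n) 1 η (Icc 0 1) :=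
    (contMDiff_iff_contDiff.2 (ContinuousAffineMap.contDiff _)).contMDiffOn
  have hlen : edist ((extChartAt (𝓡 n) p).symm y) ((extChartAt (𝓡 n) p).symm z) ≤
      Manifold.pathELength (𝓡 n) γ 0 1 := by
    rw [IsRiemannianManifold.out (I := 𝓡 n)]
    refine Manifold.riemannianEDist_le_pathELength ?_ ?_ ?_ zero_le_one
    · exact (contMDiffOn_extChartAt_symm p).comp η_smooth fun t ht => hst (hηs t ht)
    · simp [γ, η, ContinuousAffineMap.coe_lineMap_eq]
    · simp [γ, η, ContinuousAffineMap.coe_lineMap_eq]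
  refine hlen.trans ?_
  rw [Manifold.pathELength_eq_lintegral_mfderivWithin_Icc]
  calc ∫⁻ t in Icc (0 : ℝ) 1, ‖mfderivWithin 𝓘(ℝ, ℝ) (𝓡 n) γ (Icc 0 1) t 1‖ₑ
      ≤ ∫⁻ t in Icc (0 : ℝ) 1, ENNReal.ofReal (K * ‖T.symmL ℝ p (y - z)‖) := by
        refine setLIntegral_mono' measurableSet_Icc fun t ht => ?_
        have h1 : mfderivWithin 𝓘(ℝ, ℝ) (𝓡 n) γ (Icc 0 1) t =
            (mfderivWithin 𝓘(ℝ, 𝔼 n) (𝓡 n) (extChartAt (𝓡 n) p).symm (range (𝓡 n)) (η t)) ∘L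
              (mfderivWithin 𝓘(ℝ, ℝ) 𝓘(ℝ, 𝔼 n) η (Icc 0 1) t) := by
          apply mfderivWithin_comp
          · exact mdifferentiableWithinAt_extChartAt_symm (hst (hηs t ht))
          · exact η_smooth.mdifferentiableOn one_ne_zero t ht
          · exact fun t ht => extChartAt_target_subset_range p (hst (hηs t ht))
          · rw [uniqueMDiffWithinAt_iff_uniqueDiffWithinAt]
            exact uniqueDiffOn_Icc zero_lt_one t ht
        have h2 : (mfderivWithin 𝓘(ℝ, ℝ) 𝓘(ℝ, 𝔼 n) η (Icc 0 1) t (1 : ℝ) : 𝔼 n) = z - y := by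
          rw [mfderivWithin_eq_fderivWithin, fderivWithin_eq_fderiv
            (uniqueDiffOn_Icc zero_lt_one _ ht) (ContinuousAffineMap.differentiableAt _)]
          have h3 : fderiv ℝ η t (1 : ℝ) = z - y := by simp [η]
          exact h3
        have h3 : mfderivWithin 𝓘(ℝ, ℝ) (𝓡 n) γ (Icc 0 1) t (1 : ℝ) =
            (mfderivWithin 𝓘(ℝ, 𝔼 n) (𝓡 n) (extChartAt (𝓡 n) p).symm (range (𝓡 n)) (η t))
              (z - y) := by
          rw [h1, ← h2]
          rfl
        rw [← ofReal_norm]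
        refine ENNReal.ofReal_le_ofReal ?_
        have h4 : ‖mfderivWithin 𝓘(ℝ, ℝ) (𝓡 n) γ (Icc 0 1) t (1 : ℝ)‖ =
            ‖T.symmL ℝ ((extChartAt (𝓡 n) p).symm (η t)) (z - y)‖ :=
          (congrArg (fun v : TangentSpace (𝓡 n) ((extChartAt (𝓡 n) p).symm (η t)) => ‖v‖) h3).trans
            (norm_mfderivWithin_chart_symm p (hst (hηs t ht)) (z - y))
        refine h4.trans_le ?_
        rw [symmL_trivializationAt_comp]
        refine (ContinuousLinearMap.le_opNorm _ _).trans ?_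
        rw [← neg_sub y z, map_neg, norm_neg]
        exact mul_le_mul_of_nonneg_right (hsK _ (hηs t ht)) (norm_nonneg _)
    _ = ENNReal.ofReal (K * ‖T.symmL ℝ p (y - z)‖) := by simp

variable [IsContMDiffRiemannianBundle (𝓡 n) ∞ (𝔼 n) (fun x : M => TangentSpace (𝓡 n) x)]

/-- Every point has a neighbourhood on which functions that are Lipschitz for the Riemannian
distance are limits of smooth functions with uniformly bounded differential. -/
theorem exists_local_smooth_approx (p : M) : ∃ U : Set M, IsOpen U ∧ p ∈ U ∧
    IsCompact (closure U) ∧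
    ∀ ρ : M → ℝ, (∀ x y, ENNReal.ofReal |ρ x - ρ y| ≤ edist x y) → ∀ ε > 0,
      ∃ f : M → ℝ, ContMDiffOn (𝓡 n) 𝓘(ℝ, ℝ) ∞ f U ∧ (∀ x ∈ U, |f x - ρ x| ≤ ε) ∧
        ∀ x ∈ U, ∀ v : TangentSpace (𝓡 n) x, |mvfderiv (𝓡 n) f x v| ≤ 4 * ‖v‖ := by
  have := isContinuousRiemannianBundle_tangent (n := n) (M := M)
  have : LocallyCompactSpace M := ChartedSpace.locallyCompactSpace (𝔼 n) M
  set T := trivializationAt (𝔼 n) (fun x : M => TangentSpace (𝓡 n) x) p with hT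
  have hpT : p ∈ T.baseSet := FiberBundle.mem_baseSet_trivializationAt' p
  obtain ⟨C, hCc, hC⟩ := exists_compact_mem_nhds p
  have hev : ∀ᶠ x in 𝓝 p, x ∈ C ∧ ‖T.symmL ℝ p ∘L T.continuousLinearMapAt ℝ x‖ < 2 ∧
      ‖T.symmL ℝ x ∘L T.continuousLinearMapAt ℝ p‖ < 2 :=
    (Filter.eventually_mem_set.2 hC).and
      ((eventually_norm_symmL_trivializationAt_self_comp_lt (𝔼 n)
        (fun x : M => TangentSpace (𝓡 n) x) p one_lt_two).and
      (eventually_norm_symmL_trivializationAt_comp_self_lt (𝔼 n)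
        (fun x : M => TangentSpace (𝓡 n) x) p one_lt_two))
  set φ := extChartAt (𝓡 n) p with hφ
  have htgt : φ.target ∈ 𝓝 (φ p) := extChartAt_target_mem_nhds p
  have hev' : ∀ᶠ y in 𝓝 (φ p), y ∈ φ.target ∧ φ.symm y ∈ C ∧
      ‖T.symmL ℝ p ∘L T.continuousLinearMapAt ℝ (φ.symm y)‖ < 2 ∧
      ‖T.symmL ℝ (φ.symm y) ∘L T.continuousLinearMapAt ℝ p‖ < 2 := by
    refine (Filter.eventually_mem_set.2 htgt).and ?_
    have hc : ContinuousAt φ.symm (φ p) := continuousAt_extChartAt_symm p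
    have h1 : Filter.Tendsto φ.symm (𝓝 (φ p)) (𝓝 p) := by
      have := hc.tendsto
      rwa [extChartAt_to_inv] at this
    exact h1.eventually hev
  obtain ⟨r, hr, hball⟩ := Metric.eventually_nhds_iff_ball.1 hev'
  set U := φ.source ∩ φ ⁻¹' Metric.ball (φ p) r with hU
  have hUo : IsOpen U := (continuousOn_extChartAt p).isOpen_inter_preimage
    (isOpen_extChartAt_source p) Metric.isOpen_ball
  have hUC : U ⊆ C := by
    intro x hx
    have := (hball _ hx.2).2.1
    rwa [φ.left_inv hx.1] at this
  refine ⟨U, hUo, ⟨mem_extChartAt_source p, Metric.mem_ball_self hr⟩,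
    hCc.closure_of_subset hUC, fun ρ hρ ε hε => ?_⟩
  let L : 𝔼 n ≃L[ℝ] TangentSpace (𝓡 n) p := (T.continuousLinearEquivAt ℝ p hpT).symm
  have hL : ∀ w, L w = T.symmL ℝ p w := fun w => by
    rw [T.symmL_apply hpT]; rfl
  -- On this ball the metrics at nearby points and at `p` are comparable with factor `2`; in
  -- coordinates `ρ` is therefore `2`-Lipschitz for the norm at `p`.
  have hLip : ∀ y ∈ Metric.ball (φ p) r, ∀ z ∈ Metric.ball (φ p) r,
      |(ρ ∘ φ.symm) y - (ρ ∘ φ.symm) z| ≤ 2 * ‖L (y - z)‖ := by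
    intro y hy z hz
    have h1 := edist_chart_symm_le p (convex_ball (φ p) r)
      (fun y hy => (hball y hy).1) (fun y hy => (hball y hy).2.2.2.le) hy hz
    have h2 := (hρ _ _).trans h1
    rw [ENNReal.ofReal_le_ofReal_iff (by positivity)] at h2
    rw [hL]
    exact h2
  obtain ⟨g, hg, hgs⟩ := exists_lipschitz_extension L zero_le_two hLip
  obtain ⟨h, hh, hhg, hhd⟩ := exists_contDiff_approx (L : 𝔼 n →L[ℝ] TangentSpace (𝓡 n) p)
    zero_le_two hg hε
  have hsrc : ∀ x ∈ U, x ∈ (chartAt (𝔼 n) p).source := fun x hx => by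
    rw [← extChartAt_source (𝓡 n)]; exact hx.1
  refine ⟨h ∘ φ, ?_, fun x hx => ?_, fun x hx v => ?_⟩
  · exact hh.contMDiff.comp_contMDiffOn (contMDiffOn_extChartAt.mono hsrc)
  · have h1 := hhg (φ x)
    rw [← hgs hx.2, Function.comp_apply, φ.left_inv hx.1] at h1
    exact h1
  · rw [mvfderiv_comp_chart p (hsrc x hx) (hh.differentiable (by simp) _)]
    refine (hhd _ _).trans ?_
    -- Returning from the norm at `p` to the norm at `x` costs a second factor `2`, whence the
    -- constant `4`.
    have h1 : ‖L (T.continuousLinearMapAt ℝ x v)‖ ≤ 2 * ‖v‖ := by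
      have h2 := (hball _ hx.2).2.2.1.le
      rw [φ.left_inv hx.1] at h2
      rw [hL]
      exact (ContinuousLinearMap.le_opNorm _ v).trans (mul_le_mul_of_nonneg_right h2 (norm_nonneg _))
    change 2 * ‖L (T.continuousLinearMapAt ℝ x v)‖ ≤ _
    linarith

end LocalApprox

/-! ### Global smooth approximation and cutoff functions -/

section GlobalApprox

local notation "𝔼" n:max => EuclideanSpace ℝ (Fin n)

variable {n : ℕ} {M : Type*}

section Calculus

variable [TopologicalSpace M] [ChartedSpace (𝔼 n) M]

theorem mvfderiv_congr {W : Type*} [NormedAddCommGroup W] [NormedSpace ℝ W] {f g : M → W} {x : M}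
    (h : f =ᶠ[𝓝 x] g) : mvfderiv (𝓡 n) f x = mvfderiv (𝓡 n) g x := by
  ext v
  exact DFunLike.congr_fun h.mfderiv_eq v

theorem mdifferentiableAt_finsetSum {ι : Type*} (J : Finset ι) {f : ι → M → ℝ} {x : M}
    (hf : ∀ i ∈ J, MDifferentiableAt (𝓡 n) 𝓘(ℝ, ℝ) (f i) x) :
    MDifferentiableAt (𝓡 n) 𝓘(ℝ, ℝ) (fun y => ∑ i ∈ J, f i y) x := by
  classical
  induction J using Finset.induction_on with
  | empty => simpa using mdifferentiableAt_const
  | insert i J hi ih =>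
    simp only [Finset.sum_insert hi]
    exact (hf i (by simp)).add (ih fun j hj => hf j (by simp [hj]))

theorem mvfderiv_finsetSum {ι : Type*} (J : Finset ι) {f : ι → M → ℝ} {x : M}
    (hf : ∀ i ∈ J, MDifferentiableAt (𝓡 n) 𝓘(ℝ, ℝ) (f i) x) (v : TangentSpace (𝓡 n) x) :
    mvfderiv (𝓡 n) (fun y => ∑ i ∈ J, f i y) x v = ∑ i ∈ J, mvfderiv (𝓡 n) (f i) x v := by
  classical
  induction J using Finset.induction_on with
  | empty => simp [mvfderiv_const]
  | insert i J hi ih =>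
    simp only [Finset.sum_insert hi]
    rw [mvfderiv_fun_add (hf i (by simp))
      (mdifferentiableAt_finsetSum J fun j hj => hf j (by simp [hj])), add_apply,
      ih fun j hj => hf j (by simp [hj])]

end Calculus

variable [EMetricSpace M] [ChartedSpace (𝔼 n) M] [IsManifold (𝓡 n) ∞ M]
  [RiemannianBundle (fun x : M => TangentSpace (𝓡 n) x)]
  [IsContMDiffRiemannianBundle (𝓡 n) ∞ (𝔼 n) (fun x : M => TangentSpace (𝓡 n) x)]

/-- The differential of a smooth function is bounded on compact sets. -/
theorem exists_bound_mvfderiv {f : M → ℝ} (hf : ContMDiff (𝓡 n) 𝓘(ℝ, ℝ) ∞ f) {K : Set M}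
    (hK : IsCompact K) :
    ∃ C : ℝ, 0 ≤ C ∧ ∀ x ∈ K, ∀ v : TangentSpace (𝓡 n) x, |mvfderiv (𝓡 n) f x v| ≤ C * ‖v‖ := by
  have := isContinuousRiemannianBundle_tangent (n := n) (M := M)
  refine hK.induction_on (p := fun K => ∃ C : ℝ, 0 ≤ C ∧ ∀ x ∈ K, ∀ v : TangentSpace (𝓡 n) x,
    |mvfderiv (𝓡 n) f x v| ≤ C * ‖v‖) ?_ ?_ ?_ ?_
  · exact ⟨0, le_rfl, by simp⟩
  · rintro s t hst ⟨C, hC, h⟩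
    exact ⟨C, hC, fun x hx => h x (hst hx)⟩
  · rintro s t ⟨C, hC, h⟩ ⟨C', hC', h'⟩
    refine ⟨max C C', hC.trans (le_max_left _ _), ?_⟩
    rintro x (hx | hx) v
    · exact (h x hx v).trans (by gcongr; exact le_max_left _ _)
    · exact (h' x hx v).trans (by gcongr; exact le_max_right _ _)
  · intro p _
    obtain ⟨C, hC, hev⟩ := eventually_norm_trivializationAt_lt (𝔼 n)
      (fun x : M => TangentSpace (𝓡 n) x) p
    set φ := extChartAt (𝓡 n) p
    have hsm : ContDiffOn ℝ ∞ (f ∘ φ.symm) φ.target :=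
      contMDiffOn_iff_contDiffOn.1 (hf.comp_contMDiffOn (contMDiffOn_extChartAt_symm p))
    have hto : IsOpen φ.target := isOpen_extChartAt_target p
    have hd : ContinuousOn (fderiv ℝ (f ∘ φ.symm)) φ.target :=
      hsm.continuousOn_fderiv_of_isOpen hto (by simp)
    have hcont : ContinuousAt (fun x => ‖fderiv ℝ (f ∘ φ.symm) (φ x)‖) p :=
      ((hd.continuousAt (hto.mem_nhds (mem_extChartAt_target p))).comp
        (continuousAt_extChartAt p)).norm
    set B := ‖fderiv ℝ (f ∘ φ.symm) (φ p)‖ + 1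
    have hB : ∀ᶠ x in 𝓝 p, ‖fderiv ℝ (f ∘ φ.symm) (φ x)‖ < B :=
      hcont.eventually_lt continuousAt_const (by simp [B])
    refine ⟨_, mem_nhdsWithin_of_mem_nhds (hev.and (hB.and (chart_source_mem_nhds (𝔼 n) p))),
      B * C, by positivity, ?_⟩
    rintro x ⟨h1, h2, h3⟩ v
    have hx : x ∈ φ.source := by rwa [extChartAt_source]
    have h4 : f =ᶠ[𝓝 x] (f ∘ φ.symm) ∘ φ := by
      filter_upwards [(isOpen_extChartAt_source p).mem_nhds hx] with y hy
      simp [φ.left_inv hy]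
    have h5 : DifferentiableAt ℝ (f ∘ φ.symm) (φ x) :=
      (hsm.differentiableOn (by simp)).differentiableAt (hto.mem_nhds (φ.map_source hx))
    rw [mvfderiv_congr h4, mvfderiv_comp_chart p h3 h5, ← Real.norm_eq_abs]
    refine (ContinuousLinearMap.le_opNorm _ _).trans ?_
    rw [mul_assoc]
    refine mul_le_mul h2.le ?_ (norm_nonneg _) (by positivity)
    exact (ContinuousLinearMap.le_opNorm _ v).trans
      (mul_le_mul_of_nonneg_right h1.le (norm_nonneg _))

variable [IsRiemannianManifold (𝓡 n) M] [SecondCountableTopology M]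

/-- Functions which are Lipschitz for the Riemannian distance are uniform limits of smooth
functions with uniformly bounded differential. -/
theorem exists_smooth_approx {ρ : M → ℝ} (hρ : ∀ x y, ENNReal.ofReal |ρ x - ρ y| ≤ edist x y)
    {ε : ℝ} (hε : 0 < ε) :
    ∃ f : M → ℝ, ContMDiff (𝓡 n) 𝓘(ℝ, ℝ) ∞ f ∧ (∀ x, |f x - ρ x| ≤ ε) ∧
      ∀ (x : M) (v : TangentSpace (𝓡 n) x), |mvfderiv (𝓡 n) f x v| ≤ 5 * ‖v‖ := by
  rcases isEmpty_or_nonempty M with hM | hM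
  · exact ⟨0, fun x => isEmptyElim x, fun x => isEmptyElim x, fun x => isEmptyElim x⟩
  have : LocallyCompactSpace M := ChartedSpace.locallyCompactSpace (𝔼 n) M
  choose U hUo hpU hUc hU using exists_local_smooth_approx (n := n) (M := M)
  obtain ⟨s, hs, hsU⟩ := TopologicalSpace.countable_cover_nhds
    fun x : M => (hUo x).mem_nhds (hpU x)
  have hne : s.Nonempty := by
    by_contra h
    rw [not_nonempty_iff_eq_empty] at h
    simp only [h, mem_empty_iff_false, iUnion_of_empty, iUnion_empty] at hsU
    exact empty_ne_univ hsU
  obtain ⟨p, rfl⟩ := hs.exists_eq_range hne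
  obtain ⟨φ, hφ⟩ := SmoothPartitionOfUnity.exists_isSubordinate (𝓡 n) (s := (univ : Set M))
    isClosed_univ (fun k => U (p k)) (fun k => hUo _) (by rw [← hsU, biUnion_range])
  have hφc : ∀ k, IsCompact (tsupport (φ k)) := fun k =>
    (hUc (p k)).of_isClosed_subset (isClosed_tsupport _) ((hφ k).trans subset_closure)
  choose C hC0 hC using fun k => exists_bound_mvfderiv (φ k).contMDiff (hφc k)
  -- The error allowed to the `k`-th local approximation, multiplied by the bound `C k` on the
  -- differential of `φ k`, must be summable with total at most `1`.
  have hεk : ∀ k, 0 < min ε ((1 / 2) ^ (k + 1) / (C k + 1)) := fun k => by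
    have := hC0 k
    positivity
  choose f hfs hfρ hfd using fun k => hU (p k) ρ hρ _ (hεk k)
  have hfat : ∀ k, ∀ x ∈ tsupport (φ k), ContMDiffAt (𝓡 n) 𝓘(ℝ, ℝ) ∞ (f k) x := fun k x hx =>
    (hfs k).contMDiffAt ((hUo _).mem_nhds (hφ k hx))
  refine ⟨fun x => ∑ᶠ k, φ k x • f k x, φ.contMDiff_finsum_smul hfat, fun x => ?_, fun x v => ?_⟩
  · have h1 : ∑ᶠ k, φ k x • f k x ∈ Metric.closedBall (ρ x) ε := by
      refine φ.finsum_smul_mem_convex (mem_univ x) (fun k hk => ?_) (convex_closedBall _ _)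
      rw [Metric.mem_closedBall, Real.dist_eq]
      exact (hfρ k x (hφ k (subset_tsupport _ hk))).trans (min_le_left _ _)
    rwa [Metric.mem_closedBall, Real.dist_eq] at h1
  · set J := φ.fintsupport x
    have hmem : ∀ k ∈ J, x ∈ tsupport (φ k) := fun k hk => (φ.mem_fintsupport_iff x k).1 hk
    -- Because the `φ k` sum to `1`, the constant `ρ x` can be subtracted from every `f k`. In the
    -- product rule the differentials of the `φ k` are then multiplied by the small errors `f k x -
    -- ρ x`. The two resulting sums contribute `4` and `1` to the constant `5`.
    have hloc : (fun y => ∑ᶠ k, φ k y • f k y) =ᶠ[𝓝 x]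
        fun y => ρ x + ∑ k ∈ J, φ k y * (f k y - ρ x) := by
      filter_upwards [φ.eventually_finsupport_subset x] with y hy
      have h1 : ∑ k ∈ J, φ k y = 1 := φ.sum_finsupport' y (mem_univ y) hy
      have h2 : ∑ᶠ k, φ k y • f k y = ∑ k ∈ J, φ k y • f k y := by
        rw [← φ.sum_finsupport_smul_eq_finsum]
        refine Finset.sum_subset hy fun k _ hk => ?_
        have : φ k y = 0 := by simpa using hk
        simp [this]
      rw [h2]
      simp only [mul_sub, Finset.sum_sub_distrib, ← Finset.sum_mul, h1, smul_eq_mul]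
      ring
    have hdφ : ∀ k, MDifferentiableAt (𝓡 n) 𝓘(ℝ, ℝ) (φ k) x := fun k =>
      (φ k).contMDiff.mdifferentiableAt (by simp)
    have hdf : ∀ k ∈ J, MDifferentiableAt (𝓡 n) 𝓘(ℝ, ℝ) (fun y => f k y - ρ x) x := fun k hk =>
      ((hfat k x (hmem k hk)).mdifferentiableAt (by simp)).sub mdifferentiableAt_const
    have hdt : ∀ k ∈ J, MDifferentiableAt (𝓡 n) 𝓘(ℝ, ℝ) (fun y => φ k y * (f k y - ρ x)) x :=
      fun k hk => (hdφ k).mul (hdf k hk)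
    have hder : ∀ k ∈ J, mvfderiv (𝓡 n) (fun y => φ k y * (f k y - ρ x)) x v =
        φ k x * mvfderiv (𝓡 n) (f k) x v + (f k x - ρ x) * mvfderiv (𝓡 n) (φ k) x v := by
      intro k hk
      rw [mvfderiv_fun_mul (hdφ k) (hdf k hk),
        mvfderiv_fun_sub ((hfat k x (hmem k hk)).mdifferentiableAt (by simp))
          mdifferentiableAt_const, mvfderiv_const]
      simp
    rw [mvfderiv_congr hloc, mvfderiv_fun_add mdifferentiableAt_const
      (mdifferentiableAt_finsetSum J hdt), mvfderiv_const, zero_add, mvfderiv_finsetSum J hdt,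
      Finset.sum_congr rfl hder, Finset.sum_add_distrib]
    have hA : |∑ k ∈ J, φ k x * mvfderiv (𝓡 n) (f k) x v| ≤ 4 * ‖v‖ := by
      calc |∑ k ∈ J, φ k x * mvfderiv (𝓡 n) (f k) x v|
          ≤ ∑ k ∈ J, φ k x * (4 * ‖v‖) := by
            refine (Finset.abs_sum_le_sum_abs _ _).trans (Finset.sum_le_sum fun k hk => ?_)
            rw [abs_mul, abs_of_nonneg (φ.nonneg k x)]
            exact mul_le_mul_of_nonneg_left (hfd k x (hφ k (hmem k hk)) v) (φ.nonneg k x)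
        _ = 4 * ‖v‖ := by
            rw [← Finset.sum_mul, φ.sum_finsupport' x (mem_univ x)
              (φ.finsupport_subset_fintsupport x), one_mul]
    have hB : |∑ k ∈ J, (f k x - ρ x) * mvfderiv (𝓡 n) (φ k) x v| ≤ ‖v‖ := by
      calc |∑ k ∈ J, (f k x - ρ x) * mvfderiv (𝓡 n) (φ k) x v|
          ≤ ∑ k ∈ J, (1 / 2) ^ (k + 1) * ‖v‖ := by
            refine (Finset.abs_sum_le_sum_abs _ _).trans (Finset.sum_le_sum fun k hk => ?_)
            have h1 := (hfρ k x (hφ k (hmem k hk))).trans (min_le_right _ _)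
            have h2 := hC k x (hmem k hk) v
            have h3 := hC0 k
            rw [abs_mul]
            calc |f k x - ρ x| * |mvfderiv (𝓡 n) (φ k) x v|
                ≤ (1 / 2) ^ (k + 1) / (C k + 1) * ((C k + 1) * ‖v‖) := by
                  refine mul_le_mul h1 (h2.trans ?_) (abs_nonneg _) (by positivity)
                  gcongr
                  linarith
              _ = _ := by field_simp
        _ ≤ 1 * ‖v‖ := by
            rw [← Finset.sum_mul]
            refine mul_le_mul_of_nonneg_right ?_ (norm_nonneg _)
            have hsum : HasSum (fun k : ℕ => (1 / 2 : ℝ) ^ (k + 1)) 1 := by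
              have := hasSum_geometric_two.mul_right (1 / 2 : ℝ)
              simpa [pow_succ] using this
            exact sum_le_hasSum J (fun _ _ => by positivity) hsum
        _ = ‖v‖ := one_mul _
    calc _ ≤ 4 * ‖v‖ + ‖v‖ := (abs_add_le _ _).trans (add_le_add hA hB)
      _ = 5 * ‖v‖ := by ring

/-- On a complete Riemannian manifold there are smooth compactly supported cutoff functions with
uniformly bounded differentials, which near every point are eventually equal to `1`. -/
theorem exists_cutoff [CompleteSpace M] : ∃ C : ℝ, 0 ≤ C ∧ ∃ χ : ℕ → M → ℝ,
    (∀ k, ContMDiff (𝓡 n) 𝓘(ℝ, ℝ) ∞ (χ k)) ∧ (∀ k, HasCompactSupport (χ k)) ∧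
    (∀ k x, χ k x ∈ Icc (0 : ℝ) 1) ∧
    (∀ k x (v : TangentSpace (𝓡 n) x), |mvfderiv (𝓡 n) (χ k) x v| ≤ C * ‖v‖) ∧
    ∀ x, ∀ᶠ k in Filter.atTop, χ k =ᶠ[𝓝 x] 1 := by
  rcases isEmpty_or_nonempty M with hM | hM
  · exact ⟨0, le_rfl, fun _ => 0, fun k x => isEmptyElim x,
      fun k => HasCompactSupport.intro isCompact_empty fun x => isEmptyElim x,
      fun k x => isEmptyElim x, fun k x => isEmptyElim x, fun x => isEmptyElim x⟩
  let a : ℕ → M := TopologicalSpace.denseSeq M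
  -- The distance to a single point would be infinite on the other components; a growing finite part
  -- of a dense sequence eventually comes close to every point. The truncation at `k + 2` below
  -- makes the function real valued and keeps it `1`-Lipschitz.
  let d : ℕ → M → ℝ≥0∞ := fun k x => Metric.infEDist x (a '' Iic k)
  let ρ : ℕ → M → ℝ := fun k x => (min (d k x) (k + 2 : ℕ)).toReal
  have hfin : ∀ k x, min (d k x) ((k + 2 : ℕ) : ℝ≥0∞) ≠ ⊤ := fun k x =>
    ((min_le_right _ _).trans_lt (ENNReal.natCast_lt_top _)).ne
  have hρ : ∀ k x y, ENNReal.ofReal |ρ k x - ρ k y| ≤ edist x y := by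
    have h1 : ∀ k x y, ENNReal.ofReal (ρ k x - ρ k y) ≤ edist x y := by
      intro k x y
      rw [ENNReal.ofReal_sub _ ENNReal.toReal_nonneg, ENNReal.ofReal_toReal (hfin k x),
        ENNReal.ofReal_toReal (hfin k y), tsub_le_iff_left]
      rw [← min_add_add_right]
      refine le_min ((min_le_left _ _).trans Metric.infEDist_le_infEDist_add_edist)
        ((min_le_right _ _).trans le_self_add)
    intro k x y
    rcases abs_cases (ρ k x - ρ k y) with ⟨h, _⟩ | ⟨h, _⟩
    · rw [h]; exact h1 k x y
    · rw [h, neg_sub, edist_comm]; exact h1 k y x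
  choose f hfs hfρ hfd using fun k =>
    exists_smooth_approx (n := n) (hρ k) (show (0 : ℝ) < 1 / 4 by norm_num)
  -- The profile is `1` for `t ≤ 1/2` and `0` for `t ≥ 3/2`. With approximation error `1/4`, the
  -- function `θ (f k - k)` is `1` where `ρ k ≤ k` and `0` where `ρ k = k + 2`.
  let θ : ℝ → ℝ := fun t => Real.smoothTransition (3 / 2 - t)
  have hθs : ContDiff ℝ ∞ θ := Real.smoothTransition.contDiff.comp (contDiff_const.sub contDiff_id)
  obtain ⟨B, hB0, hB⟩ : ∃ B : ℝ, 0 ≤ B ∧ ∀ t, ‖deriv θ t‖ ≤ B := by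
    have h1 : HasCompactSupport (deriv θ) := by
      refine HasCompactSupport.intro (isCompact_Icc (a := (1 / 2 : ℝ)) (b := 3 / 2)) fun t ht => ?_
      rcases not_and_or.1 ht with h | h
      · have h2 : θ =ᶠ[𝓝 t] fun _ => 1 := by
          filter_upwards [Iio_mem_nhds (not_le.1 h)] with s hs
          refine Real.smoothTransition.one_of_one_le ?_
          linarith [mem_Iio.1 hs]
        rw [h2.deriv_eq, deriv_const]
      · have h2 : θ =ᶠ[𝓝 t] fun _ => 0 := by
          filter_upwards [Ioi_mem_nhds (not_le.1 h)] with s hs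
          refine Real.smoothTransition.zero_of_nonpos ?_
          linarith [mem_Ioi.1 hs]
        rw [h2.deriv_eq, deriv_const]
    obtain ⟨B, hB⟩ := (hθs.continuous_deriv (by simp)).bounded_above_of_compact_support h1
    exact ⟨B, (norm_nonneg _).trans (hB 0), hB⟩
  refine ⟨B * 5, by positivity, fun k x => θ (f k x - k), fun k => ?_, fun k => ?_, fun k x => ?_,
    fun k x v => ?_, fun x => ?_⟩
  · exact hθs.contMDiff.comp ((hfs k).sub contMDiff_const)
  -- Hopf-Rinow is used here: outside these finitely many compact balls the truncated distance is `k
  -- + 2` and the cutoff vanishes.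
  · have hKc : IsCompact (⋃ i ∈ Iic k, Metric.closedEBall (a i) ((k + 2 : ℕ) : ℝ≥0∞)) :=
      (finite_Iic k).isCompact_biUnion fun i _ =>
        isCompact_closedEBall n (a i) (ENNReal.natCast_ne_top _)
    refine HasCompactSupport.intro hKc fun x hx => ?_
    have h1 : ((k + 2 : ℕ) : ℝ≥0∞) ≤ d k x := by
      refine Metric.le_infEDist.2 ?_
      rintro _ ⟨i, hi, rfl⟩
      by_contra hcon
      exact hx (mem_iUnion₂.2 ⟨i, hi, (not_le.1 hcon).le⟩)
    have h2 : ρ k x = k + 2 := by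
      simp only [ρ, min_eq_right h1, ENNReal.toReal_natCast]
      push_cast
      ring
    have h3 := abs_le.1 (hfρ k x)
    refine Real.smoothTransition.zero_of_nonpos ?_
    linarith
  · exact ⟨Real.smoothTransition.nonneg _, Real.smoothTransition.le_one _⟩
  · have h1 : MDifferentiableAt (𝓡 n) 𝓘(ℝ, ℝ) (fun x => f k x - (k : ℝ)) x :=
      ((hfs k).mdifferentiableAt (by simp)).sub mdifferentiableAt_const
    have h2 : mvfderiv (𝓡 n) (θ ∘ fun x => f k x - (k : ℝ)) x v =
        mvfderiv (𝓡 n) (f k) x v * deriv θ (f k x - k) := by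
      rw [mvfderiv_comp_apply x (hθs.differentiable (by simp) _).mdifferentiableAt h1]
      have h3 := mvfderiv_fun_sub ((hfs k).mdifferentiableAt (by simp) (x := x))
        (mdifferentiableAt_const (c := (k : ℝ)))
      rw [mvfderiv_const, sub_zero] at h3
      rw [← h3, ← smul_eq_mul, ← fderiv_eq_smul_deriv]
      simp only [mvfderiv, mfderiv_eq_fderiv]
      rfl
    change |mvfderiv (𝓡 n) (θ ∘ fun x => f k x - (k : ℝ)) x v| ≤ _
    rw [h2, abs_mul, mul_comm, mul_assoc]
    exact mul_le_mul (hB _) (hfd k x v) (abs_nonneg _) hB0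
  · obtain ⟨i, hyx⟩ := (TopologicalSpace.denseRange_denseSeq M).exists_mem_open
      (Metric.isOpen_eball (x := x) (ε := 1)) ⟨x, Metric.mem_eball_self one_pos⟩
    -- For `k ≥ i` the point `a i`, at distance less than `1` from `x`, is among the centres, so the
    -- unit ball about `x` lies within distance `2 ≤ k` of them.
    filter_upwards [Filter.eventually_ge_atTop (max i 2)] with k hk
    filter_upwards [Metric.eball_mem_nhds x one_pos] with y hy
    have h1 : d k y ≤ (k : ℕ) := by
      calc d k y ≤ edist y (a i) :=
            Metric.infEDist_le_edist_of_mem ⟨i, (le_max_left _ _).trans hk, rfl⟩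
        _ ≤ edist y x + edist x (a i) := edist_triangle _ _ _
        _ ≤ 1 + 1 := add_le_add (Metric.mem_eball.1 hy).le
            (by rw [edist_comm]; exact (Metric.mem_eball.1 hyx).le)
        _ = ((2 : ℕ) : ℝ≥0∞) := by norm_num
        _ ≤ (k : ℕ) := by exact_mod_cast (le_max_right _ _).trans hk
    have h2 : ρ k y ≤ k := by
      have := ENNReal.toReal_mono (ENNReal.natCast_ne_top k)
        ((min_le_left (d k y) ((k + 2 : ℕ) : ℝ≥0∞)).trans h1)
      rwa [ENNReal.toReal_natCast] at this
    have h3 := abs_le.1 (hfρ k y)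
    refine Real.smoothTransition.one_of_one_le ?_
    linarith

end GlobalApprox

/-! ### Dominated convergence for square integrable sections -/

namespace MeasurableField

variable {M : Type*} [MeasurableSpace M] {μ : Measure M}
  {W : M → Type*} [∀ x, NormedAddCommGroup (W x)] [∀ x, InnerProductSpace ℂ (W x)]
  (𝓕 : MeasurableField μ W)

theorem norm_sq_toL2 (u : 𝓕.sqIntegrable) : ‖𝓕.toL2 u‖ ^ 2 = ∫ x, ‖u.1 x‖ ^ 2 ∂μ :=
  𝓕.norm_sq_preL2 u

theorem toL2_surjective : Function.Surjective 𝓕.toL2 := fun v => by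
  obtain ⟨u, rfl⟩ := SeparationQuotient.surjective_mk v
  exact ⟨u, rfl⟩

/-- Dominated convergence for a sequence of sections which vanishes eventually at every point. -/
theorem tendsto_norm_toL2_zero (f : ℕ → 𝓕.sqIntegrable) {g : M → ℝ} (hg : Integrable g μ)
    (hfg : ∀ k x, ‖(f k).1 x‖ ^ 2 ≤ g x) (hf : ∀ x, ∀ᶠ k in Filter.atTop, (f k).1 x = 0) :
    Filter.Tendsto (fun k => ‖𝓕.toL2 (f k)‖) Filter.atTop (𝓝 0) := by
  have h1 : Filter.Tendsto (fun k => ∫ x, ‖(f k).1 x‖ ^ 2 ∂μ) Filter.atTop (𝓝 (∫ _, (0 : ℝ) ∂μ)) := by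
    refine tendsto_integral_of_dominated_convergence g
      (fun k => (𝓕.integrable_norm_sq (f k)).aestronglyMeasurable) hg
      (fun k => Filter.Eventually.of_forall fun x => ?_) (Filter.Eventually.of_forall fun x => ?_)
    · rw [Real.norm_of_nonneg (by positivity)]
      exact hfg k x
    · refine tendsto_const_nhds.congr' ?_
      filter_upwards [hf x] with k hk
      simp [hk]
  rw [integral_zero] at h1
  have h2 := (Real.continuous_sqrt.tendsto 0).comp h1
  rw [Real.sqrt_zero] at h2
  refine h2.congr fun k => ?_
  rw [Function.comp_apply, ← 𝓕.norm_sq_toL2, Real.sqrt_sq (norm_nonneg _)]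

end MeasurableField

/-! ### Density of compactly supported sections in the Sobolev norm -/

section Density

local notation "𝔼" n:max => EuclideanSpace ℝ (Fin n)

variable {n : ℕ} {M : Type*}

section Smul

variable [TopologicalSpace M] [ChartedSpace (𝔼 n) M] [IsManifold (𝓡 n) ∞ M]
  {F : Type*} [NormedAddCommGroup F] [NormedSpace ℂ F]
  {V : M → Type*} [TopologicalSpace (TotalSpace F V)] [∀ x, NormedAddCommGroup (V x)]
  [∀ x, InnerProductSpace ℂ (V x)] [FiberBundle F V] [VectorBundle ℝ F V] [VectorBundle ℂ F V]

theorem smul_mem_smoothSections {χ : M → ℝ} (hχ : ContMDiff (𝓡 n) 𝓘(ℝ, ℝ) ∞ χ) {u : Π x, V x}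
    (hu : u ∈ smoothSections n F V) : (χ • u : Π x, V x) ∈ smoothSections n F V :=
  ContMDiff.smul_section hχ hu

theorem smul_mem_compactlySupportedSections [T2Space M] {χ : M → ℝ}
    (hχ : ContMDiff (𝓡 n) 𝓘(ℝ, ℝ) ∞ χ) (hc : HasCompactSupport χ) {u : Π x, V x}
    (hu : u ∈ smoothSections n F V) :
    (χ • u : Π x, V x) ∈ compactlySupportedSections n F V := by
  refine ⟨smul_mem_smoothSections hχ hu, hc.of_isClosed_subset isClosed_closure ?_⟩
  refine closure_mono fun x hx h => hx ?_
  simp only [Pi.smul_apply', h, zero_smul]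

theorem SmoothConnection.nabla_smul_apply (D : SmoothConnection n F V) {χ : M → ℝ} {u : Π x, V x}
    (hχ : ContMDiff (𝓡 n) 𝓘(ℝ, ℝ) ∞ χ) (hu : u ∈ smoothSections n F V) (x : M) :
    D.toFun (χ • u) x = χ x • D.toFun u x + (mvfderiv (𝓡 n) χ x).smulRight (u x) :=
  D.isCovariantDerivativeOnUniv.leibniz (hu.mdifferentiableAt (by simp))
    (hχ.mdifferentiableAt (by simp))

end Smul

variable [EMetricSpace M] [SecondCountableTopology M] [MeasurableSpace M] [BorelSpace M]
  [ChartedSpace (𝔼 n) M] [IsManifold (𝓡 n) ∞ M]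
  [RiemannianBundle (fun x : M => TangentSpace (𝓡 n) x)]
  [IsContMDiffRiemannianBundle (𝓡 n) ∞ (𝔼 n) (fun x : M => TangentSpace (𝓡 n) x)]
  [IsRiemannianManifold (𝓡 n) M] [CompleteSpace M]
  {F : Type*} [NormedAddCommGroup F] [NormedSpace ℂ F] [FiniteDimensional ℂ F]
  {V : M → Type*} [TopologicalSpace (TotalSpace F V)] [∀ x, NormedAddCommGroup (V x)]
  [∀ x, InnerProductSpace ℂ (V x)] [FiberBundle F V] [VectorBundle ℝ F V] [VectorBundle ℂ F V]
  [ContMDiffVectorBundle ∞ F V (𝓡 n)] [IsSmoothHermitianBundle F V n]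

/-- The Hilbert-Schmidt norm sums over `n` orthonormal vectors, on each of which `|ℓ|` is at most
`C`. Applied to `ℓ = dχ_k`, this bounds `dχ_k ⊗ u` uniformly in `k`. -/
theorem CotangentTensor.norm_sq_smulRight_le {x : M} (ℓ : TangentSpace (𝓡 n) x →L[ℝ] ℝ) {C : ℝ}
    (hC : ∀ v, |ℓ v| ≤ C * ‖v‖) (w : V x) :
    ‖(show CotangentTensor V n x from ℓ.smulRight w)‖ ^ 2 ≤ n * C ^ 2 * ‖w‖ ^ 2 := by
  rw [CotangentTensor.norm_sq_eq]
  set e := stdOrthonormalBasis ℝ (TangentSpace (𝓡 n) x)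
  have h1 : ∀ i, ‖CotangentTensor.toHom V n (show CotangentTensor V n x from ℓ.smulRight w) (e i)‖ ^ 2
      ≤ C ^ 2 * ‖w‖ ^ 2 := by
    intro i
    have h2 : CotangentTensor.toHom V n (show CotangentTensor V n x from ℓ.smulRight w) (e i) =
      ℓ (e i) • w := rfl
    have h3 := hC (e i)
    rw [e.norm_eq_one, mul_one] at h3
    rw [h2, norm_smul, mul_pow, Real.norm_eq_abs]
    gcongr
  have hfr : Module.finrank ℝ (TangentSpace (𝓡 n) x) = n :=
    (finrank_euclideanSpace_fin (𝕜 := ℝ) (n := n))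
  calc _ ≤ ∑ _i : Fin (Module.finrank ℝ (TangentSpace (𝓡 n) x)), C ^ 2 * ‖w‖ ^ 2 :=
        Finset.sum_le_sum fun i _ => h1 i
    _ = n * C ^ 2 * ‖w‖ ^ 2 := by
        rw [Finset.sum_const, Finset.card_univ, Fintype.card_fin, hfr, nsmul_eq_mul, mul_assoc]

/-- On a complete manifold the compactly supported smooth sections are dense for the Sobolev
norm. -/
theorem SmoothConnection.denseRange_inclusion (D : SmoothConnection n F V) :
    DenseRange (X := D.PreSobolev D.S1 le_rfl) (fun u : D.PreSobolev (compactlySupportedSections n F V)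
      D.compactlySupportedSections_le_S1 =>
      (Submodule.inclusion D.compactlySupportedSections_le_S1 u : D.PreSobolev D.S1 le_rfl)) := by
  obtain ⟨C, hC0, χ, hχs, hχc, hχ01, hχd, hχ1⟩ := exists_cutoff (n := n) (M := M)
  intro u
  obtain ⟨u, hu⟩ := u
  let w : ℕ → D.S1 := fun k => ⟨χ k • u, D.compactlySupportedSections_le_S1
    (smul_mem_compactlySupportedSections (hχs k) (hχc k) hu.1)⟩
  let u' : D.S1 := ⟨u, hu⟩
  have hval : ∀ k x, ((w k - u' : D.S1) : Π x, V x) x = (χ k x - 1) • u x := fun k x => by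
    rw [sub_smul, one_smul]; rfl
  have habs : ∀ k x, (χ k x - 1) ^ 2 ≤ 1 := fun k x => by
    have := hχ01 k x
    nlinarith [this.1, this.2]
  have h1 : Filter.Tendsto (fun k => ‖D.toL2 (w k - u')‖) Filter.atTop (𝓝 0) := by
    refine (sectionField n F V).tendsto_norm_toL2_zero
      (fun k => ⟨(w k - u').1, (w k - u').2.2.1⟩)
      ((sectionField n F V).integrable_norm_sq ⟨u, hu.2.1⟩) (fun k x => ?_) fun x => ?_
    · change ‖((w k - u' : D.S1) : Π x, V x) x‖ ^ 2 ≤ ‖u x‖ ^ 2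
      rw [hval, norm_smul, mul_pow, Real.norm_eq_abs, sq_abs]
      exact mul_le_of_le_one_left (by positivity) (habs k x)
    · filter_upwards [hχ1 x] with k hk
      rw [hval, hk.self_of_nhds]
      simp
  -- The Leibniz rule. The first term is controlled by `∇u` since `0 ≤ χ k ≤ 1`, the second by `u`
  -- since the differentials of the cutoffs are uniformly bounded.
  have hgrad : ∀ k x, D.nabla (w k - u' : D.S1).1 x = (χ k x - 1) • D.toFun u x +
      (mvfderiv (𝓡 n) (χ k) x).smulRight (u x) := by
    intro k x
    have h2 : (w k - u' : D.S1).1 = χ k • u + (-1 : ℂ) • u := by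
      rw [neg_one_smul, ← sub_eq_add_neg]
      rfl
    rw [h2, D.nabla_add (smul_mem_smoothSections (hχs k) hu.1)
      (Submodule.smul_mem _ _ hu.1), D.nabla_smul _ hu.1]
    change D.toFun (χ k • u) x + (-1 : ℂ) • D.toFun u x = _
    rw [D.nabla_smul_apply (hχs k) hu.1, sub_smul, one_smul, neg_one_smul]
    abel
  have h2 : Filter.Tendsto (fun k => ‖D.gradL2 (w k - u')‖) Filter.atTop (𝓝 0) := by
    have hg1 : Integrable (fun x => ‖D.nabla u x‖ ^ 2) (riemannianVolume n) :=
      (cotangentField n F V).integrable_norm_sq ⟨D.nabla u, hu.2.2⟩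
    have hg2 : Integrable (fun x => ‖u x‖ ^ 2) (riemannianVolume n) :=
      (sectionField n F V).integrable_norm_sq ⟨u, hu.2.1⟩
    have hg : Integrable (fun x => 2 * ‖D.nabla u x‖ ^ 2 + 2 * (n * C ^ 2 * ‖u x‖ ^ 2))
        (riemannianVolume n) := (hg1.const_mul 2).add ((hg2.const_mul _).const_mul 2)
    refine (cotangentField n F V).tendsto_norm_toL2_zero
      (fun k => ⟨D.nabla (w k - u').1, (w k - u').2.2.2⟩) hg (fun k x => ?_) fun x => ?_
    · change ‖D.nabla (w k - u').1 x‖ ^ 2 ≤ _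
      rw [hgrad]
      have h3 := CotangentTensor.norm_sq_smulRight_le (V := V) (mvfderiv (𝓡 n) (χ k) x)
        (hχd k x) (u x)
      set A : CotangentTensor V n x := (mvfderiv (𝓡 n) (χ k) x).smulRight (u x)
      have h4 : ‖(show CotangentTensor V n x from (χ k x - 1) • D.toFun u x)‖ ^ 2 ≤
          ‖D.nabla u x‖ ^ 2 := by
        have h5 : (show CotangentTensor V n x from (χ k x - 1) • D.toFun u x) =
            ((χ k x - 1 : ℝ) : ℂ) • D.nabla u x := by
          refine ContinuousLinearMap.ext fun v => ?_
          exact (Complex.coe_smul (χ k x - 1) (D.toFun u x v)).symm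
        rw [h5, norm_smul, mul_pow, Complex.norm_real, Real.norm_eq_abs, sq_abs]
        exact mul_le_of_le_one_left (by positivity) (habs k x)
      set B : CotangentTensor V n x := (χ k x - 1) • D.toFun u x
      change ‖B + A‖ ^ 2 ≤ _
      have h6 := norm_add_le B A
      have h7 : ‖B + A‖ ^ 2 ≤ (‖B‖ + ‖A‖) ^ 2 := by gcongr
      nlinarith [sq_nonneg (‖B‖ - ‖A‖)]
    -- The cutoff equals `1` on a neighbourhood of `x`, not only at `x`, so its differential at `x`
    -- vanishes too.
    · filter_upwards [hχ1 x] with k hk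
      change D.nabla (w k - u').1 x = 0
      rw [hgrad, hk.self_of_nhds, mvfderiv_congr hk]
      have h3 : mvfderiv (𝓡 n) (1 : M → ℝ) x = 0 := mvfderiv_const _
      rw [h3]
      simp
      rfl
  have h3 := h1.add h2
  rw [add_zero] at h3
  have h4 : Filter.Tendsto (fun k => (show D.PreSobolev D.S1 le_rfl from w k)) Filter.atTop
      (𝓝 (show D.PreSobolev D.S1 le_rfl from u')) :=
    tendsto_iff_norm_sub_tendsto_zero.2 h3
  exact mem_closure_of_tendsto h4 (Filter.Eventually.of_forall fun k =>
    ⟨⟨χ k • u, smul_mem_compactlySupportedSections (hχs k) (hχc k) hu.1⟩, rfl⟩)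

end Density

/-! ### Test sections that detect a vector of the fibre -/

section TestSections

local notation "𝔼" n:max => EuclideanSpace ℝ (Fin n)

variable {n : ℕ} {M : Type*} [TopologicalSpace M] [T2Space M] [ChartedSpace (𝔼 n) M]
  [IsManifold (𝓡 n) ∞ M]
  {F : Type*} [NormedAddCommGroup F] [NormedSpace ℂ F] [FiniteDimensional ℂ F]
  {V : M → Type*} [TopologicalSpace (TotalSpace F V)] [∀ x, NormedAddCommGroup (V x)]
  [∀ x, InnerProductSpace ℂ (V x)] [FiberBundle F V] [VectorBundle ℝ F V] [VectorBundle ℂ F V]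
  [ContMDiffVectorBundle ∞ F V (𝓡 n)]

/-- A local frame multiplied by a bump function equal to `1` near `p`: there the sections span the
fibre, so only the zero vector is orthogonal to all of them. The frame is a real one, which is
enough for spanning. -/
theorem exists_testSections (p : M) {U : Set M} (hU : U ∈ 𝓝 p) :
    ∃ s : Fin (Module.finrank ℝ F) → Π x, V x, (∀ j, s j ∈ compactlySupportedSections n F V) ∧
      (∀ j, closure {x | s j x ≠ 0} ⊆ U) ∧
      ∀ᶠ x in 𝓝 p, ∀ w : V x, (∀ j, inner ℂ (s j x) w = 0) → w = 0 := by
  have : FiniteDimensional ℝ F := FiniteDimensional.trans ℝ ℂ F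
  set e := trivializationAt F V p
  have he : e.baseSet ∈ 𝓝 p := e.open_baseSet.mem_nhds (FiberBundle.mem_baseSet_trivializationAt' p)
  obtain ⟨θ, -, hθ⟩ := (SmoothBumpFunction.nhds_basis_tsupport (I := 𝓡 n) p).mem_iff.1
    (Filter.inter_mem hU he)
  let b := Module.finBasis ℝ F
  have hsub : ∀ j, closure {x | ((θ : M → ℝ) • e.localFrame b j) x ≠ 0} ⊆ tsupport θ := fun j =>
    closure_mono fun x hx h => hx (by simp [h])
  refine ⟨fun j => (θ : M → ℝ) • e.localFrame b j, fun j => ⟨?_, ?_⟩,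
    fun j => (hsub j).trans (hθ.trans inter_subset_left), ?_⟩
  · exact ContMDiffOn.smul_section_of_tsupport θ.contMDiff.contMDiffOn e.open_baseSet
      (hθ.trans inter_subset_right) (e.contMDiffOn_localFrame_baseSet (n := ∞) (I := 𝓡 n) b j)
  · exact θ.hasCompactSupport.of_isClosed_subset isClosed_closure (hsub j)
  · filter_upwards [θ.eventuallyEq_one, he] with x hx hxe w hw
    have h1 : ∀ j, inner ℂ (e.basisAt b hxe j) w = 0 := by
      intro j
      have := hw j
      rwa [Pi.smul_apply', hx, Pi.one_apply, one_smul, e.localFrame_apply_of_mem_baseSet b hxe]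
        at this
    have h2 : inner ℂ (∑ j, (e.basisAt b hxe).repr w j • e.basisAt b hxe j) w = 0 := by
      rw [sum_inner]
      refine Finset.sum_eq_zero fun j _ => ?_
      rw [← Complex.coe_smul, inner_smul_left, h1, mul_zero]
    rwa [(e.basisAt b hxe).sum_repr, inner_self_eq_zero] at h2

end TestSections
-- Divergence-free coordinate fields
section Divergence

local notation "𝔼" n:max => EuclideanSpace ℝ (Fin n)

/-- Integration by parts against the constant function `1`. -/
theorem integral_fderiv_eq_zero {n : ℕ} {w : 𝔼 n → ℂ} (hw : ContDiff ℝ 1 w) (hc : HasCompactSupport w) (v : 𝔼 n) :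
    ∫ y, fderiv ℝ w y v = 0 := by
  have h1 : Continuous (fun y => fderiv ℝ w y v) :=
    (hw.continuous_fderiv one_ne_zero).clm_apply continuous_const
  have h2 : HasCompactSupport (fun y => fderiv ℝ w y v) := hc.fderiv_apply ℝ v
  have h := integral_mul_fderiv_eq_neg_fderiv_mul_of_integrable (𝕜 := ℂ) (μ := volume)
    (f := fun _ : 𝔼 n => (1 : ℂ)) (g := w) (v := v) (by simp)
    (by simpa using h1.integrable_of_hasCompactSupport h2)
    (by simpa using hw.continuous.integrable_of_hasCompactSupport hc)
    (fun x _ => differentiableAt_const _)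
    (fun x _ => (hw.differentiable one_ne_zero).differentiableAt)
  simpa using h

variable {n : ℕ} {M : Type*} [TopologicalSpace M] [ChartedSpace (𝔼 n) M] [IsManifold (𝓡 n) ∞ M]

/-- The local expression of a function on `M` in the chart at `p`, extended by zero. -/
def chartExtension (p : M) (f : M → ℂ) : 𝔼 n → ℂ :=
  (chartAt (𝔼 n) p).target.indicator fun y => f ((chartAt (𝔼 n) p).symm y)

theorem chartExtension_apply (p : M) (f : M → ℂ) {x : M} (hx : x ∈ (chartAt (𝔼 n) p).source) :
    chartExtension p f (chartAt (𝔼 n) p x) = f x := by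
  rw [chartExtension, indicator_of_mem ((chartAt (𝔼 n) p).map_source hx),
    (chartAt (𝔼 n) p).left_inv hx]

section
variable {p : M} {f : M → ℂ} (hf : ContMDiff (𝓡 n) 𝓘(ℝ, ℂ) ∞ f) {K : Set M} (hK : IsCompact K)
  (hKs : K ⊆ (chartAt (𝔼 n) p).source) (h0 : ∀ x ∉ K, f x = 0)
include hK hKs h0

theorem chartExtension_eq_zero {y : 𝔼 n} (hy : y ∉ chartAt (𝔼 n) p '' K) :
    chartExtension p f y = 0 := by
  by_cases hyt : y ∈ (chartAt (𝔼 n) p).target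
  · rw [chartExtension, indicator_of_mem hyt]
    exact h0 _ fun h => hy ⟨_, h, (chartAt (𝔼 n) p).right_inv hyt⟩
  · exact indicator_of_notMem hyt _

theorem isCompact_chart_image : IsCompact (chartAt (𝔼 n) p '' K) :=
  hK.image_of_continuousOn ((chartAt (𝔼 n) p).continuousOn.mono hKs)

theorem hasCompactSupport_chartExtension : HasCompactSupport (chartExtension (n := n) p f) :=
  HasCompactSupport.intro (isCompact_chart_image hK hKs h0)
    fun _ hy => chartExtension_eq_zero hK hKs h0 hy

include hf in
-- The extension by zero is smooth across the boundary of the chart's target: the image of `K` is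
-- compact, hence closed, and the function vanishes off it.
theorem contDiff_chartExtension : ContDiff ℝ 1 (chartExtension (n := n) p f) := by
  rw [contDiff_iff_contDiffAt]
  intro y
  by_cases hy : y ∈ (chartAt (𝔼 n) p).target
  · have h1 : ContMDiffAt (𝓡 n) (𝓡 n) 1 (chartAt (𝔼 n) p).symm y :=
      (contMDiffOn_symm_of_mem_maximalAtlas
        (IsManifold.chart_mem_maximalAtlas (I := 𝓡 n) (n := 1) p)).contMDiffAt
        ((chartAt (𝔼 n) p).open_target.mem_nhds hy)
    have h2 : ContMDiffAt (𝓡 n) 𝓘(ℝ, ℂ) 1 (fun y => f ((chartAt (𝔼 n) p).symm y)) y :=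
      ((hf.of_le (by norm_cast)).contMDiffAt).comp y h1
    refine h2.contDiffAt.congr_of_eventuallyEq ?_
    filter_upwards [(chartAt (𝔼 n) p).open_target.mem_nhds hy] with z hz
    exact indicator_of_mem hz _
  · have h1 : y ∉ chartAt (𝔼 n) p '' K := by
      rintro ⟨x, hx, rfl⟩
      exact hy ((chartAt (𝔼 n) p).map_source (hKs hx))
    refine (contDiffAt_const (c := (0 : ℂ))).congr_of_eventuallyEq ?_
    filter_upwards [(isCompact_chart_image hK hKs h0).isClosed.isOpen_compl.mem_nhds h1] with z hz
    exact chartExtension_eq_zero hK hKs h0 hz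

include hf in
theorem mvfderiv_eq_fderiv_chartExtension {x : M} (hx : x ∈ (chartAt (𝔼 n) p).source) (v : 𝔼 n) :
    mvfderiv (𝓡 n) f x
      ((trivializationAt (𝔼 n) (fun x : M => TangentSpace (𝓡 n) x) p).symmL ℝ x v) =
      fderiv ℝ (chartExtension p f) (chartAt (𝔼 n) p x) v := by
  have hd := (contDiff_chartExtension hf hK hKs h0).differentiable one_ne_zero
  have h1 : f =ᶠ[𝓝 x] chartExtension p f ∘ extChartAt (𝓡 n) p := by
    filter_upwards [(chartAt (𝔼 n) p).open_source.mem_nhds hx] with z hz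
    exact (chartExtension_apply p f hz).symm
  have hxb : x ∈ (trivializationAt (𝔼 n) (fun x : M => TangentSpace (𝓡 n) x) p).baseSet := hx
  rw [mvfderiv_congr h1, mvfderiv_comp_chart p hx (hd _),
    Trivialization.continuousLinearMapAt_symmL _ hxb]
  rfl

end

variable [RiemannianBundle (fun x : M => TangentSpace (𝓡 n) x)]
  [IsContMDiffRiemannianBundle (𝓡 n) ∞ (𝔼 n) (fun x : M => TangentSpace (𝓡 n) x)]
  [MeasurableSpace M] [BorelSpace M] [SecondCountableTopology M]

theorem riemannianVolume_restrict_source (p : M) :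
    (riemannianVolume n : Measure M).restrict (chartAt (𝔼 n) p).source =
      chartMeasure n (chartAt (𝔼 n) p) := by
  have hs := (chartAt (𝔼 n) p).open_source.measurableSet
  ext A hA
  rw [Measure.restrict_apply hA, riemannianVolume_apply p (hA.inter hs) inter_subset_right]
  refine le_antisymm (measure_mono inter_subset_left) ?_
  refine (measure_le_inter_add_sdiff _ A (chartAt (𝔼 n) p).source).trans ?_
  have h : chartMeasure n (chartAt (𝔼 n) p) (A \ (chartAt (𝔼 n) p).source) = 0 :=
    measure_mono_null (fun x hx => hx.2) (chartMeasure_compl_source p)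
  rw [h, add_zero]

theorem integral_riemannianVolume_eq (p : M) {f : M → ℂ}
    (hf : ContinuousOn f (chartAt (𝔼 n) p).source) (h0 : ∀ x ∉ (chartAt (𝔼 n) p).source, f x = 0) :
    ∫ x, f x ∂(riemannianVolume n) = ∫ y in (chartAt (𝔼 n) p).target,
      chartDensity n (chartAt (𝔼 n) p) y • f ((chartAt (𝔼 n) p).symm y) := by
  have hs := (chartAt (𝔼 n) p).open_source.measurableSet
  rw [← setIntegral_eq_integral_of_forall_compl_eq_zero h0]
  have hfm : AEStronglyMeasurable f ((riemannianVolume n).restrict (chartAt (𝔼 n) p).source) :=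
    hf.aestronglyMeasurable hs
  rw [riemannianVolume_restrict_source] at hfm ⊢
  rw [chartMeasure] at hfm ⊢
  rw [integral_map (aemeasurable_chart_symm p (withDensity_absolutelyContinuous _ _)) hfm,
    integral_withDensity_eq_integral_toReal_smul₀ (aemeasurable_chartDensity p)
      (Filter.Eventually.of_forall fun y => ENNReal.ofReal_lt_top)]
  refine setIntegral_congr_fun (chartAt (𝔼 n) p).open_target.measurableSet fun y hy => ?_
  simp only [ENNReal.toReal_ofReal (chartDensity_pos p hy).le]

/-- The vector field `ρ⁻¹ ∂ᵢ` of the chart at `p`, where `ρ` is the Riemannian density. -/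
def coordField (p : M) (i : Fin n) (x : M) : TangentSpace (𝓡 n) x :=
  (chartDensity n (chartAt (𝔼 n) p) (chartAt (𝔼 n) p x))⁻¹ •
    (trivializationAt (𝔼 n) (fun x : M => TangentSpace (𝓡 n) x) p).symmL ℝ x
      (EuclideanSpace.single i (1 : ℝ))

/-- Off its base set the inverse of a trivialization is zero by convention, so the field is defined
on all of `M`. -/
theorem coordField_of_notMem (p : M) (i : Fin n) {x : M} (hx : x ∉ (chartAt (𝔼 n) p).source) :
    coordField p i x = 0 := by
  have h : (trivializationAt (𝔼 n) (fun x : M => TangentSpace (𝓡 n) x) p).symmL ℝ x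
      (EuclideanSpace.single i (1 : ℝ)) = 0 := Trivialization.symmₗ_apply_of_notMem (R := ℝ) _ hx _
  rw [coordField, h, smul_zero]

theorem continuousOn_inv_chartDensity (p : M) :
    ContinuousOn (fun x => (chartDensity n (chartAt (𝔼 n) p) (chartAt (𝔼 n) p x))⁻¹)
      (chartAt (𝔼 n) p).source :=
  ((continuousOn_chartDensity p).comp (chartAt (𝔼 n) p).continuousOn
    (chartAt (𝔼 n) p).mapsTo).inv₀
    fun _ hx => (chartDensity_pos p ((chartAt (𝔼 n) p).map_source hx)).ne'

/-- The fields `ρ⁻¹ ∂ᵢ` are divergence free. -/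
theorem integral_mvfderiv_coordField (p : M) (i : Fin n) {f : M → ℂ}
    (hf : ContMDiff (𝓡 n) 𝓘(ℝ, ℂ) ∞ f) {K : Set M} (hK : IsCompact K)
    (hKs : K ⊆ (chartAt (𝔼 n) p).source) (h0 : ∀ x ∉ K, f x = 0) :
    ∫ x, mvfderiv (𝓡 n) f x (coordField p i x) ∂(riemannianVolume n) = 0 := by
  set e := chartAt (𝔼 n) p
  set w := chartExtension (n := n) p f
  have hw : ContDiff ℝ 1 w := contDiff_chartExtension hf hK hKs h0
  have hwc : HasCompactSupport w := hasCompactSupport_chartExtension hK hKs h0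
  have h1 : ∀ x ∈ e.source, mvfderiv (𝓡 n) f x (coordField p i x) =
      (chartDensity n e (e x))⁻¹ • fderiv ℝ w (e x) (EuclideanSpace.single i 1) := fun x hx => by
    rw [coordField, map_smul, mvfderiv_eq_fderiv_chartExtension hf hK hKs h0 hx]
  have hc : Continuous fun y => fderiv ℝ w y (EuclideanSpace.single i 1) :=
    (hw.continuous_fderiv one_ne_zero).clm_apply continuous_const
  have h2 : ContinuousOn (fun x => mvfderiv (𝓡 n) f x (coordField p i x)) e.source :=
    ((continuousOn_inv_chartDensity p).smul (hc.comp_continuousOn e.continuousOn)).congr h1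
  rw [integral_riemannianVolume_eq p h2 fun x hx => by rw [coordField_of_notMem p i hx, map_zero]]
  -- The factor `ρ⁻¹` of the field cancels the volume density, leaving a pure coordinate derivative.
  -- No derivative of the density appears, so its continuity and positivity suffice.
  have h3 : ∫ y in e.target, chartDensity n e y •
      mvfderiv (𝓡 n) f (e.symm y) (coordField p i (e.symm y)) =
      ∫ y in e.target, fderiv ℝ w y (EuclideanSpace.single i 1) := by
    refine setIntegral_congr_fun e.open_target.measurableSet fun y hy => ?_
    rw [h1 _ (e.map_target hy), e.right_inv hy, smul_inv_smul₀ (chartDensity_pos p hy).ne']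
  rw [h3, setIntegral_eq_integral_of_forall_compl_eq_zero, integral_fderiv_eq_zero hw hwc]
  intro y hy
  -- The support of `w` lies in the image of `K`, inside the target, so the integral may be taken
  -- over the whole Euclidean space.
  have h4 : y ∉ tsupport w := by
    intro h
    have h5 : tsupport w ⊆ e '' K := closure_minimal (fun z hz => by
      by_contra h6
      exact hz (chartExtension_eq_zero hK hKs h0 h6)) (isCompact_chart_image hK hKs h0).isClosed
    obtain ⟨x, hx, rfl⟩ := h5 h
    exact hy (e.map_source (hKs hx))
  rw [fderiv_of_notMem_tsupport (𝕜 := ℝ) h4]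
  rfl

end Divergence

/-! ### Continuity of scaled sections and of extensions by zero -/

section ContinuousSections

variable {B : Type*} [TopologicalSpace B] {F : Type*} [NormedAddCommGroup F] [NormedSpace ℝ F]
  {E : B → Type*} [∀ x, AddCommGroup (E x)] [∀ x, Module ℝ (E x)]
  [TopologicalSpace (TotalSpace F E)] [∀ x, TopologicalSpace (E x)] [FiberBundle F E]
  [VectorBundle ℝ F E]

theorem continuousOn_smul_section {s : Set B} {c : B → ℝ} {u : Π x, E x} (hc : ContinuousOn c s)
    (hu : ContinuousOn (fun x => TotalSpace.mk' F x (u x)) s) :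
    ContinuousOn (fun x => TotalSpace.mk' F x (c x • u x)) s := by
  intro x hx
  have h := hu x hx
  rw [FiberBundle.continuousWithinAt_totalSpace] at h ⊢
  refine ⟨h.1, ((hc x hx).smul h.2).congr_of_eventuallyEq ?_ ?_⟩
  · filter_upwards [mem_nhdsWithin_of_mem_nhds ((trivializationAt F E x).open_baseSet.mem_nhds
      (FiberBundle.mem_baseSet_trivializationAt' x))] with y hy
    exact ((trivialization_linear ℝ (trivializationAt F E x)).linear y hy).map_smul (c y) (u y)
  · exact ((trivialization_linear ℝ (trivializationAt F E x)).linear x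
      (FiberBundle.mem_baseSet_trivializationAt' x)).map_smul (c x) (u x)

theorem continuous_section_of_eq_zero {U K : Set B} (hU : IsOpen U) (hK : IsClosed K) (hKU : K ⊆ U)
    {u : Π x, E x} (hu : ContinuousOn (fun x => TotalSpace.mk' F x (u x)) U)
    (h0 : ∀ x ∉ K, u x = 0) : Continuous (fun x => TotalSpace.mk' F x (u x)) := by
  rw [continuous_iff_continuousAt]
  intro x
  by_cases hx : x ∈ U
  · exact hu.continuousAt (hU.mem_nhds hx)
  · refine (Trivialization.continuous_zeroSection (F := F) (E := E) ℝ).continuousAt.congr ?_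
    filter_upwards [hK.isOpen_compl.mem_nhds fun h => hx (hKU h)] with y hy
    rw [h0 y hy]
    rfl

end ContinuousSections

/-! ### Test tensors and sections orthogonal to all test sections -/

section Closable

local notation "𝔼" n:max => EuclideanSpace ℝ (Fin n)

variable {n : ℕ} {M : Type*} [TopologicalSpace M] [ChartedSpace (𝔼 n) M]
  [IsManifold (𝓡 n) ∞ M]
  [RiemannianBundle (fun x : M => TangentSpace (𝓡 n) x)]
  [IsContMDiffRiemannianBundle (𝓡 n) ∞ (𝔼 n) (fun x : M => TangentSpace (𝓡 n) x)]
  {F : Type*} [NormedAddCommGroup F] [NormedSpace ℂ F] [FiniteDimensional ℂ F]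
  {V : M → Type*} [TopologicalSpace (TotalSpace F V)] [∀ x, NormedAddCommGroup (V x)]
  [∀ x, InnerProductSpace ℂ (V x)] [FiberBundle F V] [VectorBundle ℝ F V] [VectorBundle ℂ F V]
  [ContMDiffVectorBundle ∞ F V (𝓡 n)] [IsSmoothHermitianBundle F V n]

/-- The element `⟨X, ·⟩ ⊗ s` of `T*M ⊗ V`. -/
def flatTensor {x : M} (X : TangentSpace (𝓡 n) x) (s : V x) : CotangentTensor V n x :=
  (innerSL ℝ X).smulRight s

/-- Expanding `X` in the orthonormal basis that defines the inner product gives the identity. It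
turns pairings in `T*M ⊗ V` into pairings in `V` with the derivative along `X`. -/
theorem inner_flatTensor {x : M} (X : TangentSpace (𝓡 n) x) (s : V x) (A : CotangentTensor V n x) :
    inner ℂ (flatTensor X s) A = inner ℂ s (A.toHom V n X) := by
  set e := stdOrthonormalBasis ℝ (TangentSpace (𝓡 n) x)
  have h1 : inner ℂ (flatTensor X s) A =
      ∑ i, inner ℂ ((flatTensor X s).toHom V n (e i)) (A.toHom V n (e i)) := rfl
  rw [h1]
  conv_rhs => rw [← e.sum_repr X, map_sum, inner_sum]
  refine Finset.sum_congr rfl fun i _ => ?_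
  have h2 : (flatTensor X s).toHom V n (e i) = inner ℝ X (e i) • s := rfl
  rw [h2, map_smul, e.repr_apply_apply, ← Complex.coe_smul, ← Complex.coe_smul, inner_smul_left,
    inner_smul_right, Complex.conj_ofReal, real_inner_comm]

theorem continuousOn_flatTensor {U : Set M} {X : Π x : M, TangentSpace (𝓡 n) x} {s : Π x, V x}
    (hX : ContinuousOn (fun x => TotalSpace.mk' (𝔼 n) (E := fun x : M => TangentSpace (𝓡 n) x)
      x (X x)) U)
    (hs : ContinuousOn (fun x => TotalSpace.mk' F x (s x)) U) :
    ContinuousOn (fun x => TotalSpace.mk' (𝔼 n →L[ℝ] F)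
      (E := fun x : M => TangentSpace (𝓡 n) x →L[ℝ] V x) x (flatTensor (X x) (s x))) U := by
  have := isContinuousRiemannianBundle_tangent (n := n) (M := M)
  intro x₀ hx₀
  set eT := trivializationAt (𝔼 n) (fun x : M => TangentSpace (𝓡 n) x) x₀
  set eV := trivializationAt F V x₀
  have hT : eT.baseSet ∈ 𝓝 x₀ := eT.open_baseSet.mem_nhds (FiberBundle.mem_baseSet_trivializationAt' x₀)
  have hV : eV.baseSet ∈ 𝓝 x₀ := eV.open_baseSet.mem_nhds (FiberBundle.mem_baseSet_trivializationAt' x₀)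
  rw [continuousWithinAt_hom_bundle]
  refine ⟨continuousWithinAt_id, ?_⟩
  -- The model tangent space is finite dimensional, so continuity of an operator-valued map may be
  -- tested on each fixed vector.
  rw [continuousWithinAt_clm_apply]
  intro w
  have h1 : ContinuousAt (fun x => TotalSpace.mk' (𝔼 n)
      (E := fun x : M => TangentSpace (𝓡 n) x) x (eT.symm x w)) x₀ := by
    have h := eT.continuousOn_symm.comp (s := eT.baseSet) (f := fun x : M => (x, w)) (by fun_prop)
      (fun x hx => ⟨hx, mem_univ _⟩)
    exact h.continuousAt hT
  have h2 : ContinuousWithinAt (fun x => (inner ℝ (X x) (eT.symm x w) : ℝ)) U x₀ :=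
    (hX x₀ hx₀).inner_bundle h1.continuousWithinAt
  have h3 := ((FiberBundle.continuousWithinAt_totalSpace F _).1 (hs x₀ hx₀)).2
  have key : ∀ x ∈ eT.baseSet ∩ eV.baseSet, ContinuousLinearMap.inCoordinates (𝔼 n)
      (fun x : M => TangentSpace (𝓡 n) x) F V x₀ x x₀ x (flatTensor (V := V) (X x) (s x)) w =
      (inner ℝ (X x) (eT.symm x w) : ℝ) • (eV ⟨x, s x⟩).2 := by
    intro x hx
    change eV.continuousLinearMapAt ℝ x ((inner ℝ (X x) (eT.symmL ℝ x w) : ℝ) • s x) = _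
    rw [Trivialization.symmL_apply _ hx.1]
    rw [map_smul, Trivialization.continuousLinearMapAt_apply_of_mem ℝ _ hx.2]
  refine (h2.smul h3).congr_of_eventuallyEq ?_ ?_
  · filter_upwards [mem_nhdsWithin_of_mem_nhds (Filter.inter_mem hT hV)] with x hx
    exact key x hx
  · exact key x₀ ⟨mem_of_mem_nhds hT, mem_of_mem_nhds hV⟩

theorem contMDiff_inner_section {u v : Π x, V x} (hu : u ∈ smoothSections n F V)
    (hv : v ∈ smoothSections n F V) :
    ContMDiff (𝓡 n) 𝓘(ℝ, ℂ) ∞ (fun x => inner ℂ (u x) (v x)) := by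
  obtain ⟨h, hc, hh⟩ := IsSmoothHermitianBundle.exists_contMDiff (F := F) (V := V) (n := n)
  simp only [hh]
  have h1 : ContMDiff (𝓡 n) ((𝓡 n).prod 𝓘(ℝ, ℂ)) ∞ (fun x => TotalSpace.mk' ℂ
      (E := Bundle.Trivial M ℂ) x (h x (u x) (v x))) :=
    ContMDiff.clm_bundle_apply₂ (F₁ := F) (F₂ := F) hc hu hv
  intro x
  exact (contMDiffAt_totalSpace.1 (h1 x)).2

variable [MeasurableSpace M] [BorelSpace M] [SecondCountableTopology M]

theorem mem_sqIntegrable_sectionField {u : Π x, V x}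
    (hu : Continuous fun x => TotalSpace.mk' F x (u x)) {K : Set M} (hK : IsCompact K)
    (hKc : IsClosed K) (h0 : ∀ x ∉ K, u x = 0) : u ∈ (sectionField n F V).sqIntegrable := by
  refine ⟨IsMeasurableSection.of_continuous F V hu, ?_⟩
  have hc : Continuous (fun x => ‖u x‖ ^ 2) := by
    have h1 : Continuous (fun x => inner ℂ (u x) (u x)) := by
      rw [← continuousOn_univ]
      exact continuousOn_inner (F := F) (n := n) hu.continuousOn hu.continuousOn
    refine (Complex.continuous_re.comp h1).congr fun x => ?_
    exact inner_self_eq_norm_sq (𝕜 := ℂ) (u x)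
  have hs : HasCompactSupport fun x => ‖u x‖ ^ 2 :=
    hK.of_isClosed_subset isClosed_closure (closure_minimal (fun x hx => by
      by_contra h
      exact hx (by simp [h0 x h])) hKc)
  refine lt_of_eq_of_lt (lintegral_congr fun x => ?_)
    (hc.integrable_of_hasCompactSupport (μ := riemannianVolume n) hs).2
  rw [enorm_pow, enorm_norm]

theorem mem_sqIntegrable_cotangentField {A : Π x : M, CotangentTensor V n x}
    (hA : Continuous fun x => TotalSpace.mk' (𝔼 n →L[ℝ] F)
      (E := fun x : M => TangentSpace (𝓡 n) x →L[ℝ] V x) x (A x)) {K : Set M} (hK : IsCompact K)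
    (hKc : IsClosed K) (h0 : ∀ x ∉ K, A x = 0) : A ∈ (cotangentField n F V).sqIntegrable := by
  refine ⟨IsMeasurableSection.of_continuous (𝔼 n →L[ℝ] F)
      (fun x : M => TangentSpace (𝓡 n) x →L[ℝ] V x) hA, ?_⟩
  have hc : Continuous (fun x => ‖A x‖ ^ 2) := by
    have h1 : Continuous (fun x => inner ℂ (A x) (A x)) :=
      continuous_inner_cotangent (F := F) hA hA
    refine (Complex.continuous_re.comp h1).congr fun x => ?_
    exact inner_self_eq_norm_sq (𝕜 := ℂ) (A x)
  have hs : HasCompactSupport fun x => ‖A x‖ ^ 2 :=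
    hK.of_isClosed_subset isClosed_closure (closure_minimal (fun x hx => by
      by_contra h
      exact hx (by simp [h0 x h])) hKc)
  refine lt_of_eq_of_lt (lintegral_congr fun x => ?_)
    (hc.integrable_of_hasCompactSupport (μ := riemannianVolume n) hs).2
  rw [enorm_pow, enorm_norm]

variable [T2Space M]

variable (n F) in
/-- A section which is orthogonal to all test sections supported in the open set `U` vanishes
almost everywhere on `U`. -/
theorem ae_eq_zero_of_integral_inner_eq_zero {U : Set M} (hU : IsOpen U) {w : Π x, V x}
    (hint : ∀ s ∈ compactlySupportedSections n F V, closure {x | s x ≠ 0} ⊆ U →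
      Integrable (fun x => inner ℂ (s x) (w x)) (riemannianVolume n))
    (h0 : ∀ s ∈ compactlySupportedSections n F V, closure {x | s x ≠ 0} ⊆ U →
      ∫ x, inner ℂ (s x) (w x) ∂(riemannianVolume n) = 0) :
    ∀ᵐ x ∂(riemannianVolume n : Measure M), x ∈ U → w x = 0 := by
  have : LocallyCompactSpace M := ChartedSpace.locallyCompactSpace (𝔼 n) M
  rw [ae_iff]
  refine measure_null_of_locally_null _ fun p hp => ?_
  have hpU : p ∈ U := by
    by_contra h
    exact hp fun h' => absurd h' h
  obtain ⟨s, hs, hsU, hev⟩ := exists_testSections (n := n) (F := F) (V := V) p (hU.mem_nhds hpU)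
  -- Test sections may be multiplied by any compactly supported smooth function `g`, so the scalar
  -- function `h(s j, w)` integrates to zero against all such `g`.
  have h1 : ∀ j, ∀ᵐ x ∂(riemannianVolume n : Measure M), inner ℂ (s j x) (w x) = 0 := by
    intro j
    refine ae_eq_zero_of_integral_contMDiff_smul_eq_zero (𝓡 n)
      (hint _ (hs j) (hsU j)).locallyIntegrable fun g hg hgc => ?_
    have hsub : closure {x | (g • s j) x ≠ 0} ⊆ U := by
      refine (closure_mono ?_).trans (hsU j)
      exact fun x hx h => hx (by simp [h])
    rw [← h0 (g • s j) (smul_mem_compactlySupportedSections hg hgc (hs j).1) hsub]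
    refine integral_congr_ae (Filter.Eventually.of_forall fun x => ?_)
    simp only [Pi.smul_apply']
    rw [← Complex.coe_smul (g x) (s j x), inner_smul_left, Complex.conj_ofReal, Complex.real_smul]
  refine ⟨{x | ¬ (x ∈ U → w x = 0)} ∩
    {x | ∀ w : V x, (∀ j, inner ℂ (s j x) w = 0) → w = 0},
    Filter.inter_mem self_mem_nhdsWithin (mem_nhdsWithin_of_mem_nhds hev), ?_⟩
  have h2 := ae_all_iff.2 h1
  rw [ae_iff] at h2
  refine measure_mono_null ?_ h2
  rintro x ⟨hx1, hx2⟩ hx3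
  exact hx1 fun _ => hx2 _ hx3

/-! ### Dense domain and closability of the connection -/

namespace SmoothConnection

variable (D : SmoothConnection n F V)

theorem mem_graph_nablaOn {S : Submodule ℂ (Π x, V x)} {hS : S ≤ D.S1}
    (z : L2Section n F V × L2Cotangent n F V) : z ∈ (D.nablaOn S hS).graph ↔
      ∃ u : D.PreSobolev S hS,
        (D.toL2 (PreSobolev.toS1 D u), D.gradL2 (PreSobolev.toS1 D u)) = z := by
  set E := LinearEquiv.ofInjective (D.toL2 ∘ₗ Submodule.inclusion hS)
    (D.toL2_injective.comp (Submodule.inclusion_injective hS))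
  have h : ∀ u : S, D.nablaOn S hS (E u) = D.gradL2 (Submodule.inclusion hS u) := fun u => by
    change D.gradL2 (Submodule.inclusion hS (E.symm (E u))) = _
    rw [E.symm_apply_apply]
  rw [LinearPMap.mem_graph_iff]
  constructor
  · rintro ⟨y, hy1, hy2⟩
    obtain ⟨u, rfl⟩ := E.surjective y
    exact ⟨u, Prod.ext hy1 ((h u).symm.trans hy2)⟩
  · rintro ⟨u, rfl⟩
    exact ⟨E u, rfl, h u⟩

/-- The domain contains all test sections, and an `L²` section orthogonal to these is zero almost
everywhere. -/
theorem dense_domain_nabla2 : Dense (D.nabla2.domain : Set (L2Section n F V)) := by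
  rw [Submodule.dense_iff_topologicalClosure_eq_top, Submodule.topologicalClosure_eq_top_iff,
    Submodule.eq_bot_iff]
  intro f hf
  obtain ⟨w, rfl⟩ := (sectionField n F V).toL2_surjective f
  rw [(sectionField n F V).toL2_eq_zero_iff]
  have h := ae_eq_zero_of_integral_inner_eq_zero n F isOpen_univ (w := w.1) (fun s hs _ => ?_)
    fun s hs _ => ?_
  · filter_upwards [h] with x hx
    exact hx (mem_univ x)
  · exact (sectionField n F V).integrable_inner ⟨s, (D.compactlySupportedSections_le_S1 hs).2.1⟩ w
  · exact (Submodule.mem_orthogonal _ _).1 hf _ ⟨⟨s, D.compactlySupportedSections_le_S1 hs⟩, rfl⟩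

variable {D}

/-- Integration by parts along the field `ρ⁻¹ ∂ᵢ`. -/
theorem IsCompatible.integral_add_eq_zero (hD : D.IsCompatible) (p : M) (i : Fin n) {s u : Π x, V x}
    (hs : s ∈ compactlySupportedSections n F V)
    (hsp : closure {x | s x ≠ 0} ⊆ (chartAt (𝔼 n) p).source) (hu : u ∈ smoothSections n F V) :
    ∫ x, (inner ℂ (D.toFun s x (coordField p i x)) (u x) +
      inner ℂ (s x) (D.toFun u x (coordField p i x))) ∂(riemannianVolume n) = 0 := by
  rw [← integral_mvfderiv_coordField p i (contMDiff_inner_section hs.1 hu) hs.2 hsp]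
  · exact integral_congr_ae (Filter.Eventually.of_forall fun x =>
      (hD s hs.1 u hu x (coordField p i x)).symm)
  · intro x hx
    have : s x = 0 := by
      by_contra h
      exact hx (subset_closure h)
    rw [this, inner_zero_left]

theorem continuousOn_coordField (p : M) (i : Fin n) :
    ContinuousOn (fun x => TotalSpace.mk' (𝔼 n) (E := fun x : M => TangentSpace (𝓡 n) x)
      x (coordField p i x)) (chartAt (𝔼 n) p).source := by
  refine (continuousOn_smul_section (continuousOn_inv_chartDensity p)
    (continuousOn_frame p i)).congr fun x hx => ?_
  rw [coordField, Trivialization.symmL_apply _ hx]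

variable (D) in
theorem toFun_eq_zero_of_notMem {s : Π x, V x} (hs : s ∈ smoothSections n F V) {x : M}
    (hx : x ∉ closure {x | s x ≠ 0}) : D.toFun s x = 0 := by
  have h1 : ∀ᶠ y in 𝓝 x, s y = (0 : Π x, V x) y := by
    filter_upwards [isClosed_closure.isOpen_compl.mem_nhds hx] with y hy
    by_contra h
    exact hy (subset_closure h)
  exact (D.isCovariantDerivativeOnUniv.congr_of_eventuallyEq
    (hs.mdifferentiableAt (by simp)) (mdifferentiableAt_zeroSection ..) Filter.univ_mem h1).trans
    D.isCovariantDerivativeOnUniv.zero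

section TestTensor

variable {p : M} {s : Π x, V x} (hs : s ∈ compactlySupportedSections n F V)
  (hsp : closure {x | s x ≠ 0} ⊆ (chartAt (𝔼 n) p).source)
include hs hsp

/-- The coordinate field is continuous only on the chart domain, but `s` is supported in a compact
subset of it, so the product is continuous with compact support. -/
theorem flatTensor_mem_sqIntegrable (i : Fin n) :
    (fun x => flatTensor (coordField p i x) (s x)) ∈ (cotangentField n F V).sqIntegrable := by
  have h0 : ∀ x ∉ closure {x | s x ≠ 0}, flatTensor (coordField p i x) (s x) = 0 := fun x hx => by
    have : s x = 0 := by
      by_contra h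
      exact hx (subset_closure h)
    rw [this]
    exact ContinuousLinearMap.ext fun v => smul_zero _
  exact mem_sqIntegrable_cotangentField (continuous_section_of_eq_zero
    (chartAt (𝔼 n) p).open_source isClosed_closure hsp (continuousOn_flatTensor
    (continuousOn_coordField p i) hs.1.continuous.continuousOn) h0) hs.2 isClosed_closure h0

variable (D) in
theorem toFun_coordField_mem_sqIntegrable (i : Fin n) :
    (fun x => D.toFun s x (coordField p i x)) ∈ (sectionField n F V).sqIntegrable := by
  have h0 : ∀ x ∉ closure {x | s x ≠ 0}, D.toFun s x (coordField p i x) = 0 := fun x hx => by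
    rw [D.toFun_eq_zero_of_notMem hs.1 hx]
    rfl
  exact mem_sqIntegrable_sectionField (continuous_section_of_eq_zero
    (chartAt (𝔼 n) p).open_source isClosed_closure hsp
    ((D.continuous_nabla hs.1).continuousOn.clm_bundle_apply (continuousOn_coordField p i)) h0)
    hs.2 isClosed_closure h0

/-- The formal adjoint of `∇` on the tensors `Xᵢ♭ ⊗ s` is `-∇_{Xᵢ}s`, with no term of order zero
since `Xᵢ` is divergence free. The right side is continuous in `u` for the `L²` norm. -/
theorem IsCompatible.inner_gradL2 (hD : D.IsCompatible) (i : Fin n) (u : D.S1) :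
    inner ℂ ((cotangentField n F V).toL2 ⟨_, flatTensor_mem_sqIntegrable hs hsp i⟩) (D.gradL2 u) =
      - inner ℂ ((sectionField n F V).toL2 ⟨_, D.toFun_coordField_mem_sqIntegrable hs hsp i⟩)
        (D.toL2 u) := by
  have h := hD.integral_add_eq_zero p i hs hsp u.2.1
  have h1 := (cotangentField n F V).integrable_inner
    ⟨_, flatTensor_mem_sqIntegrable hs hsp i⟩ ⟨D.nabla u.1, u.2.2.2⟩
  have h2 : Integrable (fun x => inner ℂ (D.toFun s x (coordField p i x)) (u.1 x))
      (riemannianVolume n) := (sectionField n F V).integrable_inner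
    ⟨_, D.toFun_coordField_mem_sqIntegrable hs hsp i⟩ ⟨u.1, u.2.2.1⟩
  have h3 : ∀ x, inner ℂ (flatTensor (coordField p i x) (s x)) (D.nabla u.1 x) =
      inner ℂ (s x) (D.toFun u.1 x (coordField p i x)) := fun x => inner_flatTensor _ _ _
  have h4 : Integrable (fun x => inner ℂ (s x) (D.toFun u.1 x (coordField p i x)))
      (riemannianVolume n) := h1.congr (Filter.Eventually.of_forall h3)
  rw [integral_add h2 h4, add_comm] at h
  refine Eq.trans ?_ (eq_neg_of_add_eq_zero_left h)
  exact integral_congr_ae (Filter.Eventually.of_forall h3)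

end TestTensor

/-- The adjoint identity passes to `L²` limits: a vertical vector `(0, v)` in the closure of the
graph has `v` orthogonal to all test tensors, and these are numerous enough to force `v = 0`. -/
theorem IsCompatible.isClosable_nabla2 (hD : D.IsCompatible) : D.nabla2.IsClosable := by
  refine isClosable_of_graph fun y hy => ?_
  obtain ⟨v, rfl⟩ := (cotangentField n F V).toL2_surjective y
  rw [(cotangentField n F V).toL2_eq_zero_iff]
  have hzero : ∀ (p : M) (i : Fin n) (s) (hs : s ∈ compactlySupportedSections n F V)
      (hsp : closure {x | s x ≠ 0} ⊆ (chartAt (𝔼 n) p).source),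
      inner ℂ ((cotangentField n F V).toL2 ⟨_, flatTensor_mem_sqIntegrable hs hsp i⟩)
        ((cotangentField n F V).toL2 v) = 0 := by
    intro p i s hs hsp
    set B := (cotangentField n F V).toL2 ⟨_, flatTensor_mem_sqIntegrable hs hsp i⟩
    set b := (sectionField n F V).toL2 ⟨_, D.toFun_coordField_mem_sqIntegrable hs hsp i⟩
    -- The adjoint identity is a closed condition on the pair `(u, ∇u)`, so it holds on the closure
    -- of the graph, in particular at `(0, v)`.
    have hcl : IsClosed {z : L2Section n F V × L2Cotangent n F V |
        inner ℂ B z.2 + inner ℂ b z.1 = 0} := isClosed_eq (by fun_prop) continuous_const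
    have hsub : (D.nabla2.graph : Set (L2Section n F V × L2Cotangent n F V)) ⊆
        {z | inner ℂ B z.2 + inner ℂ b z.1 = 0} := by
      intro z hz
      obtain ⟨u, rfl⟩ := (D.mem_graph_nablaOn z).1 hz
      exact eq_neg_iff_add_eq_zero.1 (hD.inner_gradL2 hs hsp i (PreSobolev.toS1 D u))
    have h := closure_minimal hsub hcl hy
    simpa using h
  have hp : ∀ p : M, ∀ᵐ x ∂(riemannianVolume n : Measure M), x ∈ (chartAt (𝔼 n) p).source →
      v.1 x = 0 := by
    intro p
    have h1 : ∀ i : Fin n, ∀ᵐ x ∂(riemannianVolume n : Measure M),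
        x ∈ (chartAt (𝔼 n) p).source → (v.1 x).toHom V n (coordField p i x) = 0 := by
      intro i
      refine ae_eq_zero_of_integral_inner_eq_zero n F (chartAt (𝔼 n) p).open_source
        (fun s hs hsp => ?_) fun s hs hsp => ?_
      · refine ((cotangentField n F V).integrable_inner
          ⟨_, flatTensor_mem_sqIntegrable hs hsp i⟩ v).congr (Filter.Eventually.of_forall fun x => ?_)
        exact inner_flatTensor _ _ _
      · rw [← hzero p i s hs hsp]
        exact integral_congr_ae (Filter.Eventually.of_forall fun x =>
          (inner_flatTensor _ _ _).symm)
    -- At almost every point of the chart `v` kills all the `Xᵢ`, which are nonzero multiples of the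
    -- coordinate frame.
    filter_upwards [ae_all_iff.2 h1] with x hx hxp
    obtain ⟨b, hb⟩ := exists_frame_basis p hxp
    refine ContinuousLinearMap.coe_injective (b.ext fun i => ?_)
    have h2 := hx i hxp
    rw [coordField, map_smul, smul_eq_zero_iff_right
      (inv_ne_zero (chartDensity_pos p ((chartAt (𝔼 n) p).map_source hxp)).ne'),
      Trivialization.symmL_apply _ hxp, ← hb] at h2
    exact h2
  rw [ae_iff]
  refine measure_null_of_locally_null _ fun p _ => ⟨{x | ¬ v.1 x = 0} ∩ (chartAt (𝔼 n) p).source,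
    Filter.inter_mem self_mem_nhdsWithin (mem_nhdsWithin_of_mem_nhds
      ((chartAt (𝔼 n) p).open_source.mem_nhds (mem_chart_source _ p))), ?_⟩
  have h := hp p
  rw [ae_iff] at h
  refine measure_mono_null ?_ h
  exact fun x hx h' => hx.1 (h' hx.2)

end SmoothConnection

end Closable

/-- The extension is again isometric, so it is injective with closed range; the range is also dense.
-/
theorem bijective_completion_map {X Y : Type*} [NormedAddCommGroup X] [NormedAddCommGroup Y]
    {j : X → Y} (hj : Isometry j) (hd : DenseRange j) :
    Function.Bijective (UniformSpace.Completion.map j) := by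
  have hi : Isometry (UniformSpace.Completion.map j) := hj.completion_map
  refine ⟨hi.injective, ?_⟩
  rw [← range_eq_univ, ← hi.isClosedEmbedding.isClosed_range.closure_eq]
  refine DenseRange.closure_range ?_
  have h1 : DenseRange ((↑) ∘ j : X → UniformSpace.Completion Y) :=
    UniformSpace.Completion.denseRange_coe.comp hd (UniformSpace.Completion.continuous_coe Y)
  refine h1.mono ?_
  rintro _ ⟨x, rfl⟩
  exact ⟨x, UniformSpace.Completion.map_coe hj.uniformContinuous x⟩

/-! ### The bounded maps from the Sobolev norm to `L²` -/

namespace SmoothConnection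

section Operators

local notation "𝔼" n:max => EuclideanSpace ℝ (Fin n)

variable {n : ℕ} {M : Type*} [TopologicalSpace M] [ChartedSpace (𝔼 n) M]
  [IsManifold (𝓡 n) ∞ M]
  [RiemannianBundle (fun x : M => TangentSpace (𝓡 n) x)]
  [IsContMDiffRiemannianBundle (𝓡 n) ∞ (𝔼 n) (fun x : M => TangentSpace (𝓡 n) x)]
  {F : Type*} [NormedAddCommGroup F] [NormedSpace ℂ F] [FiniteDimensional ℂ F]
  {V : M → Type*} [TopologicalSpace (TotalSpace F V)] [∀ x, NormedAddCommGroup (V x)]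
  [∀ x, InnerProductSpace ℂ (V x)] [FiberBundle F V] [VectorBundle ℝ F V] [VectorBundle ℂ F V]
  [ContMDiffVectorBundle ∞ F V (𝓡 n)] [IsSmoothHermitianBundle F V n]
  [MeasurableSpace M] [BorelSpace M] [SecondCountableTopology M]
  (D : SmoothConnection n F V) (S : Submodule ℂ (Π x, V x)) (hS : S ≤ D.S1)

/-- The inclusion of `S` with the Sobolev norm in `L²(V)`. -/
def sobolevToL2 : D.PreSobolev S hS →L[ℂ] L2Section n F V :=
  (D.toL2 ∘ₗ PreSobolev.toS1 D).mkContinuous 1 fun u => by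
    rw [one_mul, PreSobolev.norm_def]
    exact le_add_of_nonneg_right (norm_nonneg _)

/-- The map `u ↦ ∇u` from `S` with the Sobolev norm to `L²(T*M ⊗ V)`. -/
def sobolevGrad : D.PreSobolev S hS →L[ℂ] L2Cotangent n F V :=
  (D.gradL2 ∘ₗ PreSobolev.toS1 D).mkContinuous 1 fun u => by
    rw [one_mul, PreSobolev.norm_def]
    exact le_add_of_nonneg_left (norm_nonneg _)

theorem isClosable_nablaC_of_nabla2 [T2Space M] (h : D.nabla2.IsClosable) : D.nablaC.IsClosable := by
  refine h.leIsClosable (LinearPMap.le_graph_iff.1 fun z hz => ?_)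
  obtain ⟨u, rfl⟩ := (D.mem_graph_nablaOn z).1 hz
  exact (D.mem_graph_nablaOn _).2 ⟨PreSobolev.toS1 D u, rfl⟩

end Operators

end SmoothConnection

end SobolevBundle
end
-- The Sobolev spaces of a complete manifold
theorem corollary3p8 (n : ℕ) {M : Type*} [EMetricSpace M] [SecondCountableTopology M]
    [MeasurableSpace M] [BorelSpace M]
    [ChartedSpace (EuclideanSpace ℝ (Fin n)) M] [IsManifold (𝓡 n) ∞ M]
    [RiemannianBundle (fun x : M => TangentSpace (𝓡 n) x)]
    [IsContMDiffRiemannianBundle (𝓡 n) ∞ (EuclideanSpace ℝ (Fin n))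
      (fun x : M => TangentSpace (𝓡 n) x)]
    [IsRiemannianManifold (𝓡 n) M] [CompleteSpace M]
    (F : Type*) [NormedAddCommGroup F] [NormedSpace ℂ F] [FiniteDimensional ℂ F]
    (V : M → Type*) [TopologicalSpace (TotalSpace F V)] [∀ x, NormedAddCommGroup (V x)]
    [∀ x, InnerProductSpace ℂ (V x)] [FiberBundle F V] [VectorBundle ℝ F V] [VectorBundle ℂ F V]
    [ContMDiffVectorBundle ∞ F V (𝓡 n)] [SobolevBundle.IsSmoothHermitianBundle F V n]
    (D : SobolevBundle.SmoothConnection n F V) (hD : D.IsCompatible) :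
    Dense (D.nabla2.domain : Set (SobolevBundle.L2Section n F V)) ∧
    D.nabla2.IsClosable ∧ D.nablaC.IsClosable ∧
    -- the canonical maps of the completions `W^{1,2}(V)` and `W_0^{1,2}(V)` to `L²(V)`, which
    -- identify these spaces with the domains of the closed operators, with the graph norms
    ∃ (ι : D.W12 →L[ℂ] SobolevBundle.L2Section n F V)
      (ι₀ : D.W012 →L[ℂ] SobolevBundle.L2Section n F V),
      (∀ u : D.PreSobolev D.S1 le_rfl,
        ι u = D.toL2 (SobolevBundle.SmoothConnection.PreSobolev.toS1 D u)) ∧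
      (∀ u : D.PreSobolev (SobolevBundle.compactlySupportedSections n F V)
          D.compactlySupportedSections_le_S1,
        ι₀ u = D.toL2 (SobolevBundle.SmoothConnection.PreSobolev.toS1 D u)) ∧
      Function.Injective ι ∧ Function.Injective ι₀ ∧
      range ι = D.nabla2.closure.domain ∧
      (∀ (w : D.W12) (hw : ι w ∈ D.nabla2.closure.domain),
        ‖w‖ = ‖ι w‖ + ‖D.nabla2.closure ⟨ι w, hw⟩‖) ∧
      range ι₀ = D.nablaC.closure.domain ∧
      (∀ (w : D.W012) (hw : ι₀ w ∈ D.nablaC.closure.domain),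
        ‖w‖ = ‖ι₀ w‖ + ‖D.nablaC.closure ⟨ι₀ w, hw⟩‖) ∧
      range ι₀ = range ι ∧ Function.Bijective D.w012ToW12 := by
  have h2 := hD.isClosable_nabla2
  have hc := D.isClosable_nablaC_of_nabla2 h2
  -- The Sobolev norm on `C_c^∞` is by definition the restriction of the one on `S₁`, so the
  -- inclusion is isometric, and completeness of `M` makes it dense.
  have hbij : Function.Bijective D.w012ToW12 :=
    SobolevBundle.bijective_completion_map (X := D.PreSobolev
      (SobolevBundle.compactlySupportedSections n F V) D.compactlySupportedSections_le_S1)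
      (Y := D.PreSobolev D.S1 le_rfl) (Isometry.of_dist_eq fun _ _ => rfl) D.denseRange_inclusion
  -- The two maps to `L²` are compatible with the canonical map: they agree on `C_c^∞`, hence on its
  -- completion. With surjectivity of the canonical map this gives equal images.
  have hcomp : ∀ w : D.W012,
      SobolevBundle.extendCompletion (D.sobolevToL2 D.S1 le_rfl) (D.w012ToW12 w) =
      SobolevBundle.extendCompletion (D.sobolevToL2 (SobolevBundle.compactlySupportedSections n F V)
        D.compactlySupportedSections_le_S1) w := by
    intro w
    have hj : Isometry (fun u : D.PreSobolev
        (SobolevBundle.compactlySupportedSections n F V) D.compactlySupportedSections_le_S1 =>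
        (show D.PreSobolev D.S1 le_rfl from
          Submodule.inclusion D.compactlySupportedSections_le_S1 u)) :=
      Isometry.of_dist_eq fun _ _ => rfl
    induction w using UniformSpace.Completion.induction_on with
    | hp =>
      exact isClosed_eq ((ContinuousLinearMap.continuous _).comp
        UniformSpace.Completion.continuous_map) (ContinuousLinearMap.continuous _)
    | ih u =>
      have h3 : D.w012ToW12 u = ((show D.PreSobolev D.S1 le_rfl from
          Submodule.inclusion D.compactlySupportedSections_le_S1 u : D.PreSobolev D.S1 le_rfl) :
          D.W12) := UniformSpace.Completion.map_coe hj.uniformContinuous u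
      rw [h3, SobolevBundle.extendCompletion_coe, SobolevBundle.extendCompletion_coe]
      rfl
  refine ⟨D.dense_domain_nabla2, h2, hc,
    SobolevBundle.extendCompletion (D.sobolevToL2 _ _),
    SobolevBundle.extendCompletion (D.sobolevToL2 _ _),
    fun u => SobolevBundle.extendCompletion_coe _ u,
    fun u => SobolevBundle.extendCompletion_coe _ u,
    SobolevBundle.extendCompletion_injective _ (D.sobolevGrad _ _) (fun _ => rfl) _
      D.mem_graph_nablaOn h2,
    SobolevBundle.extendCompletion_injective _ (D.sobolevGrad _ _) (fun _ => rfl) _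
      D.mem_graph_nablaOn hc,
    SobolevBundle.range_extendCompletion _ (D.sobolevGrad _ _) (fun _ => rfl) _
      D.mem_graph_nablaOn h2,
    SobolevBundle.norm_eq_graphNorm _ (D.sobolevGrad _ _) (fun _ => rfl) _
      D.mem_graph_nablaOn h2,
    SobolevBundle.range_extendCompletion _ (D.sobolevGrad _ _) (fun _ => rfl) _
      D.mem_graph_nablaOn hc,
    SobolevBundle.norm_eq_graphNorm _ (D.sobolevGrad _ _) (fun _ => rfl) _
      D.mem_graph_nablaOn hc, ?_, hbij⟩
  ext x
  constructor
  · rintro ⟨w, rfl⟩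
    exact ⟨_, hcomp w⟩
  · rintro ⟨w, rfl⟩
    obtain ⟨v, rfl⟩ := hbij.2 w
    exact ⟨v, (hcomp v).symm⟩
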